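/- Let $d\ge 1$, $\Omega=[0,1)^d$, and let $a:\mathbb R^d\to\mathbb R$, $\mu:\mathbb R^d\times\mathbb R^d\to\mathbb R$ be measurable and satisfy, for all $x,y\in\mathbb R^d$ and $m,n\in\mathbb Z^d$, $$a\in L_1(\mathbb R^d),\quad \operatorname{mes}\{a\ne 0\}>0,\quad a(x)\ge 0,\quad a(-x)=a(x),$$ $$0<\mu_-\le\mu(x,y)\le\mu_+<\infty,\quad \mu(x,y)=\mu(y,x),\quad \mu(x+m,y+n)=\mu(x,y),$$ $$M_k=\int_{\mathbb R^d}|x|^k a(x)\,dx<\infty,\quad k=1,2,3.$$ For $\xi\in\mathbb R^d$ let $\mathbb A(\xi)$ be the bounded operator in the complex space $L_2(\Omega)$ $$(\mathbb A(\xi)u)(x)=p(x)u(x)-\int_\Omega \tilde a(\xi,x-y)\mu(x,y)u(y)\,dy,$$ $$p(x)=\int_{\mathbb R^d}a(x-y)\mu(x,y)\,dy,\qquad \tilde a(\xi,z)=\sum_{n\in\mathbb Z^d}a(z+n)e^{-i\langle\xi,z+n\rangle}.$$ Put $\mathcal A_\pi(a)=\inf_{|y|\ge\pi}\int_{\mathbb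 R^d}(1-\cos\langle z,y\rangle)a(z)\,dz$, $\;d_0=\operatorname{dist}\bigl(0,\sigma(\mathbb A(0))\setminus\{0\}\bigr)$, and $$\delta_0=\min\{1,\;3^{-1}2^{-d}M_1^{-1}\mu_+^{-1}\mu_-\mathcal A_\pi(a)\}.$$ Let $P$ be the orthogonal projector onto $\operatorname{Ker}\mathbb A(0)$. Let $F(\xi)$, for $|\xi|\le\delta_0$, be the spectral projector of $\mathbb A(\xi)$ for the interval $[0,d_0/3]$. Then $\operatorname{Ker}\mathbb A(0)$ is the space of constants; $\mathcal A_\pi(a)>0$ and $d_0\ge\mu_-\mathcal A_\pi(a)$; the operators $\mathbb A(\xi)$ are self-adjoint; for $|\xi|\le\delta_0$ the indicator function of $[0,d_0/3]$ is continuous on $\sigma(\mathbb A(\xi))$ (so that $F(\xi)$ is the value of the continuous functional calculus at this function); and for each $j=1,\dots,d$ the cell problem $$\int_{\mathbb R^d}a(x-y)\mu(x,y)(v_j(x)-v_j(y))\,dy=\int_{\mathbb R^d}a(x-y)\mu(x,y)(x_j-y_j)\,dy\ \text{ for a.e. }x\in\Omega,\qquad \int_\Omega v_j\,dx=0,$$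 has a unique solution $v_j\in L_2(\Omega)$, where $v_j$ is extended $\mathbb Z^d$-periodically to $\mathbb R^d$. Put $$g_{ij}=\int_\Omega dx\int_{\mathbb R^d}dy\,\bigl((x_i-y_i)(x_j-y_j)-v_j(x)(x_i-y_i)-v_i(x)(x_j-y_j)\bigr)a(x-y)\mu(x,y).$$ For all $\xi\in\mathbb R^d$ with $|\xi|\le\delta_0$, in the operator norm of $L_2(\Omega)$, $$\|F(\xi)-P\|\le C_1(d_0)\,|\xi|,\qquad \Bigl\|\mathbb A(\xi)F(\xi)-\tfrac12\sum_{i,j=1}^d g_{ij}\xi_i\xi_j\,P\Bigr\|\le C_2(d_0)\,|\xi|^3,$$ where $$C_1(D)=6(\pi+2)\pi^{-1}2^dD^{-1}\mu_+M_1,$$ $$C_2(D)=\frac{\pi+2}{2\pi}\Bigl(\mu_+M_3+\frac{\mu_+^2}{D}(3M_2+M_3)(12M_1+3M_2+M_3)+\frac{\mu_+^3}{D^2}(6M_1+3M_2+M_3)^3\Bigr).$$ Moreover $C_i(d_0)\le C_i(\mu_-\mathcal A_\pi(a))$ for $i=1,2$, so that both constants are controlled by $d$, $\mu_-$, $\mu_+$,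 $M_1$, $M_2$, $M_3$ and $\mathcal A_\pi(a)$ only. -/

import Mathlib

open MeasureTheory Set
open scoped ENNReal NNReal

namespace NonlocalHomogenization

/-- Euclidean space `ℝ^d`. -/
abbrev E (d : ℕ) : Type := EuclideanSpace ℝ (Fin d)

/-- An element of the lattice `ℤ^d`, viewed in `ℝ^d`. -/
def latt {d : ℕ} (n : Fin d → ℤ) : E d := WithLp.toLp 2 (fun i => (n i : ℝ))

/-- The periodicity cell `Ω = [0,1)^d`. -/
def cell (d : ℕ) : Set (E d) := {x | ∀ i, x i ∈ Ico (0 : ℝ) 1}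

/-- Lebesgue measure on the cell `Ω`. -/
noncomputable abbrev cellMeasure (d : ℕ) : Measure (E d) := volume.restrict (cell d)

/-- The complex Hilbert space `L₂(Ω)`. -/
noncomputable abbrev L2 (d : ℕ) := Lp ℂ 2 (cellMeasure d)

/-- The standing assumptions on the coefficients `a`, `μ` and the bounds `μm = μ₋`, `μp = μ₊`. -/
structure Admissible {d : ℕ} (a : E d → ℝ) (μ : E d → E d → ℝ) (μm μp : ℝ) : Prop where
  integrable_a : Integrable a
  support_pos : 0 < volume {x | a x ≠ 0}
  nonneg : ∀ x, 0 ≤ a x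
  even : ∀ x, a (-x) = a x
  measurable_μ : AEStronglyMeasurable (Function.uncurry μ) (volume.prod volume)
  μm_pos : 0 < μm
  le_μ : ∀ x y, μm ≤ μ x y
  μ_le : ∀ x y, μ x y ≤ μp
  symm : ∀ x y, μ x y = μ y x
  periodic : ∀ x y (m n : Fin d → ℤ), μ (x + latt m) (y + latt n) = μ x y
  integrable_moment : ∀ k ∈ ({1, 2, 3} : Set ℕ), Integrable (fun x => ‖x‖ ^ k * a x)

/-- The moments `M_k(a) = ∫ |x|^k a(x) dx`. -/
noncomputable def moment {d : ℕ} (k : ℕ) (a : E d → ℝ) : ℝ := ∫ x, ‖x‖ ^ k * a x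

/-- The symbol `Â(y) = ∫ (1 - cos⟨z,y⟩) a(z) dz`. -/
noncomputable def symbolA {d : ℕ} (a : E d → ℝ) (y : E d) : ℝ :=
  ∫ z, (1 - Real.cos (inner ℝ z y)) * a z

/-- `𝒜_r(a)`, the infimum of `Â(y)` over `|y| ≥ r`. -/
noncomputable def calA {d : ℕ} (r : ℝ) (a : E d → ℝ) : ℝ :=
  sInf (symbolA a '' {y | r ≤ ‖y‖})

/-- `ã(ξ,z) = ∑_{n ∈ ℤ^d} a(z+n) exp(-i⟨ξ,z+n⟩)`. -/
noncomputable def aTilde {d : ℕ} (a : E d → ℝ) (ξ z : E d) : ℂ :=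
  ∑' n : Fin d → ℤ, (a (z + latt n) : ℂ) *
    Complex.exp (-Complex.I * ((inner ℝ ξ (z + latt n) : ℝ) : ℂ))

/-- The potential `p(x) = ∫ a(x-y) μ(x,y) dy`. -/
noncomputable def potential {d : ℕ} (a : E d → ℝ) (μ : E d → E d → ℝ) (x : E d) : ℝ :=
  ∫ y, a (x - y) * μ x y

/-- `(𝔹(ξ)u)(x) = ∫_Ω ã(ξ,x-y) μ(x,y) u(y) dy`. -/
noncomputable def actB {d : ℕ} (a : E d → ℝ) (μ : E d → E d → ℝ) (ξ : E d) (u : E d → ℂ)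
    (x : E d) : ℂ :=
  ∫ y in cell d, aTilde a ξ (x - y) * (μ x y : ℂ) * u y

/-- `(𝔸(ξ)u)(x) = p(x) u(x) - (𝔹(ξ)u)(x)`. -/
noncomputable def actA {d : ℕ} (a : E d → ℝ) (μ : E d → E d → ℝ) (ξ : E d) (u : E d → ℂ)
    (x : E d) : ℂ :=
  (potential a μ x : ℂ) * u x - actB a μ ξ u x

section Helpers

theorem measurableSet_cell (d : ℕ) : MeasurableSet (cell d) := by
  have : cell d = ⋂ i, (fun x : E d => x i) ⁻¹' Ico (0 : ℝ) 1 := by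
    ext x; simp [cell]
  rw [this]
  refine MeasurableSet.iInter fun i => ?_
  have hm : Measurable (fun x : E d => x i) := by fun_prop
  exact hm measurableSet_Ico

theorem latt_injOn_cell {d : ℕ} (w : E d) (m n : Fin d → ℤ)
    (hm : w + latt m ∈ cell d) (hn : w + latt n ∈ cell d) : m = n := by
  funext i
  have h1 := hm i
  have h2 := hn i
  simp only [latt, PiLp.add_apply, mem_Ico] at h1 h2
  have h3 : (m i : ℝ) < n i + 1 := by linarith
  have h4 : (n i : ℝ) < m i + 1 := by linarith
  have h5 : m i < n i + 1 := by exact_mod_cast h3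
  have h6 : n i < m i + 1 := by exact_mod_cast h4
  omega

theorem tsum_indicator_cell_le {d : ℕ} (w : E d) :
    ∑' n : Fin d → ℤ, (cell d).indicator (fun _ => (1 : ℝ≥0∞)) (w + latt n) ≤ 1 := by
  by_cases h : ∃ n : Fin d → ℤ, w + latt n ∈ cell d
  · obtain ⟨n, hn⟩ := h
    rw [tsum_eq_single n]
    · exact indicator_le_self' (fun _ _ => zero_le_one) _ |>.trans le_rfl
    · intro m hm
      exact indicator_of_notMem (fun hc => hm (latt_injOn_cell w m n hc hn)) _
  · push Not at h
    simp [indicator_of_notMem (h _)]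

/-- `∑_n ‖a(z+n)‖`. -/
noncomputable def absSum {d : ℕ} (a : E d → ℝ) (z : E d) : ℝ≥0∞ :=
  ∑' n : Fin d → ℤ, ‖a (z + latt n)‖ₑ

theorem enorm_aTilde_le {d : ℕ} (a : E d → ℝ) (ξ z : E d) : ‖aTilde a ξ z‖ₑ ≤ absSum a z := by
  refine enorm_tsum_le_tsum_enorm.trans (le_of_eq (tsum_congr fun n => ?_))
  rw [enorm_mul]
  have h1 : ‖Complex.exp (-Complex.I * ((inner ℝ ξ (z + latt n) : ℝ) : ℂ))‖ₑ = 1 := by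
    rw [← ofReal_norm, Complex.norm_exp]
    simp
  rw [h1, mul_one]
  rw [← ofReal_norm, ← ofReal_norm, Complex.norm_real]

theorem lintegral_absSum_left {d : ℕ} {a : E d → ℝ} (ha : AEStronglyMeasurable a volume)
    (x : E d) : ∫⁻ y in cell d, absSum a (x - y) ≤ ∫⁻ z, ‖a z‖ₑ := by
  have hae : AEMeasurable (fun z => ‖a z‖ₑ) volume := ha.enorm
  have hq : ∀ n : Fin d → ℤ, AEMeasurable (fun y => ‖a (x - y + latt n)‖ₑ) volume := by
    intro n
    have h := hae.comp_quasiMeasurePreserving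
      (quasiMeasurePreserving_sub_left_of_right_invariant volume (x + latt n))
    refine h.congr (Filter.Eventually.of_forall fun y => ?_)
    simp only [Function.comp]
    congr 2; abel
  unfold absSum
  rw [lintegral_tsum (fun n => (hq n).restrict)]
  have hstep : ∀ n : Fin d → ℤ, ∫⁻ y in cell d, ‖a (x - y + latt n)‖ₑ
      = ∫⁻ z, (cell d).indicator (fun _ => (1 : ℝ≥0∞)) (x - z + latt n) * ‖a z‖ₑ := by
    intro n
    rw [← lintegral_indicator (measurableSet_cell d),
      ← lintegral_sub_left_eq_self _ (x + latt n)]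
    refine lintegral_congr fun z => ?_
    have e1 : x + latt n - z = x - z + latt n := by abel
    have e2 : x - (x - z + latt n) + latt n = z := by abel
    rw [e1]
    by_cases hz : x - z + latt n ∈ cell d
    · rw [indicator_of_mem hz, indicator_of_mem hz, e2, one_mul]
    · rw [indicator_of_notMem hz, indicator_of_notMem hz, zero_mul]
  rw [tsum_congr hstep, ← lintegral_tsum]
  · refine lintegral_mono fun z => ?_
    dsimp only
    rw [ENNReal.tsum_mul_right]
    exact (mul_le_mul_left (tsum_indicator_cell_le (x - z)) _).trans (one_mul _).le
  · intro n
    refine AEMeasurable.mul (Measurable.aemeasurable ?_) hae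
    exact (measurable_const.indicator (measurableSet_cell d)).comp (by fun_prop)

theorem lintegral_absSum_right {d : ℕ} {a : E d → ℝ} (ha : AEStronglyMeasurable a volume)
    (y : E d) : ∫⁻ x in cell d, absSum a (x - y) ≤ ∫⁻ z, ‖a z‖ₑ := by
  have hae : AEMeasurable (fun z => ‖a z‖ₑ) volume := ha.enorm
  have hq : ∀ n : Fin d → ℤ, AEMeasurable (fun x => ‖a (x - y + latt n)‖ₑ) volume := by
    intro n
    have h := hae.comp_quasiMeasurePreserving
      (measurePreserving_add_right volume (latt n - y)).quasiMeasurePreserving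
    refine h.congr (Filter.Eventually.of_forall fun x => ?_)
    simp only [Function.comp]
    congr 2; abel
  unfold absSum
  rw [lintegral_tsum (fun n => (hq n).restrict)]
  have hstep : ∀ n : Fin d → ℤ, ∫⁻ x in cell d, ‖a (x - y + latt n)‖ₑ
      = ∫⁻ z, (cell d).indicator (fun _ => (1 : ℝ≥0∞)) (z + y + latt (-n)) * ‖a z‖ₑ := by
    intro n
    have hneg : latt (-n) = -latt n := by
      ext i; simp [latt]
    rw [← lintegral_indicator (measurableSet_cell d),
      ← lintegral_add_right_eq_self _ (y + latt (-n))]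
    refine lintegral_congr fun z => ?_
    have e1 : z + (y + latt (-n)) = z + y + latt (-n) := by abel
    have e2 : z + y + latt (-n) - y + latt n = z := by rw [hneg]; abel
    rw [e1]
    by_cases hz : z + y + latt (-n) ∈ cell d
    · rw [indicator_of_mem hz, indicator_of_mem hz, e2, one_mul]
    · rw [indicator_of_notMem hz, indicator_of_notMem hz, zero_mul]
  rw [tsum_congr hstep, ← lintegral_tsum]
  · refine lintegral_mono fun z => ?_
    dsimp only
    rw [ENNReal.tsum_mul_right]
    have h := tsum_indicator_cell_le (z + y)
    rw [← (Equiv.neg (Fin d → ℤ)).tsum_eq] at h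
    exact (mul_le_mul_left h _).trans (one_mul _).le
  · intro n
    refine AEMeasurable.mul (Measurable.aemeasurable ?_) hae
    exact (measurable_const.indicator (measurableSet_cell d)).comp (by fun_prop)

theorem prod_cell_ac (d : ℕ) : (cellMeasure d).prod (cellMeasure d) ≪
    (volume : Measure (E d)).prod volume :=
  Measure.AbsolutelyContinuous.prod Measure.restrict_le_self.absolutelyContinuous
    Measure.restrict_le_self.absolutelyContinuous

theorem aestronglyMeasurable_shift {d : ℕ} {a : E d → ℝ} (ha : AEStronglyMeasurable a volume)
    (n : Fin d → ℤ) :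
    AEStronglyMeasurable (fun q : E d × E d => a (q.1 - q.2 + latt n))
      ((cellMeasure d).prod (cellMeasure d)) := by
  have h1 : Measure.QuasiMeasurePreserving (fun q : E d × E d => q.1 - q.2 + latt n)
      (volume.prod volume) volume :=
    (measurePreserving_add_right volume (latt n)).quasiMeasurePreserving.comp
      (quasiMeasurePreserving_sub volume volume)
  exact (ha.comp_quasiMeasurePreserving h1).mono_ac (prod_cell_ac d)

theorem absSum_aemeasurable {d : ℕ} {a : E d → ℝ} (ha : AEStronglyMeasurable a volume) :
    AEMeasurable (fun q : E d × E d => absSum a (q.1 - q.2))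
      ((cellMeasure d).prod (cellMeasure d)) :=
  AEMeasurable.tsum fun n => (aestronglyMeasurable_shift ha n).enorm

instance isFiniteMeasure_cell (d : ℕ) : IsFiniteMeasure (cellMeasure d) := by
  refine ⟨?_⟩
  rw [Measure.restrict_apply_univ]
  refine (Bornology.IsBounded.measure_lt_top (s := cell d) ?_)
  rw [isBounded_iff_forall_norm_le]
  refine ⟨√(∑ _i : Fin d, 1), fun x hx => ?_⟩
  rw [EuclideanSpace.norm_eq]
  refine Real.sqrt_le_sqrt (Finset.sum_le_sum fun i _ => ?_)
  have h := hx i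
  rw [Real.norm_eq_abs, sq_abs]
  nlinarith [h.1, h.2]

theorem aTilde_aestronglyMeasurable {d : ℕ} {a : E d → ℝ} (ha : Integrable a) (ξ : E d) :
    AEStronglyMeasurable (fun q : E d × E d => aTilde a ξ (q.1 - q.2))
      ((cellMeasure d).prod (cellMeasure d)) := by
  have hfin : ∀ᵐ q ∂((cellMeasure d).prod (cellMeasure d)), absSum a (q.1 - q.2) < ∞ := by
    refine ae_lt_top' (absSum_aemeasurable ha.1) ?_
    rw [lintegral_prod _ (absSum_aemeasurable ha.1)]
    refine ne_of_lt ((lintegral_mono fun x => lintegral_absSum_left ha.1 x).trans_lt ?_)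
    rw [lintegral_const]
    exact ENNReal.mul_lt_top ha.2 (measure_lt_top _ _)
  refine aestronglyMeasurable_of_tendsto_ae Filter.atTop
    (f := fun (s : Finset (Fin d → ℤ)) (q : E d × E d) => ∑ n ∈ s,
      (a (q.1 - q.2 + latt n) : ℂ) *
        Complex.exp (-Complex.I * ((inner ℝ ξ (q.1 - q.2 + latt n) : ℝ) : ℂ))) ?_ ?_
  · intro s
    refine Finset.aestronglyMeasurable_fun_sum _ fun n _ => ?_
    refine AEStronglyMeasurable.mul ?_ ?_
    · exact Complex.continuous_ofReal.comp_aestronglyMeasurable (aestronglyMeasurable_shift ha.1 n)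
    · exact Continuous.aestronglyMeasurable (by fun_prop)
  · filter_upwards [hfin] with q hq
    refine Summable.hasSum ?_
    refine Summable.of_norm ?_
    have hs : Summable (fun n : Fin d → ℤ => ‖a (q.1 - q.2 + latt n)‖) := by
      rw [← tsum_enorm_ne_top_iff_summable_norm]
      exact hq.ne
    refine hs.congr fun n => ?_
    rw [norm_mul, Complex.norm_real, Complex.norm_exp]
    simp

/-- A linear prescription on functions with an `L²` bound defines a bounded operator. -/
theorem exists_clm {X : Type*} [MeasurableSpace X] (ν : Measure X) (Φ : (X → ℂ) → X → ℂ)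
    (C : ℝ≥0) (hm : ∀ u : Lp ℂ 2 ν, AEStronglyMeasurable (Φ u) ν)
    (hb : ∀ u : Lp ℂ 2 ν, eLpNorm (Φ u) 2 ν ≤ C * eLpNorm u 2 ν)
    (hadd : ∀ u v : Lp ℂ 2 ν, Φ ⇑(u + v) =ᵐ[ν] Φ u + Φ v)
    (hsmul : ∀ (c : ℂ) (u : Lp ℂ 2 ν), Φ ⇑(c • u) =ᵐ[ν] c • Φ u) :
    ∃ T : Lp ℂ 2 ν →L[ℂ] Lp ℂ 2 ν, ∀ u, T u =ᵐ[ν] Φ u := by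
  have hL : ∀ u : Lp ℂ 2 ν, MemLp (Φ u) 2 ν := fun u =>
    ⟨hm u, (hb u).trans_lt (ENNReal.mul_lt_top ENNReal.coe_lt_top (Lp.eLpNorm_lt_top u))⟩
  let L : Lp ℂ 2 ν →ₗ[ℂ] Lp ℂ 2 ν :=
    { toFun := fun u => (hL u).toLp
      map_add' := fun u v => by
        rw [← MemLp.toLp_add]
        exact MemLp.toLp_congr _ _ (hadd u v)
      map_smul' := fun c u => by
        rw [RingHom.id_apply, ← MemLp.toLp_const_smul]
        exact MemLp.toLp_congr _ _ (hsmul c u) }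
  refine ⟨L.mkContinuous C fun u => ?_, fun u => (hL u).coeFn_toLp⟩
  change ‖(hL u).toLp‖ ≤ C * ‖u‖
  rw [Lp.norm_toLp, Lp.norm_def, ← ENNReal.coe_toReal C, ← ENNReal.toReal_mul]
  exact ENNReal.toReal_mono (ENNReal.mul_lt_top ENNReal.coe_lt_top (Lp.eLpNorm_lt_top u)).ne (hb u)

/-- Schur test: existence of the bounded integral operator with a given kernel. -/
theorem exists_integralOperator {X : Type*} [MeasurableSpace X] (ν : Measure X) [IsFiniteMeasure ν]
    (k : X → X → ℂ) (hk : AEStronglyMeasurable (Function.uncurry k) (ν.prod ν)) (C : ℝ≥0)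
    (h1 : ∀ x, ∫⁻ y, ‖k x y‖ₑ ∂ν ≤ C) (h2 : ∀ y, ∫⁻ x, ‖k x y‖ₑ ∂ν ≤ C) :
    ∃ T : Lp ℂ 2 ν →L[ℂ] Lp ℂ 2 ν, ∀ u, T u =ᵐ[ν] fun x => ∫ y, k x y * u y ∂ν := by
  have hum : ∀ u : Lp ℂ 2 ν, AEStronglyMeasurable (fun q : X × X => u q.2) (ν.prod ν) :=
    fun u => (Lp.aestronglyMeasurable u).comp_quasiMeasurePreserving
      Measure.quasiMeasurePreserving_snd
  have hku : ∀ u : Lp ℂ 2 ν, AEStronglyMeasurable (fun q : X × X => k q.1 q.2 * u q.2)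
      (ν.prod ν) := fun u => hk.mul (hum u)
  have hkx : ∀ᵐ x ∂ν, AEStronglyMeasurable (k x) ν := hk.prodMk_left
  have hsq : ∀ u : Lp ℂ 2 ν, eLpNorm u 2 ν ^ 2 = ∫⁻ y, ‖u y‖ₑ ^ 2 ∂ν := fun u => by
    rw [eLpNorm_eq_lintegral_rpow_enorm_toReal (by norm_num) (by norm_num), ← ENNReal.rpow_natCast,
      ← ENNReal.rpow_mul]
    norm_num
  have hcs : ∀ u : Lp ℂ 2 ν, ∀ᵐ x ∂ν, (∫⁻ y, ‖k x y * u y‖ₑ ∂ν) ^ 2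
      ≤ C * ∫⁻ y, ‖k x y‖ₑ * ‖u y‖ₑ ^ 2 ∂ν := by
    intro u
    filter_upwards [hkx] with x hx
    have hu := (Lp.aestronglyMeasurable u).enorm
    have hx' := hx.enorm
    have hH := ENNReal.lintegral_mul_le_Lp_mul_Lq ν Real.HolderConjugate.two_two
      (f := fun y => ‖k x y‖ₑ ^ (1 / 2 : ℝ)) (g := fun y => ‖k x y‖ₑ ^ (1 / 2 : ℝ) * ‖u y‖ₑ)
      (hx'.pow_const _) ((hx'.pow_const _).mul hu)
    have e0 : ∀ t : ℝ≥0∞, t ^ (1 / 2 : ℝ) * t ^ (1 / 2 : ℝ) = t := fun t => by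
      rw [← ENNReal.rpow_add_of_nonneg _ _ (by norm_num) (by norm_num)]; norm_num
    have e1 : ∀ t : ℝ≥0∞, (t ^ (1 / 2 : ℝ)) ^ (2 : ℝ) = t := fun t => by
      rw [← ENNReal.rpow_mul]; norm_num
    have l0 : ∫⁻ y, ‖k x y * u y‖ₑ ∂ν = ∫⁻ y, ((fun y => ‖k x y‖ₑ ^ (1 / 2 : ℝ)) *
        (fun y => ‖k x y‖ₑ ^ (1 / 2 : ℝ) * ‖u y‖ₑ)) y ∂ν := by
      refine lintegral_congr fun y => ?_
      simp only [Pi.mul_apply]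
      rw [← mul_assoc, e0, enorm_mul]
    have l1 : ∫⁻ y, (‖k x y‖ₑ ^ (1 / 2 : ℝ)) ^ (2 : ℝ) ∂ν = ∫⁻ y, ‖k x y‖ₑ ∂ν :=
      lintegral_congr fun y => e1 _
    have l2 : ∫⁻ y, (‖k x y‖ₑ ^ (1 / 2 : ℝ) * ‖u y‖ₑ) ^ (2 : ℝ) ∂ν
        = ∫⁻ y, ‖k x y‖ₑ * ‖u y‖ₑ ^ 2 ∂ν :=
      lintegral_congr fun y => by
        rw [ENNReal.mul_rpow_of_nonneg _ _ (by norm_num), e1]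
        norm_num
    rw [← l0, l1, l2] at hH
    calc (∫⁻ y, ‖k x y * u y‖ₑ ∂ν) ^ 2
        ≤ ((∫⁻ y, ‖k x y‖ₑ ∂ν) ^ (1 / 2 : ℝ) *
          (∫⁻ y, ‖k x y‖ₑ * ‖u y‖ₑ ^ 2 ∂ν) ^ (1 / 2 : ℝ)) ^ 2 := by gcongr
      _ = (∫⁻ y, ‖k x y‖ₑ ∂ν) * ∫⁻ y, ‖k x y‖ₑ * ‖u y‖ₑ ^ 2 ∂ν := by
          rw [mul_pow, sq, sq, e0, e0]
      _ ≤ _ := by gcongr; exact h1 x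
  have hint : ∀ u : Lp ℂ 2 ν,
      ∫⁻ x, (∫⁻ y, ‖k x y * u y‖ₑ ∂ν) ^ 2 ∂ν ≤ (C * eLpNorm u 2 ν) ^ 2 := by
    intro u
    have hmeas : AEMeasurable (fun q : X × X => ‖k q.1 q.2‖ₑ * ‖u q.2‖ₑ ^ 2) (ν.prod ν) :=
      hk.enorm.mul ((hum u).enorm.pow_const 2)
    calc ∫⁻ x, (∫⁻ y, ‖k x y * u y‖ₑ ∂ν) ^ 2 ∂ν
        ≤ ∫⁻ x, C * ∫⁻ y, ‖k x y‖ₑ * ‖u y‖ₑ ^ 2 ∂ν ∂ν := lintegral_mono_ae (hcs u)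
      _ = C * ∫⁻ x, ∫⁻ y, ‖k x y‖ₑ * ‖u y‖ₑ ^ 2 ∂ν ∂ν :=
          lintegral_const_mul' _ _ ENNReal.coe_ne_top
      _ = C * ∫⁻ y, ∫⁻ x, ‖k x y‖ₑ * ‖u y‖ₑ ^ 2 ∂ν ∂ν := by
          rw [lintegral_lintegral_swap hmeas]
      _ ≤ C * ∫⁻ y, C * ‖u y‖ₑ ^ 2 ∂ν := by
          gcongr with y
          rw [lintegral_mul_const' _ _ (by simp)]
          gcongr
          exact h2 y
      _ = (C * eLpNorm u 2 ν) ^ 2 := by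
          rw [lintegral_const_mul' _ _ ENNReal.coe_ne_top, mul_pow, hsq u]; ring
  have hfin : ∀ u : Lp ℂ 2 ν, ∀ᵐ x ∂ν, Integrable (fun y => k x y * u y) ν := by
    intro u
    have hmm : AEMeasurable (fun x => (∫⁻ y, ‖k x y * u y‖ₑ ∂ν) ^ 2) ν :=
      (AEMeasurable.lintegral_prod_right' (f := fun q : X × X => ‖k q.1 q.2 * u q.2‖ₑ)
        (hku u).enorm).pow_const 2
    have hlt := ae_lt_top' hmm ((hint u).trans_lt (ENNReal.pow_lt_top
      (ENNReal.mul_lt_top ENNReal.coe_lt_top (Lp.eLpNorm_lt_top u)))).ne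
    filter_upwards [hlt, hkx] with x hx hx2
    refine ⟨hx2.mul (Lp.aestronglyMeasurable u), ?_⟩
    exact (ENNReal.pow_lt_top_iff.1 hx).resolve_right (by norm_num)
  refine exists_clm ν (fun u x => ∫ y, k x y * u y ∂ν) C (fun u => ?_) (fun u => ?_)
    (fun u v => ?_) (fun c u => ?_)
  · exact (hku u).integral_prod_right'
  · rw [← ENNReal.pow_le_pow_left_iff (n := 2) (by norm_num)]
    refine le_trans ?_ (hint u)
    rw [eLpNorm_eq_lintegral_rpow_enorm_toReal (by norm_num) (by norm_num), ← ENNReal.rpow_natCast,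
      ← ENNReal.rpow_mul]
    norm_num
    refine lintegral_mono fun x => ?_
    dsimp only
    gcongr
    refine (enorm_integral_le_lintegral_enorm _).trans (le_of_eq ?_)
    exact lintegral_congr fun y => by rw [enorm_mul]
  · filter_upwards [hfin u, hfin v] with x hxu hxv
    rw [Pi.add_apply, ← integral_add hxu hxv]
    refine integral_congr_ae ?_
    filter_upwards [Lp.coeFn_add u v] with y hy
    rw [hy, Pi.add_apply, mul_add]
  · refine Filter.Eventually.of_forall fun x => ?_
    rw [Pi.smul_apply, smul_eq_mul, ← integral_const_mul]
    refine integral_congr_ae ?_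
    filter_upwards [Lp.coeFn_smul c u] with y hy
    rw [hy, Pi.smul_apply, smul_eq_mul]; ring

/-- Multiplication by a bounded measurable function. -/
theorem exists_mulOperator {X : Type*} [MeasurableSpace X] (ν : Measure X)
    (f : X → ℂ) (hf : AEStronglyMeasurable f ν) (C : ℝ≥0) (hC : ∀ x, ‖f x‖ ≤ C) :
    ∃ T : Lp ℂ 2 ν →L[ℂ] Lp ℂ 2 ν, ∀ u, T u =ᵐ[ν] fun x => f x * u x := by
  refine exists_clm ν (fun u x => f x * u x) C (fun u => hf.mul (Lp.aestronglyMeasurable u))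
    (fun u => ?_) (fun u v => ?_) (fun c u => ?_)
  · refine (eLpNorm_le_nnreal_smul_eLpNorm_of_ae_le_mul (c := C) (f := fun x => f x * u x)
      (g := u) (Filter.Eventually.of_forall fun x => ?_) 2).trans (le_of_eq ?_)
    · rw [← NNReal.coe_le_coe]
      push_cast
      rw [norm_mul]
      gcongr
      exact hC x
    · rfl
  · filter_upwards [Lp.coeFn_add u v] with y hy
    simp only [hy, Pi.add_apply, mul_add]
  · filter_upwards [Lp.coeFn_smul c u] with y hy
    simp only [hy, Pi.smul_apply, smul_eq_mul]; ring

theorem Admissible.abs_μ_le {d : ℕ} {a : E d → ℝ} {μ : E d → E d → ℝ} {μm μp : ℝ}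
    (h : Admissible a μ μm μp) (x y : E d) : |μ x y| ≤ μp := by
  rw [abs_of_pos (h.μm_pos.trans_le (h.le_μ x y))]
  exact h.μ_le x y

theorem potential_aestronglyMeasurable {d : ℕ} {a : E d → ℝ} {μ : E d → E d → ℝ} {μm μp : ℝ}
    (h : Admissible a μ μm μp) : AEStronglyMeasurable (potential a μ) (cellMeasure d) := by
  have h1 : AEStronglyMeasurable (fun q : E d × E d => a (q.1 - q.2) * μ q.1 q.2)
      (volume.prod volume) :=
    (h.integrable_a.1.comp_quasiMeasurePreserving
      (quasiMeasurePreserving_sub volume volume)).mul h.measurable_μ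
  exact (h1.integral_prod_right').restrict

theorem abs_potential_le {d : ℕ} {a : E d → ℝ} {μ : E d → E d → ℝ} {μm μp : ℝ}
    (h : Admissible a μ μm μp) (x : E d) : |potential a μ x| ≤ μp * ∫ z, |a z| := by
  have hi : Integrable (fun y => μp * |a (x - y)|) :=
    (h.integrable_a.abs.comp_sub_left x).const_mul μp
  have h1 := norm_integral_le_of_norm_le (f := fun y => a (x - y) * μ x y) hi
    (Filter.Eventually.of_forall fun y => by
      rw [Real.norm_eq_abs, abs_mul, mul_comm]
      exact mul_le_mul_of_nonneg_right (h.abs_μ_le x y) (abs_nonneg _))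
  rw [integral_const_mul, integral_sub_left_eq_self (fun z => |a z|)] at h1
  exact h1

end Helpers

/-- `𝔸(ξ)` is a well-defined bounded operator on `L₂(Ω)`. -/
theorem exists_opA {d : ℕ} {a : E d → ℝ} {μ : E d → E d → ℝ} {μm μp : ℝ}
    (h : Admissible a μ μm μp) (ξ : E d) :
    ∃ T : L2 d →L[ℂ] L2 d, ∀ u : L2 d, T u =ᵐ[cellMeasure d] actA a μ ξ u := by
  have hp0 : 0 ≤ μp := h.μm_pos.le.trans ((h.le_μ 0 0).trans (h.μ_le 0 0))
  obtain ⟨T₁, hT₁⟩ := exists_mulOperator (cellMeasure d) (fun x => (potential a μ x : ℂ))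
    (Complex.continuous_ofReal.comp_aestronglyMeasurable (potential_aestronglyMeasurable h))
    (Real.toNNReal (μp * ∫ z, |a z|)) (fun x => by
      rw [Complex.norm_real]
      exact (abs_potential_le h x).trans (Real.le_coe_toNNReal _))
  have hkb : ∀ x y, ‖aTilde a ξ (x - y) * (μ x y : ℂ)‖ₑ ≤ absSum a (x - y) * ENNReal.ofReal μp := by
    intro x y
    rw [enorm_mul]
    refine mul_le_mul' (enorm_aTilde_le a ξ _) ?_
    rw [← ofReal_norm, Complex.norm_real]
    exact ENNReal.ofReal_le_ofReal (h.abs_μ_le x y)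
  have hN : (∫⁻ z, ‖a z‖ₑ) * ENNReal.ofReal μp ≠ ∞ :=
    ENNReal.mul_ne_top h.integrable_a.2.ne ENNReal.ofReal_ne_top
  obtain ⟨T₂, hT₂⟩ := exists_integralOperator (cellMeasure d)
    (fun x y => aTilde a ξ (x - y) * (μ x y : ℂ))
    ((aTilde_aestronglyMeasurable h.integrable_a ξ).mul
      (Complex.continuous_ofReal.comp_aestronglyMeasurable
        (h.measurable_μ.mono_ac (prod_cell_ac d))))
    ((∫⁻ z, ‖a z‖ₑ) * ENNReal.ofReal μp).toNNReal
    (fun x => by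
      rw [ENNReal.coe_toNNReal hN]
      refine (lintegral_mono fun y => hkb x y).trans ?_
      rw [lintegral_mul_const' _ _ ENNReal.ofReal_ne_top]
      exact mul_le_mul' (lintegral_absSum_left h.integrable_a.1 x) le_rfl)
    (fun y => by
      rw [ENNReal.coe_toNNReal hN]
      refine (lintegral_mono fun x => hkb x y).trans ?_
      rw [lintegral_mul_const' _ _ ENNReal.ofReal_ne_top]
      exact mul_le_mul' (lintegral_absSum_right h.integrable_a.1 y) le_rfl)
  refine ⟨T₁ - T₂, fun u => ?_⟩
  filter_upwards [hT₁ u, hT₂ u, Lp.coeFn_sub (T₁ u) (T₂ u)] with x h1 h2 h3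
  rw [sub_apply, h3, Pi.sub_apply, h1, h2]
  rfl

/-- The bounded operator `𝔸(ξ) = 𝔸(ξ,a,μ)` in `L₂(Ω)`; it is determined by `opA_spec`. -/
noncomputable def opA {d : ℕ} {a : E d → ℝ} {μ : E d → E d → ℝ} {μm μp : ℝ}
    (h : Admissible a μ μm μp) (ξ : E d) : L2 d →L[ℂ] L2 d :=
  (exists_opA h ξ).choose

theorem opA_spec {d : ℕ} {a : E d → ℝ} {μ : E d → E d → ℝ} {μm μp : ℝ}
    (h : Admissible a μ μm μp) (ξ : E d) (u : L2 d) :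
    opA h ξ u =ᵐ[cellMeasure d] actA a μ ξ u :=
  (exists_opA h ξ).choose_spec u

section SpectralTheory

variable {H : Type*} [NormedAddCommGroup H] [InnerProductSpace ℂ H] [CompleteSpace H]

/-- The indicator function `χ_S` of a set of real numbers. -/
noncomputable def chi (S : Set ℝ) : ℝ → ℝ := S.indicator (fun _ => 1)

/-- The spectral projector `χ_S(T)` of a bounded self-adjoint operator `T`. Mathlib's functional
calculus is the continuous one, so this is meaningful when `χ_S` is continuous on the spectrum
of `T` (that is, when the spectrum splits into the relatively clopen parts inside and outside
of `S`). -/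
noncomputable def spectralProjector (T : H →L[ℂ] H) (S : Set ℝ) : H →L[ℂ] H := cfc (chi S) T

/-- The distance from the point `0` to the rest of the spectrum of `T`. -/
noncomputable def gapAtZero (T : H →L[ℂ] H) : ℝ := Metric.infDist 0 (spectrum ℝ T \ {0})

end SpectralTheory

section

variable {d : ℕ} {a : E d → ℝ} {μ : E d → E d → ℝ} {μm μp : ℝ}

/-- `d₀ = dist(0, σ(𝔸(0)) \ {0})`. -/
noncomputable def dZero (h : Admissible a μ μm μp) : ℝ := gapAtZero (opA h 0)

/-- `δ₀ = min{1, 3⁻¹ 2⁻ᵈ M₁(a)⁻¹ μ₊⁻¹ μ₋ 𝒜_π(a)}`. -/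
noncomputable def deltaZero (a : E d → ℝ) (μm μp : ℝ) : ℝ :=
  min 1 (3⁻¹ * (2 ^ d)⁻¹ * (moment 1 a)⁻¹ * μp⁻¹ * μm * calA Real.pi a)

/-- `F(ξ)`: the spectral projector of `𝔸(ξ)` for the interval `[0, d₀/3]`. -/
noncomputable def projF (h : Admissible a μ μm μp) (ξ : E d) : L2 d →L[ℂ] L2 d :=
  spectralProjector (opA h ξ) (Icc 0 (dZero h / 3))

/-- The function `𝟏_Ω` in `L₂(Ω)`. -/
noncomputable def oneCell (d : ℕ) : L2 d := Lp.const 2 (cellMeasure d) (1 : ℂ)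

/-- `P`: the orthogonal projector onto `Ker 𝔸(0)`. -/
noncomputable def projP (h : Admissible a μ μm μp) : L2 d →L[ℂ] L2 d :=
  (opA h 0).ker.starProjection

/-- The `ℤ^d`-periodic extension to `ℝ^d` of a function on `Ω`. -/
noncomputable def perExt (u : E d → ℂ) (x : E d) : ℂ :=
  u (WithLp.toLp 2 (fun i => Int.fract (x i)))

/-- `v ∈ L₂(Ω)` solves the `j`-th cell problem
`∫ a(x-y) μ(x,y) (v(x) - v(y)) dy = ∫ a(x-y) μ(x,y) (x_j - y_j) dy` for a.e. `x ∈ Ω`,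
`∫_Ω v = 0`, where `v` is extended periodically to `ℝ^d`. -/
def IsCellSolution (a : E d → ℝ) (μ : E d → E d → ℝ) (j : Fin d) (v : L2 d) : Prop :=
  (∀ᵐ x ∂(cellMeasure d),
    ∫ y, ((a (x - y) * μ x y : ℝ) : ℂ) * (perExt v x - perExt v y)
      = ∫ y, ((a (x - y) * μ x y * (x j - y j) : ℝ) : ℂ)) ∧
  ∫ x in cell d, v x = 0

/-- The coefficients
`g_ij = ∫_Ω dx ∫ dy ((x_i-y_i)(x_j-y_j) - v_j(x)(x_i-y_i) - v_i(x)(x_j-y_j)) a(x-y) μ(x,y)`. -/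
noncomputable def coeffG (a : E d → ℝ) (μ : E d → E d → ℝ) (v : Fin d → L2 d) (i j : Fin d) : ℂ :=
  ∫ x in cell d, ∫ y,
    (((x i - y i : ℝ) : ℂ) * ((x j - y j : ℝ) : ℂ)
      - v j x * ((x i - y i : ℝ) : ℂ) - v i x * ((x j - y j : ℝ) : ℂ))
      * ((a (x - y) * μ x y : ℝ) : ℂ)

/-- `6 (π+2) π⁻¹ 2ᵈ D⁻¹ μ₊ M₁`. -/
noncomputable def constC1 (d : ℕ) (μp M₁ D : ℝ) : ℝ :=
  6 * (Real.pi + 2) * Real.pi⁻¹ * 2 ^ d * D⁻¹ * μp * M₁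

/-- `(π+2)/(2π) (μ₊M₃ + μ₊²/D (3M₂+M₃)(12M₁+3M₂+M₃) + μ₊³/D² (6M₁+3M₂+M₃)³)`. -/
noncomputable def constC2 (μp M₁ M₂ M₃ D : ℝ) : ℝ :=
  (Real.pi + 2) / (2 * Real.pi) *
    (μp * M₃
      + μp ^ 2 / D * ((3 * M₂ + M₃) * (12 * M₁ + 3 * M₂ + M₃))
      + μp ^ 3 / D ^ 2 * (6 * M₁ + 3 * M₂ + M₃) ^ 3)

end

end NonlocalHomogenization

open NonlocalHomogenization

/-!
The operator `𝔸(0)` has the constants as its kernel and a spectral gap at least `μ₋ 𝒜_π(a)`: its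
quadratic form, once symmetrized, has a nonnegative density (`Admissible.re_inner_opA`,
`Admissible.formDensity_nonneg`), so that replacing `μ` by the constant `μ₋` can only decrease it.
For constant `μ` the operator is diagonal in the Fourier basis of the cell, with eigenvalues the
values of the symbol `∫ (1 - cos⟨z,y⟩) a(z) dz` at `y = 2πn`, and Parseval's identity gives the gap
(`Admissible.calA_mul_norm_sq_le`). The infimum `𝒜_π(a)` of the symbol over `|y| ≥ π` is positive
because the symbol is continuous, is positive off the origin, and tends to `∫ a > 0` at infinity by
the Riemann–Lebesgue lemma (`Admissible.calA_pos`).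

By Schur's test a periodized kernel `b` weighted by `μ` has norm at most `μ₊ ‖b‖₁`, so Taylor's
formula for `exp(-i⟨ξ,z⟩)` gives `𝔸(ξ) = 𝔸(0) + T₁ + T₂ + O(|ξ|³)` with explicit constants. The
threshold `δ₀` is chosen so that `‖𝔸(ξ) - 𝔸(0)‖ ≤ d₀/6`; the spectrum of `𝔸(ξ)` then lies in
`[0, d₀/6] ∪ [5d₀/6, ∞)`, the indicator of `[0, d₀/3]` is continuous on it, and `F = F(ξ)` is a
projection.

No contour integrals are needed for the two estimates. Let `S` be the reduced inverse of `𝔸(0)` and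
`G` the inverse of `𝔸(ξ)` on the range of `1 - F`. The products `F (1 - P)` and `(1 - F) P` solve
identities of Sylvester type in terms of `S` and `G`, whence both are of order `‖𝔸(ξ) - 𝔸(0)‖ / d₀`
and so is `F - P` (`PerturbedGap.norm_F_sub_P`). Using these identities twice, `𝔸(ξ) F` equals
`P T₂ P - P T₁ S T₁ P` up to third order, since `P T₁ P = 0` by the evenness of `a` and the
symmetry of `μ` (`PerturbedGap.norm_T_mul_F_sub`); the continuous functional calculus supplies the
hypotheses of both (`exists_perturbedGap`). The constants obtained this way are smaller
than those claimed.

Finally, the cell problem reads `𝔸(0) v = w`, `v ⊥ 1` (`Admissible.isCellSolution_iff`), so that its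
solution is `S w`, and `P T₂ P - P T₁ S T₁ P` is multiplication by `½ ∑ g_ij ξ_i ξ_j` on the
constants (`Admissible.effective_operator_eq`).
-/

namespace NonlocalHomogenization

/-! ### Perturbation of an isolated eigenvalue, algebraically -/

/-- An operator `T₀` with kernel projection `P` and reduced inverse `S`, together with a
perturbation `T` of size `ε`, a projection `F` commuting with `T`, and an inverse `G` of `T` on the
range of `1 - F`. The norm bounds are those that hold when `σ(T₀) ⊆ {0} ∪ [D, ∞)` and `F` is the
spectral projection of `T` onto its spectrum near `0`. Only the ring structure and the norm are
used, which is why everything takes place in a normed ring. -/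
structure PerturbedGap {R : Type*} [NormedRing R] (T₀ T P S F G : R) (D ε : ℝ) : Prop where
  D_pos : 0 < D
  eps_le : ε ≤ D / 6
  T₀_mul_P : T₀ * P = 0
  P_mul_T₀ : P * T₀ = 0
  T₀_mul_S : T₀ * S = 1 - P
  S_mul_T₀ : S * T₀ = 1 - P
  P_mul_S : P * S = 0
  S_mul_P : S * P = 0
  T_mul_F : T * F = F * T
  F_mul_F : F * F = F
  T_mul_G : T * G = 1 - F
  G_mul_T : G * T = 1 - F
  norm_P : ‖P‖ ≤ 1
  norm_one_sub_P : ‖1 - P‖ ≤ 1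
  norm_F : ‖F‖ ≤ 1
  norm_S : ‖S‖ ≤ D⁻¹
  norm_G : ‖G‖ ≤ 6 / 5 * D⁻¹
  norm_TF : ‖T * F‖ ≤ D / 6
  norm_sub : ‖T - T₀‖ ≤ ε

namespace PerturbedGap

variable {R : Type*} [NormedRing R] {T₀ T P S F G : R} {D ε : ℝ}

theorem eps_nonneg (h : PerturbedGap T₀ T P S F G D ε) : 0 ≤ ε := (norm_nonneg _).trans h.norm_sub

/-- A contraction argument: `X = F (1 - P)` satisfies `X = (T F) X S - F (T - T₀) S`, where `T F`
has norm at most `D / 6` and `S` norm at most `1 / D`. -/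
theorem norm_F_mul_one_sub_P (h : PerturbedGap T₀ T P S F G D ε) :
    ‖F * (1 - P)‖ ≤ 6 / 5 * (ε * D⁻¹) := by
  have hD := h.D_pos
  have hDi : 0 < D⁻¹ := inv_pos.2 hD
  have key : F * (1 - P) = T * F * (F * (1 - P)) * S - F * (T - T₀) * S := by
    have e1 : F * (1 - P) = F * T₀ * S := by rw [← h.T₀_mul_S, mul_assoc]
    have e2 : T * F * (F * (1 - P)) * S = F * T * S := by
      calc T * F * (F * (1 - P)) * S = T * (F * F) * S - T * (F * F) * (P * S) := by noncomm_ring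
        _ = F * T * S := by rw [h.P_mul_S, mul_zero, sub_zero, h.F_mul_F, h.T_mul_F]
    rw [e2, e1]; noncomm_ring
  have hn : ‖F * (1 - P)‖ ≤ D / 6 * ‖F * (1 - P)‖ * D⁻¹ + 1 * ε * D⁻¹ := by
    conv_lhs => rw [key]
    exact norm_sub_le_of_le (norm_mul_le_of_le (norm_mul_le_of_le h.norm_TF le_rfl) h.norm_S)
      (norm_mul_le_of_le (norm_mul_le_of_le h.norm_F h.norm_sub) h.norm_S)
  have : D / 6 * ‖F * (1 - P)‖ * D⁻¹ = ‖F * (1 - P)‖ / 6 := by field_simp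
  linarith

theorem norm_one_sub_P_mul_F (h : PerturbedGap T₀ T P S F G D ε) :
    ‖(1 - P) * F‖ ≤ 6 / 5 * (ε * D⁻¹) := by
  have hD := h.D_pos
  have hDi : 0 < D⁻¹ := inv_pos.2 hD
  have key : (1 - P) * F = S * (((1 - P) * F) * (T * F)) - S * ((T - T₀) * F) := by
    have e1 : (1 - P) * F = S * T₀ * F := by rw [← h.S_mul_T₀]
    have e2 : S * (((1 - P) * F) * (T * F)) = S * T * F := by
      calc S * (((1 - P) * F) * (T * F)) = S * (F * T) * F - S * P * (F * T) * F := by noncomm_ring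
        _ = S * T * (F * F) := by rw [h.S_mul_P, ← h.T_mul_F]; noncomm_ring
        _ = S * T * F := by rw [h.F_mul_F]
    rw [e2, e1]; noncomm_ring
  have hn : ‖(1 - P) * F‖ ≤ D⁻¹ * (‖(1 - P) * F‖ * (D / 6)) + D⁻¹ * (ε * 1) := by
    conv_lhs => rw [key]
    exact norm_sub_le_of_le (norm_mul_le_of_le h.norm_S (norm_mul_le_of_le le_rfl h.norm_TF))
      (norm_mul_le_of_le h.norm_S (norm_mul_le_of_le h.norm_sub h.norm_F))
  have : D⁻¹ * (‖(1 - P) * F‖ * (D / 6)) = ‖(1 - P) * F‖ / 6 := by field_simp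
  linarith

theorem norm_one_sub_F_mul_P (h : PerturbedGap T₀ T P S F G D ε) :
    ‖(1 - F) * P‖ ≤ 6 / 5 * (ε * D⁻¹) := by
  have key : (1 - F) * P = G * (T - T₀) * P := by
    rw [← h.G_mul_T, mul_sub, sub_mul, mul_assoc G T₀, h.T₀_mul_P, mul_zero, sub_zero]
  rw [key]
  refine (norm_mul_le_of_le (norm_mul_le_of_le h.norm_G h.norm_sub) h.norm_P).trans (le_of_eq ?_)
  ring

theorem norm_P_mul_one_sub_F (h : PerturbedGap T₀ T P S F G D ε) :
    ‖P * (1 - F)‖ ≤ 6 / 5 * (ε * D⁻¹) := by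
  have key : P * (1 - F) = P * (T - T₀) * G := by
    rw [← h.T_mul_G, mul_sub, sub_mul, h.P_mul_T₀, zero_mul, sub_zero, mul_assoc]
  rw [key]
  refine (norm_mul_le_of_le (norm_mul_le_of_le h.norm_P h.norm_sub) h.norm_G).trans (le_of_eq ?_)
  ring

theorem norm_F_sub_P (h : PerturbedGap T₀ T P S F G D ε) : ‖F - P‖ ≤ 12 / 5 * (ε * D⁻¹) := by
  have : F - P = F * (1 - P) - (1 - F) * P := by noncomm_ring
  rw [this]
  exact (norm_sub_le_of_le h.norm_F_mul_one_sub_P h.norm_one_sub_F_mul_P).trans (by linarith)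

/-- The part of `T` near the origin is small of second order, when the first-order part `T₁` of
the perturbation vanishes in the range of `P`. -/
theorem norm_T_mul_F (h : PerturbedGap T₀ T P S F G D ε) {T₁ : R} {ω : ℝ}
    (hP : P * T₁ * P = 0) (hT₁ : ‖T₁‖ ≤ ε) (hω : ‖T - T₀ - T₁‖ ≤ ω) :
    ‖T * F‖ ≤ ω + 3.4 * (6 / 5 * (ε * D⁻¹)) * ε := by
  have hD := h.D_pos
  have hε := h.eps_nonneg
  have hX := h.norm_F_mul_one_sub_P
  have hX' := h.norm_one_sub_P_mul_F
  set q := 6 / 5 * (ε * D⁻¹) with hq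
  have hq0 : 0 ≤ q := by positivity
  -- `ε ≤ D / 6` gives `q ≤ 1 / 5`, so that the four products below contribute
  -- `(6/5 + 1 + 1 + 1/5) q ε`
  have hqD : q * (D / 6) = ε / 5 := by rw [hq]; field_simp
  have hq5 : q ≤ 1 / 5 := by nlinarith [h.eps_le]
  have hT₀F : ‖T₀ * F‖ ≤ q * (D / 6) + 1 * (ε * 1) := by
    have : T₀ * F = ((1 - P) * F) * (T * F) - (1 - P) * ((T - T₀) * F) := by
      have e : (1 - P) * F * (T * F) = (1 - P) * (T * F) := by
        rw [h.T_mul_F, ← mul_assoc, mul_assoc _ F F, h.F_mul_F, mul_assoc]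
      rw [e]
      calc T₀ * F = T₀ * F - P * T₀ * F := by rw [h.P_mul_T₀, zero_mul, sub_zero]
        _ = _ := by noncomm_ring
    rw [this]
    exact norm_sub_le_of_le (norm_mul_le_of_le hX' h.norm_TF)
      (norm_mul_le_of_le h.norm_one_sub_P (norm_mul_le_of_le h.norm_sub h.norm_F))
  have key : T * F = (F * (1 - P)) * (T₀ * F)
      + (F * P * T₁ * ((1 - P) * F) + (F * (1 - P)) * T₁ * (P * F)
        + (F * (1 - P)) * T₁ * ((1 - P) * F)) + F * (T - T₀ - T₁) * F := by
    have e0 : T * F = F * T * F := by rw [← h.T_mul_F, mul_assoc, h.F_mul_F]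
    have e1 : (F * (1 - P)) * (T₀ * F) = F * T₀ * F := by
      calc (F * (1 - P)) * (T₀ * F) = F * T₀ * F - F * (P * T₀) * F := by noncomm_ring
        _ = _ := by rw [h.P_mul_T₀]; noncomm_ring
    have e2 : F * P * T₁ * ((1 - P) * F) + (F * (1 - P)) * T₁ * (P * F)
        + (F * (1 - P)) * T₁ * ((1 - P) * F) = F * T₁ * F := by
      calc _ = F * T₁ * F - F * (P * T₁ * P) * F := by noncomm_ring
        _ = _ := by rw [hP]; noncomm_ring
    rw [e1, e2, e0]; noncomm_ring
  rw [key]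
  refine (norm_add_le_of_le (norm_add_le_of_le (norm_mul_le_of_le hX hT₀F)
    (norm_add_le_of_le (norm_add_le_of_le
      (norm_mul_le_of_le (norm_mul_le_of_le (norm_mul_le_of_le h.norm_F h.norm_P) hT₁) hX')
      (norm_mul_le_of_le (norm_mul_le_of_le hX hT₁) (norm_mul_le_of_le h.norm_P h.norm_F)))
      (norm_mul_le_of_le (norm_mul_le_of_le hX hT₁) hX')))
    (norm_mul_le_of_le (norm_mul_le_of_le h.norm_F hω) h.norm_F)).trans ?_
  rw [hqD]
  have : q * ε * q ≤ q * ε * (1 / 5) := by gcongr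
  nlinarith

/-- Second-order perturbation theory: the part of `T` near the origin is, up to third order, the
effective operator `P T₂ P - P T₁ S T₁ P`. -/
theorem norm_T_mul_F_sub (h : PerturbedGap T₀ T P S F G D ε) {T₁ T₂ : R} {ω r : ℝ}
    (hP : P * T₁ * P = 0) (hT₁ : ‖T₁‖ ≤ ε) (hω : ‖T - T₀ - T₁‖ ≤ ω)
    (hr : ‖T - T₀ - T₁ - T₂‖ ≤ r) :
    ‖T * F - (P * T₂ * P - P * T₁ * S * T₁ * P)‖
      ≤ r + 4.4 * (ω * ε * D⁻¹) + 14 * (ε ^ 3 * (D⁻¹) ^ 2) := by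
  have hD := h.D_pos
  have hε := h.eps_nonneg
  have hDi : 0 < D⁻¹ := inv_pos.2 hD
  have hX := h.norm_F_mul_one_sub_P
  have hX' := h.norm_one_sub_P_mul_F
  have hY := h.norm_P_mul_one_sub_F
  have hY' := h.norm_one_sub_F_mul_P
  have hτ := h.norm_T_mul_F hP hT₁ hω
  set q := 6 / 5 * (ε * D⁻¹) with hq
  have hq0 : 0 ≤ q := by positivity
  set τ := ω + 3.4 * q * ε
  have hPV : ‖P * (T - T₀)‖ ≤ 1 * ε := norm_mul_le_of_le h.norm_P h.norm_sub
  have hVP : ‖(T - T₀) * P‖ ≤ ε * 1 := norm_mul_le_of_le h.norm_sub h.norm_P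
  -- the compression of `T F` to the range of `P`
  have k1 : T * F = P * T * P - P * (T - T₀) * ((1 - F) * P)
      + ((1 - P) * F) * (T * F) * P + (T * F) * (F * (1 - P)) := by
    have e1 : ((1 - P) * F) * (T * F) = (1 - P) * (T * F) := by
      rw [h.T_mul_F, ← mul_assoc, mul_assoc _ F F, h.F_mul_F, mul_assoc]
    have e2 : (T * F) * (F * (1 - P)) = T * F * (1 - P) := by
      rw [← mul_assoc, mul_assoc T F F, h.F_mul_F]
    have e3 : P * (T - T₀) = P * T := by rw [mul_sub, h.P_mul_T₀, sub_zero]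
    rw [e1, e2, e3]; noncomm_ring
  have k2 : P * T * P = P * T₂ * P + P * (T - T₀ - T₁ - T₂) * P := by
    calc P * T * P = P * T₂ * P + P * (T - T₀ - T₁ - T₂) * P + P * T₀ * P + P * T₁ * P := by
          noncomm_ring
      _ = _ := by rw [hP, h.P_mul_T₀]; noncomm_ring
  -- the component of `(1 - F) P` orthogonal to `P`, through the reduced inverse
  have k3 : (1 - F) * P = (P * (1 - F)) * ((1 - F) * P) + (S * ((T - T₀) * P)
      - S * ((1 - P) * F) * ((T - T₀) * P) - S * (T - T₀) * ((1 - F) * P)) := by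
    have e1 : (P * (1 - F)) * ((1 - F) * P) = P * ((1 - F) * P) := by
      calc _ = P * ((1 - F - F + F * F) * P) := by noncomm_ring
        _ = _ := by rw [h.F_mul_F]; noncomm_ring
    have e2 : S * ((1 - P) * F) = S * F := by
      calc S * ((1 - P) * F) = S * F - S * P * F := by noncomm_ring
        _ = _ := by rw [h.S_mul_P]; noncomm_ring
    have e3 : (T - T₀) * P = T * P := by rw [sub_mul, h.T₀_mul_P, sub_zero]
    have e4 : (1 - P) * ((1 - F) * P) = S * (T * P) - S * F * (T * P)
        - S * (T - T₀) * ((1 - F) * P) := by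
      rw [← h.S_mul_T₀]
      calc S * T₀ * ((1 - F) * P) = S * (T * P) - S * (T * F) * P
            - S * (T - T₀) * ((1 - F) * P) := by noncomm_ring
        _ = _ := by rw [h.T_mul_F]; noncomm_ring
    rw [e1, e2, e3, ← e4]; noncomm_ring
  have k4 : P * (T - T₀) * (S * ((T - T₀) * P)) = P * T₁ * S * T₁ * P
      + (P * (T - T₀ - T₁) * S * ((T - T₀) * P) + P * T₁ * S * (T - T₀ - T₁) * P) := by
    noncomm_ring
  have key : T * F - (P * T₂ * P - P * T₁ * S * T₁ * P)
      = P * (T - T₀ - T₁ - T₂) * P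
        - (P * (T - T₀) * ((P * (1 - F)) * ((1 - F) * P))
          + (P * (T - T₀ - T₁) * S * ((T - T₀) * P) + P * T₁ * S * (T - T₀ - T₁) * P)
          - P * (T - T₀) * (S * ((1 - P) * F) * ((T - T₀) * P))
          - P * (T - T₀) * (S * (T - T₀) * ((1 - F) * P)))
        + ((1 - P) * F) * (T * F) * P + (T * F) * (F * (1 - P)) := by
    have e : P * (T - T₀) * ((1 - F) * P)
        = P * (T - T₀) * ((P * (1 - F)) * ((1 - F) * P))
          + (P * T₁ * S * T₁ * P
            + (P * (T - T₀ - T₁) * S * ((T - T₀) * P) + P * T₁ * S * (T - T₀ - T₁) * P))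
          - P * (T - T₀) * (S * ((1 - P) * F) * ((T - T₀) * P))
          - P * (T - T₀) * (S * (T - T₀) * ((1 - F) * P)) := by
      rw [← k4]
      conv_lhs => rw [k3]
      rw [mul_add, mul_sub (P * (T - T₀)), mul_sub (P * (T - T₀))]
      abel
    conv_lhs => rw [k1]
    rw [e, k2]; abel
  have n1 := norm_mul_le_of_le (norm_mul_le_of_le h.norm_P hr) h.norm_P
  have n2 := norm_mul_le_of_le hPV (norm_mul_le_of_le hY hY')
  have n3 := norm_mul_le_of_le (norm_mul_le_of_le (norm_mul_le_of_le h.norm_P hω) h.norm_S) hVP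
  have n4 := norm_mul_le_of_le (norm_mul_le_of_le (norm_mul_le_of_le
    (norm_mul_le_of_le h.norm_P hT₁) h.norm_S) hω) h.norm_P
  have n5 := norm_mul_le_of_le hPV (norm_mul_le_of_le (norm_mul_le_of_le h.norm_S hX') hVP)
  have n6 := norm_mul_le_of_le hPV
    (norm_mul_le_of_le (norm_mul_le_of_le h.norm_S h.norm_sub) hY')
  have n7 := norm_mul_le_of_le (norm_mul_le_of_le hX' hτ) h.norm_P
  have n8 := norm_mul_le_of_le hτ hX
  rw [key]
  refine (norm_add_le_of_le (norm_add_le_of_le (norm_sub_le_of_le n1 (norm_sub_le_of_le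
    (norm_sub_le_of_le (norm_add_le_of_le n2 (norm_add_le_of_le n3 n4)) n5) n6)) n7) n8).trans ?_
  have hc : 0 ≤ ε ^ 3 * (D⁻¹) ^ 2 := by positivity
  simp only [τ, hq]
  ring_nf at hc ⊢
  nlinarith

end PerturbedGap

/-! ### Spectral gaps of bounded self-adjoint operators -/

section SpectralGap

variable {H : Type*} [NormedAddCommGroup H] [InnerProductSpace ℂ H] [CompleteSpace H]

theorem isPositive_of_re_inner_nonneg {T : H →L[ℂ] H} (hT : IsSelfAdjoint T)
    (h : ∀ u, 0 ≤ (inner ℂ u (T u)).re) : 0 ≤ T := by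
  rw [ContinuousLinearMap.nonneg_iff_isPositive, ContinuousLinearMap.isPositive_def]
  refine ⟨hT.isSymmetric, fun u => ?_⟩
  rw [ContinuousLinearMap.reApplyInnerSelf, ← inner_conj_symm, RCLike.conj_re]
  exact h u

/-- A lower bound for the quadratic form off the kernel of `T` opens a gap in the spectrum: it
makes `T² - γ T` nonnegative, so that `x² ≥ γ x` on the spectrum. -/
theorem spectrum_gap_of_form_bound {T : H →L[ℂ] H} (hT : IsSelfAdjoint T) {γ : ℝ} (hγ : 0 < γ)
    (hb : ∀ u, γ * ‖u - T.ker.starProjection u‖ ^ 2 ≤ (inner ℂ u (T u)).re) {x : ℝ}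
    (hx : x ∈ spectrum ℝ T) : x = 0 ∨ γ ≤ x := by
  have hpos : 0 ≤ T := isPositive_of_re_inner_nonneg hT fun u => le_trans (by positivity) (hb u)
  have hx0 : 0 ≤ x := spectrum_nonneg_of_nonneg hpos hx
  have hsq : 0 ≤ T * T - γ • T := by
    refine isPositive_of_re_inner_nonneg ?_ fun u => ?_
    · exact (IsSelfAdjoint.of_nonneg (by simpa using hT.mul_self_nonneg)).sub
        ((IsSelfAdjoint.all γ).smul hT)
    · set w := u - T.ker.starProjection u
      have hTw : T w = T u := by
        have : T (T.ker.starProjection u) = 0 := Submodule.starProjection_apply_mem T.ker u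
        simp [w, this]
      have hsym : ∀ x y, inner ℂ (T x) y = inner ℂ x (T y) := hT.isSymmetric
      have e1 : inner ℂ u ((T * T - γ • T) u) = inner ℂ (T u) (T u) - γ * inner ℂ u (T u) := by
        have : (T * T - γ • T) u = T (T u) - (γ : ℂ) • T u := by simp
        rw [this, inner_sub_right, inner_smul_right, hsym]
      have e2 : (inner ℂ u (T u)).re ≤ ‖w‖ * ‖T u‖ := by
        have : inner ℂ u (T u) = inner ℂ w (T u) := by
          rw [← hTw, ← hsym, ← hsym, hTw]
        rw [this]
        exact (Complex.re_le_norm _).trans (norm_inner_le_norm _ _)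
      have e3 := hb u
      have e4 : γ * ‖w‖ ≤ ‖T u‖ := by
        by_cases hw : ‖w‖ = 0
        · rw [hw]; simp
        · have : 0 < ‖w‖ := lt_of_le_of_ne (norm_nonneg _) (Ne.symm hw)
          nlinarith
      rw [e1, Complex.sub_re, Complex.re_ofReal_mul, inner_self_eq_norm_sq_to_K]
      have : ((‖T u‖ : ℂ) ^ 2).re = ‖T u‖ ^ 2 := by
        rw [← Complex.ofReal_pow, Complex.ofReal_re]
      simp only [Complex.coe_algebraMap] at *
      rw [this]
      nlinarith [norm_nonneg (T u)]
  have hcfc : T * T - γ • T = cfc (fun y : ℝ => y * y - γ * y) T := by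
    rw [cfc_sub _ _ T, cfc_mul _ _ T, cfc_const_mul _ _ T, cfc_id' ℝ T]
  have hmem : x * x - γ * x ∈ spectrum ℝ (T * T - γ • T) := by
    rw [hcfc, cfc_map_spectrum _ T]
    exact ⟨x, hx, rfl⟩
  have h2 := spectrum_nonneg_of_nonneg hsq hmem
  rcases hx0.eq_or_lt with h0 | h0
  · exact Or.inl h0.symm
  · right; nlinarith

theorem eq_zero_or_gapAtZero_le {T : H →L[ℂ] H} (hT : 0 ≤ T) {x : ℝ} (hx : x ∈ spectrum ℝ T) :
    x = 0 ∨ gapAtZero T ≤ x := by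
  by_cases h0 : x = 0
  · exact Or.inl h0
  · right
    have h1 := Metric.infDist_le_dist_of_mem (x := (0 : ℝ)) (s := spectrum ℝ T \ {0}) (y := x)
      ⟨hx, h0⟩
    rwa [dist_zero_left, Real.norm_eq_abs, abs_of_nonneg (spectrum_nonneg_of_nonneg hT hx)] at h1

theorem le_gapAtZero {T : H →L[ℂ] H} (hT : IsSelfAdjoint T) (hne : T ≠ 0) {γ : ℝ}
    (h : ∀ x ∈ spectrum ℝ T, x = 0 ∨ γ ≤ x) : γ ≤ gapAtZero T := by
  have hs : (spectrum ℝ T \ {0}).Nonempty := by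
    by_contra hcon
    rw [not_nonempty_iff_eq_empty, sdiff_eq_empty] at hcon
    apply hne
    rw [← cfc_id' ℝ T, cfc_congr (g := fun _ => 0) fun x hx => hcon hx]
    simp
  refine (Metric.le_infDist hs).2 fun x hx => ?_
  rw [dist_zero_left]
  exact ((h x hx.1).resolve_left hx.2).trans (le_abs_self x)

/-- The resolvent `(T₀ - x)⁻¹` has norm at most `1 / dist(x, σ(T₀))`, so a Neumann series shows that
`T - x` is invertible as soon as `‖T - T₀‖ < dist(x, σ(T₀))`. -/
theorem notMem_spectrum_of_norm_sub_lt {T T₀ : H →L[ℂ] H} (hT₀ : IsSelfAdjoint T₀) {x r : ℝ}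
    (hr : 0 < r) (hx : ∀ y ∈ spectrum ℝ T₀, r ≤ |y - x|) (hlt : ‖T - T₀‖ < r) :
    x ∉ spectrum ℝ T := by
  have hne : ∀ y ∈ spectrum ℝ T₀, y - x ≠ 0 := fun y hy h0 => by
    have := hx y hy
    rw [h0, abs_zero] at this
    linarith
  have hc : ContinuousOn (fun y : ℝ => (y - x)⁻¹) (spectrum ℝ T₀) :=
    ContinuousOn.inv₀ (by fun_prop) hne
  set R := cfc (fun y : ℝ => (y - x)⁻¹) T₀
  have hsub : cfc (fun y : ℝ => y - x) T₀ = T₀ - algebraMap ℝ _ x := by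
    rw [cfc_sub _ _ T₀, cfc_id' ℝ T₀, cfc_const _ T₀]
  have h1 : R * (T₀ - algebraMap ℝ _ x) = 1 := by
    rw [← hsub, ← cfc_mul _ _ T₀ hc,
      cfc_congr (g := fun _ => 1) fun y hy => inv_mul_cancel₀ (hne y hy), cfc_const_one ℝ T₀]
  have h2 : (T₀ - algebraMap ℝ _ x) * R = 1 := by
    rw [← hsub, ← cfc_mul _ _ T₀ (by fun_prop) hc,
      cfc_congr (g := fun _ => 1) fun y hy => mul_inv_cancel₀ (hne y hy), cfc_const_one ℝ T₀]
  have hR : ‖R‖ ≤ r⁻¹ := norm_cfc_le (by positivity) fun y hy => by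
    rw [norm_inv, Real.norm_eq_abs]
    exact inv_anti₀ hr (hx y hy)
  have hn : ‖R * (T₀ - T)‖ < 1 := by
    refine (norm_mul_le _ _).trans_lt ?_
    rw [norm_sub_rev]
    calc ‖R‖ * ‖T - T₀‖ ≤ r⁻¹ * ‖T - T₀‖ := by gcongr
      _ < r⁻¹ * r := by gcongr
      _ = 1 := inv_mul_cancel₀ hr.ne'
  have hu : IsUnit (T₀ - algebraMap ℝ (H →L[ℂ] H) x) := ⟨⟨_, R, h2, h1⟩, rfl⟩
  have h3 : T - algebraMap ℝ _ x = (T₀ - algebraMap ℝ _ x) * (1 - R * (T₀ - T)) := by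
    rw [mul_sub, mul_one, ← mul_assoc, h2, one_mul]; abel
  rw [spectrum.notMem_iff, ← IsUnit.neg_iff, neg_sub, h3]
  exact hu.mul (isUnit_one_sub_of_norm_lt_one hn)

theorem spectrum_of_norm_sub_le {T T₀ : H →L[ℂ] H} (hT₀ : IsSelfAdjoint T₀) {D : ℝ} (hD : 0 < D)
    (hσ : ∀ y ∈ spectrum ℝ T₀, y = 0 ∨ D ≤ y) (hT : 0 ≤ T) (hle : ‖T - T₀‖ ≤ D / 6) {x : ℝ}
    (hx : x ∈ spectrum ℝ T) : 0 ≤ x ∧ (x ≤ D / 6 ∨ 5 * D / 6 ≤ x) := by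
  refine ⟨spectrum_nonneg_of_nonneg hT hx, ?_⟩
  by_contra! hcon
  refine notMem_spectrum_of_norm_sub_lt (T := T) hT₀ (x := x) (r := min x (D - x))
    (lt_min (by linarith) (by linarith)) (fun y hy => ?_)
    (hle.trans_lt (lt_min (by linarith) (by linarith))) hx
  rcases hσ y hy with rfl | h
  · rw [zero_sub, abs_neg]
    exact (min_le_left _ _).trans (le_abs_self _)
  · exact (min_le_right _ _).trans ((by linarith : D - x ≤ y - x).trans (le_abs_self _))

/-- The indicator of `[0, D/3]` agrees near each point of `σ(T)` with that of a closed and with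
that of an open half-line. -/
theorem continuousOn_chi {s : Set ℝ} {D : ℝ} (hD : 0 < D)
    (hs : ∀ x ∈ s, 0 ≤ x ∧ (x ≤ D / 6 ∨ 5 * D / 6 ≤ x)) : ContinuousOn (chi (Icc 0 (D / 3))) s := by
  intro x hx
  obtain ⟨-, h | h⟩ := hs x hx
  · refine (continuousWithinAt_const (b := (1 : ℝ))).congr_of_eventuallyEq ?_ ?_
    · filter_upwards [self_mem_nhdsWithin,
        mem_nhdsWithin_of_mem_nhds (Iio_mem_nhds (by linarith : x < D / 3))] with y hy hy'
      exact indicator_of_mem (show y ∈ Icc 0 (D / 3) from ⟨(hs y hy).1, le_of_lt hy'⟩) _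
    · exact indicator_of_mem (show x ∈ Icc 0 (D / 3) from ⟨(hs x hx).1, by linarith⟩) _
  · refine (continuousWithinAt_const (b := (0 : ℝ))).congr_of_eventuallyEq ?_ ?_
    · filter_upwards [mem_nhdsWithin_of_mem_nhds (Ioi_mem_nhds (by linarith : D / 3 < x))] with y hy
      exact indicator_of_notMem (fun hc => (not_le.2 hy) hc.2) _
    · exact indicator_of_notMem (fun hc => by linarith [hc.2]) _

theorem exists_reduced_inverse {T : H →L[ℂ] H} (hT : IsSelfAdjoint T) {D : ℝ} (hD : 0 < D)
    (hσ : ∀ x ∈ spectrum ℝ T, x = 0 ∨ D ≤ x) :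
    ∃ S : H →L[ℂ] H, T * S = 1 - T.ker.starProjection ∧ S * T = 1 - T.ker.starProjection ∧
      T.ker.starProjection * S = 0 ∧ S * T.ker.starProjection = 0 ∧ ‖S‖ ≤ D⁻¹ := by
  -- any function equal to `1 / x` on `[D, ∞)` and to `0` at `0` gives the reduced inverse;
  -- `x⁻¹` itself qualifies, as `0⁻¹ = 0`
  have hc : ContinuousOn (fun x : ℝ => x⁻¹) (spectrum ℝ T) := by
    intro x hx
    rcases hσ x hx with rfl | h
    · refine (continuousWithinAt_const (b := (0 : ℝ))).congr_of_eventuallyEq ?_ inv_zero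
      filter_upwards [self_mem_nhdsWithin,
        mem_nhdsWithin_of_mem_nhds (Iio_mem_nhds hD)] with y hy hy'
      rcases hσ y hy with rfl | h'
      · exact inv_zero
      · exact absurd hy' (not_lt.2 h')
    · exact (continuousAt_inv₀ (by linarith)).continuousWithinAt
  set P := T.ker.starProjection with hP
  set S := cfc (fun x : ℝ => x⁻¹) T
  have hTS : T * S = S * T := by
    have := (cfc_commute_cfc (fun x : ℝ => x) (fun x : ℝ => x⁻¹) T).eq
    rwa [cfc_id' ℝ T] at this
  have hPsa : IsSelfAdjoint P := isSelfAdjoint_starProjection _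
  have hTP : T * P = 0 := by
    ext u
    exact Submodule.starProjection_apply_mem T.ker u
  have hPT : P * T = 0 := by
    have := congrArg star hTP
    rwa [star_mul, hPsa.star_eq, hT.star_eq, star_zero] at this
  have hTTS : T * (1 - T * S) = 0 := by
    have h1 : T * T * S = T := by
      have e : cfc (fun x : ℝ => x * x * x⁻¹) T = cfc (fun x : ℝ => x * x) T * S :=
        cfc_mul (fun x : ℝ => x * x) (fun x : ℝ => x⁻¹) T (by fun_prop) hc
      rw [cfc_mul (fun x : ℝ => x) (fun x : ℝ => x) T, cfc_id' ℝ T] at e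
      rw [← e]
      conv_rhs => rw [← cfc_id' ℝ T]
      refine cfc_congr fun x hx => ?_
      by_cases h0 : x = 0
      · simp [h0]
      · simp [h0]
    rw [mul_sub, mul_one, ← mul_assoc, h1, sub_self]
  have hQ : P * (1 - T * S) = 1 - T * S := by
    ext u
    refine (Submodule.starProjection_eq_self_iff (K := T.ker)).2 ?_
    exact congrArg (fun A : H →L[ℂ] H => A u) hTTS
  have hTSP : T * S = 1 - P := by
    have : P * (1 - T * S) = P := by rw [mul_sub, mul_one, ← mul_assoc, hPT, zero_mul, sub_zero]
    rw [this] at hQ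
    rw [hQ]; abel
  have hSP : S * P = 0 := by
    have e : cfc (fun x : ℝ => x⁻¹ * x * x⁻¹) T = S := by
      refine cfc_congr fun x _ => ?_
      by_cases h0 : x = 0
      · simp [h0]
      · simp [h0]
    rw [cfc_mul (fun x : ℝ => x⁻¹ * x) _ T (hc.mul (by fun_prop)) hc,
      cfc_mul _ (fun x : ℝ => x) T hc, cfc_id' ℝ T] at e
    change S * T * S = S at e
    rw [← e, mul_assoc S, hTSP, mul_assoc, sub_mul, one_mul,
      (isStarProjection_starProjection (U := T.ker)).isIdempotentElem.eq, sub_self, mul_zero]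
  refine ⟨S, hTSP, hTS ▸ hTSP, ?_, hSP, ?_⟩
  · have := congrArg star hSP
    have hS : IsSelfAdjoint S := IsSelfAdjoint.cfc
    rwa [star_mul, hPsa.star_eq, hS.star_eq, star_zero] at this
  · refine norm_cfc_le (by positivity) fun x hx => ?_
    rcases hσ x hx with rfl | h
    · simp [hD.le]
    · rw [norm_inv, Real.norm_eq_abs, abs_of_pos (by linarith)]
      exact inv_anti₀ hD h

/-- The spectral projection `F` of the perturbed operator onto `[0, D/3]`, together with the kernel
projection and the reduced inverse of the unperturbed one, satisfies the hypotheses of the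
algebraic perturbation theory. -/
theorem exists_perturbedGap {T T₀ : H →L[ℂ] H} (hT₀ : IsSelfAdjoint T₀) {D ε : ℝ} (hD : 0 < D)
    (hσ : ∀ y ∈ spectrum ℝ T₀, y = 0 ∨ D ≤ y) (hT : 0 ≤ T) (hle : ‖T - T₀‖ ≤ ε) (hε : ε ≤ D / 6) :
    ∃ S G, PerturbedGap T₀ T T₀.ker.starProjection S
      (spectralProjector T (Icc 0 (D / 3))) G D ε := by
  have hTsa : IsSelfAdjoint T := .of_nonneg hT
  have hs : ∀ x ∈ spectrum ℝ T, 0 ≤ x ∧ (x ≤ D / 6 ∨ 5 * D / 6 ≤ x) := fun x hx =>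
    spectrum_of_norm_sub_le hT₀ hD hσ hT (hle.trans hε) hx
  have hχ := continuousOn_chi hD hs
  have hone : ∀ x ∈ spectrum ℝ T, x ≤ D / 6 → chi (Icc 0 (D / 3)) x = 1 := fun x hx h =>
    indicator_of_mem (show x ∈ Icc 0 (D / 3) from ⟨(hs x hx).1, by linarith⟩) _
  have hzero : ∀ x : ℝ, 5 * D / 6 ≤ x → chi (Icc 0 (D / 3)) x = 0 := fun x h =>
    indicator_of_notMem (fun hc => by linarith [hc.2]) _
  have hginv : ∀ x ∈ spectrum ℝ T, max x (D / 2) ≠ 0 := fun x _ =>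
    (lt_of_lt_of_le (by linarith) (le_max_right x (D / 2))).ne'
  have hg : ContinuousOn (fun x : ℝ => (1 - chi (Icc 0 (D / 3)) x) * (max x (D / 2))⁻¹)
      (spectrum ℝ T) :=
    (continuousOn_const.sub hχ).mul (ContinuousOn.inv₀ (by fun_prop) hginv)
  obtain ⟨S, hTS, hST, hPS, hSP, hSn⟩ := exists_reduced_inverse hT₀ hD hσ
  have hPsp : IsStarProjection T₀.ker.starProjection := isStarProjection_starProjection
  set F := spectralProjector T (Icc 0 (D / 3)) with hF
  have hFF : F * F = F := by
    rw [hF, spectralProjector, ← cfc_mul _ _ T hχ hχ]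
    refine cfc_congr fun x hx => ?_
    rcases (hs x hx).2 with h | h
    · simp [hone x hx h]
    · simp [hzero x h]
  have hFsp : IsStarProjection F := ⟨hFF, IsSelfAdjoint.cfc⟩
  have hTG : cfc (fun x : ℝ => x) T *
      cfc (fun x : ℝ => (1 - chi (Icc 0 (D / 3)) x) * (max x (D / 2))⁻¹) T = 1 - F := by
    rw [← cfc_mul _ _ T (by fun_prop) hg, hF, spectralProjector, ← cfc_const_one ℝ T,
      ← cfc_sub _ _ T (by fun_prop) hχ]
    refine cfc_congr fun x hx => ?_
    rcases (hs x hx).2 with h | h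
    · simp [hone x hx h]
    · simp only [hzero x h]
      rw [max_eq_left (by linarith), sub_zero, one_mul, mul_inv_cancel₀ (by linarith)]
  have hTP : T₀ * T₀.ker.starProjection = 0 := by
    ext u
    exact Submodule.starProjection_apply_mem T₀.ker u
  have hTF : T * F = cfc (fun x : ℝ => x * chi (Icc 0 (D / 3)) x) T := by
    rw [cfc_mul _ _ T (by fun_prop) hχ, cfc_id' ℝ T, hF, spectralProjector]
  refine ⟨S, cfc (fun x : ℝ => (1 - chi (Icc 0 (D / 3)) x) * (max x (D / 2))⁻¹) T, ?_⟩
  refine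
    { D_pos := hD
      eps_le := hε
      T₀_mul_P := hTP
      P_mul_T₀ := ?_
      T₀_mul_S := hTS
      S_mul_T₀ := hST
      P_mul_S := hPS
      S_mul_P := hSP
      T_mul_F := ?_
      F_mul_F := hFF
      T_mul_G := ?_
      G_mul_T := ?_
      norm_P := hPsp.norm_le
      norm_one_sub_P := hPsp.one_sub.norm_le
      norm_F := hFsp.norm_le
      norm_S := hSn
      norm_G := ?_
      norm_TF := ?_
      norm_sub := hle }
  · have := congrArg star hTP
    rwa [star_mul, hPsp.isSelfAdjoint.star_eq, hT₀.star_eq, star_zero] at this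
  · have := (cfc_commute_cfc (fun x : ℝ => x) (chi (Icc 0 (D / 3))) T).eq
    rwa [cfc_id' ℝ T] at this
  · rwa [cfc_id' ℝ T] at hTG
  · rw [(cfc_commute_cfc _ _ T).eq, cfc_id' ℝ T] at hTG
    exact hTG
  · refine norm_cfc_le (by positivity) fun x hx => ?_
    rcases (hs x hx).2 with h | h
    · rw [hone x hx h, sub_self, zero_mul, norm_zero]; positivity
    · rw [hzero x h, sub_zero, one_mul, max_eq_left (by linarith), norm_inv, Real.norm_eq_abs,
        abs_of_pos (by linarith)]
      calc x⁻¹ ≤ (5 * D / 6)⁻¹ := inv_anti₀ (by linarith) h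
        _ = 6 / 5 * D⁻¹ := by field_simp
  · rw [hTF]
    refine norm_cfc_le (by positivity) fun x hx => ?_
    rcases (hs x hx).2 with h | h
    · rw [hone x hx h, mul_one, Real.norm_eq_abs, abs_of_nonneg (hs x hx).1]; exact h
    · rw [hzero x h, mul_zero, norm_zero]; positivity

end SpectralGap

/-! ### Integral operators under the Schur test: weak form and norm -/

section Schur

variable {X : Type*} [MeasurableSpace X] {ν : Measure X}

theorem eLpNorm_two_sq (u : X → ℂ) : eLpNorm u 2 ν ^ 2 = ∫⁻ y, ‖u y‖ₑ ^ 2 ∂ν := by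
  rw [eLpNorm_eq_lintegral_rpow_enorm_toReal (by norm_num) (by norm_num), ← ENNReal.rpow_natCast,
    ← ENNReal.rpow_mul]
  norm_num

variable [SFinite ν]

theorem lintegral_schur_fst {κ : X → X → ℝ≥0∞}
    (hκ : AEMeasurable (fun q : X × X => κ q.1 q.2) (ν.prod ν))
    {C : ℝ≥0} (h1 : ∀ x, ∫⁻ y, κ x y ∂ν ≤ C) (v : X → ℂ) (hv : AEStronglyMeasurable v ν) :
    ∫⁻ q, κ q.1 q.2 * ‖v q.1‖ₑ ^ 2 ∂(ν.prod ν) ≤ C * eLpNorm v 2 ν ^ 2 := by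
  have hv1 : AEMeasurable (fun q : X × X => ‖v q.1‖ₑ ^ 2) (ν.prod ν) :=
    ((hv.comp_quasiMeasurePreserving Measure.quasiMeasurePreserving_fst).enorm.pow_const 2)
  rw [lintegral_prod (fun q : X × X => κ q.1 q.2 * ‖v q.1‖ₑ ^ 2) (hκ.mul hv1), eLpNorm_two_sq,
    ← lintegral_const_mul' _ _ ENNReal.coe_ne_top]
  refine lintegral_mono fun x => ?_
  dsimp only
  rw [lintegral_mul_const' _ _ (by simp)]
  gcongr
  exact h1 x

theorem lintegral_schur_snd {κ : X → X → ℝ≥0∞}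
    (hκ : AEMeasurable (fun q : X × X => κ q.1 q.2) (ν.prod ν))
    {C : ℝ≥0} (h2 : ∀ y, ∫⁻ x, κ x y ∂ν ≤ C) (u : X → ℂ) (hu : AEStronglyMeasurable u ν) :
    ∫⁻ q, κ q.1 q.2 * ‖u q.2‖ₑ ^ 2 ∂(ν.prod ν) ≤ C * eLpNorm u 2 ν ^ 2 := by
  have hu1 : AEMeasurable (fun q : X × X => ‖u q.2‖ₑ ^ 2) (ν.prod ν) :=
    ((hu.comp_quasiMeasurePreserving Measure.quasiMeasurePreserving_snd).enorm.pow_const 2)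
  rw [lintegral_prod_symm (fun q : X × X => κ q.1 q.2 * ‖u q.2‖ₑ ^ 2) (hκ.mul hu1), eLpNorm_two_sq,
    ← lintegral_const_mul' _ _ ENNReal.coe_ne_top]
  refine lintegral_mono fun x => ?_
  dsimp only
  rw [lintegral_mul_const' _ _ (by simp)]
  gcongr
  exact h2 x

/-- The bilinear Schur test: Cauchy–Schwarz after splitting `κ = κ^{1/2} κ^{1/2}`. -/
theorem lintegral_schur {κ : X → X → ℝ≥0∞}
    (hκ : AEMeasurable (fun q : X × X => κ q.1 q.2) (ν.prod ν))
    {C : ℝ≥0} (h1 : ∀ x, ∫⁻ y, κ x y ∂ν ≤ C) (h2 : ∀ y, ∫⁻ x, κ x y ∂ν ≤ C) (u v : X → ℂ)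
    (hu : AEStronglyMeasurable u ν) (hv : AEStronglyMeasurable v ν) :
    ∫⁻ q, κ q.1 q.2 * (‖v q.1‖ₑ * ‖u q.2‖ₑ) ∂(ν.prod ν) ≤ C * eLpNorm v 2 ν * eLpNorm u 2 ν := by
  have hv1 : AEMeasurable (fun q : X × X => ‖v q.1‖ₑ) (ν.prod ν) :=
    (hv.comp_quasiMeasurePreserving Measure.quasiMeasurePreserving_fst).enorm
  have hu1 : AEMeasurable (fun q : X × X => ‖u q.2‖ₑ) (ν.prod ν) :=
    (hu.comp_quasiMeasurePreserving Measure.quasiMeasurePreserving_snd).enorm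
  have hκ' : AEMeasurable (fun q : X × X => κ q.1 q.2 ^ (1 / 2 : ℝ)) (ν.prod ν) := hκ.pow_const _
  have hH := ENNReal.lintegral_mul_le_Lp_mul_Lq (ν.prod ν) Real.HolderConjugate.two_two
    (f := fun q : X × X => κ q.1 q.2 ^ (1 / 2 : ℝ) * ‖v q.1‖ₑ)
    (g := fun q : X × X => κ q.1 q.2 ^ (1 / 2 : ℝ) * ‖u q.2‖ₑ)
    (hκ'.mul hv1) (hκ'.mul hu1)
  have e0 : ∀ t : ℝ≥0∞, t ^ (1 / 2 : ℝ) * t ^ (1 / 2 : ℝ) = t := fun t => by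
    rw [← ENNReal.rpow_add_of_nonneg _ _ (by norm_num) (by norm_num)]; norm_num
  have e1 : ∀ t s : ℝ≥0∞, (t ^ (1 / 2 : ℝ) * s) ^ (2 : ℝ) = t * s ^ 2 := fun t s => by
    rw [ENNReal.mul_rpow_of_nonneg _ _ (by norm_num), ← ENNReal.rpow_mul]; norm_num
  have e2 : ∀ t : ℝ≥0∞, (t ^ 2) ^ (1 / 2 : ℝ) = t := fun t => by
    rw [← ENNReal.rpow_natCast, ← ENNReal.rpow_mul]; norm_num
  simp only [Pi.mul_apply, e1] at hH
  calc ∫⁻ q, κ q.1 q.2 * (‖v q.1‖ₑ * ‖u q.2‖ₑ) ∂(ν.prod ν)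
      = ∫⁻ q, κ q.1 q.2 ^ (1 / 2 : ℝ) * ‖v q.1‖ₑ * (κ q.1 q.2 ^ (1 / 2 : ℝ) * ‖u q.2‖ₑ)
          ∂(ν.prod ν) := by
        refine lintegral_congr fun q => ?_
        conv_lhs => rw [← e0 (κ q.1 q.2)]
        ring
    _ ≤ _ := hH
    _ ≤ (C * eLpNorm v 2 ν ^ 2) ^ (1 / 2 : ℝ) * (C * eLpNorm u 2 ν ^ 2) ^ (1 / 2 : ℝ) := by
        gcongr
        · exact lintegral_schur_fst hκ h1 v hv
        · exact lintegral_schur_snd hκ h2 u hu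
    _ = C * eLpNorm v 2 ν * eLpNorm u 2 ν := by
        rw [ENNReal.mul_rpow_of_nonneg _ _ (by norm_num),
          ENNReal.mul_rpow_of_nonneg _ _ (by norm_num), e2, e2]
        conv_rhs => rw [← e0 C]
        ring

theorem integrable_schur {k : X → X → ℂ} (hk : AEStronglyMeasurable (Function.uncurry k) (ν.prod ν))
    {C : ℝ≥0} (h1 : ∀ x, ∫⁻ y, ‖k x y‖ₑ ∂ν ≤ C) (h2 : ∀ y, ∫⁻ x, ‖k x y‖ₑ ∂ν ≤ C)
    (u v : Lp ℂ 2 ν) :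
    Integrable (fun q : X × X => starRingEnd ℂ (v q.1) * (k q.1 q.2 * u q.2)) (ν.prod ν) := by
  have hu := (Lp.aestronglyMeasurable u).comp_quasiMeasurePreserving
    (Measure.quasiMeasurePreserving_snd (μ := ν) (ν := ν))
  have hv := (Lp.aestronglyMeasurable v).comp_quasiMeasurePreserving
    (Measure.quasiMeasurePreserving_fst (μ := ν) (ν := ν))
  refine ⟨(Complex.continuous_conj.comp_aestronglyMeasurable hv).mul (hk.mul hu), ?_⟩
  refine lt_of_le_of_lt (le_of_eq ?_) ((lintegral_schur
    (κ := fun x y => ‖k x y‖ₑ) hk.enorm h1 h2 u v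
    (Lp.aestronglyMeasurable u) (Lp.aestronglyMeasurable v)).trans_lt
      (ENNReal.mul_lt_top (ENNReal.mul_lt_top ENNReal.coe_lt_top (Lp.eLpNorm_lt_top v))
        (Lp.eLpNorm_lt_top u)))
  refine lintegral_congr fun q => ?_
  rw [enorm_mul, enorm_mul, RCLike.enorm_conj]
  ring

/-- The Schur test, with the weak form of the operator and the bound for its norm. -/
theorem exists_schur_operator [IsFiniteMeasure ν] {k : X → X → ℂ}
    (hk : AEStronglyMeasurable (Function.uncurry k) (ν.prod ν)) {C : ℝ≥0}
    (h1 : ∀ x, ∫⁻ y, ‖k x y‖ₑ ∂ν ≤ C) (h2 : ∀ y, ∫⁻ x, ‖k x y‖ₑ ∂ν ≤ C) :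
    ∃ T : Lp ℂ 2 ν →L[ℂ] Lp ℂ 2 ν, (∀ u, T u =ᵐ[ν] fun x => ∫ y, k x y * u y ∂ν) ∧ ‖T‖ ≤ C ∧
      ∀ u v, inner ℂ v (T u) =
        ∫ q, starRingEnd ℂ (v q.1) * (k q.1 q.2 * u q.2) ∂(ν.prod ν) := by
  obtain ⟨T, hT⟩ := exists_integralOperator ν k hk C h1 h2
  have hw : ∀ u v, inner ℂ v (T u) =
      ∫ q, starRingEnd ℂ (v q.1) * (k q.1 q.2 * u q.2) ∂(ν.prod ν) := by
    intro u v
    rw [L2.inner_def, integral_prod _ (integrable_schur hk h1 h2 u v)]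
    refine integral_congr_ae ?_
    filter_upwards [hT u] with x hx
    rw [RCLike.inner_apply, hx, integral_const_mul, mul_comm]
  refine ⟨T, hT, ?_, hw⟩
  refine T.opNorm_le_bound C.2 fun u => ?_
  have hb : ‖T u‖ ^ 2 ≤ C * ‖T u‖ * ‖u‖ := by
    have h3 : ‖inner ℂ (T u) (T u)‖ = ‖T u‖ ^ 2 := by
      rw [inner_self_eq_norm_sq_to_K]; simp
    rw [← h3, hw u (T u)]
    refine (norm_integral_le_lintegral_norm _).trans ?_
    have h4 := lintegral_schur (κ := fun x y => ‖k x y‖ₑ) hk.enorm h1 h2 u (T u)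
      (Lp.aestronglyMeasurable u) (Lp.aestronglyMeasurable (T u))
    rw [Lp.norm_def, Lp.norm_def, ← ENNReal.coe_toReal C, ← ENNReal.toReal_mul,
      ← ENNReal.toReal_mul]
    refine ENNReal.toReal_mono (ENNReal.mul_lt_top (ENNReal.mul_lt_top ENNReal.coe_lt_top
      (Lp.eLpNorm_lt_top _)) (Lp.eLpNorm_lt_top u)).ne (le_trans (le_of_eq ?_) h4)
    refine lintegral_congr fun q => ?_
    rw [ofReal_norm, enorm_mul, enorm_mul, RCLike.enorm_conj]
    ring
  by_cases h0 : ‖T u‖ = 0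
  · rw [h0]; positivity
  · have : 0 < ‖T u‖ := lt_of_le_of_ne (norm_nonneg _) (Ne.symm h0)
    have h5 : ‖T u‖ * ‖T u‖ ≤ ‖T u‖ * (C * ‖u‖) := by nlinarith
    exact le_of_mul_le_mul_left h5 this

end Schur

/-! ### Periodization -/

section Lattice

variable {d : ℕ}

/-- The periodization `∑_{n ∈ ℤ^d} b(z+n)`. -/
noncomputable def perSum (b : E d → ℂ) (z : E d) : ℂ := ∑' n : Fin d → ℤ, b (z + latt n)

theorem latt_neg (n : Fin d → ℤ) : latt (-n) = -latt n := by
  ext i; simp [latt]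

theorem iUnion_cell_translates :
    ⋃ n : Fin d → ℤ, (fun y : E d => y + latt (-n)) ⁻¹' cell d = univ := by
  refine eq_univ_of_forall fun y => mem_iUnion.2 ⟨fun i => ⌊y i⌋, fun i => ?_⟩
  have : (y + latt (-fun i => ⌊y i⌋)) i = Int.fract (y i) := by
    simp [latt, Int.fract, sub_eq_add_neg]
  rw [this]
  exact ⟨Int.fract_nonneg _, Int.fract_lt_one _⟩

theorem measurableSet_cell_translate (n : Fin d → ℤ) :
    MeasurableSet ((fun y : E d => y + latt (-n)) ⁻¹' cell d) :=
  (measurable_add_const _) (measurableSet_cell d)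

theorem pairwise_disjoint_cell_translates :
    Pairwise (Function.onFun Disjoint
      fun n : Fin d → ℤ => (fun y : E d => y + latt (-n)) ⁻¹' cell d) := by
  intro m n hmn
  refine Set.disjoint_left.2 fun y hm hn => hmn ?_
  exact neg_injective (latt_injOn_cell y _ _ hm hn)

theorem preimage_cell_translate (n : Fin d → ℤ) :
    (fun y : E d => y + latt n) ⁻¹' ((fun y : E d => y + latt (-n)) ⁻¹' cell d) = cell d := by
  ext y
  simp [latt_neg]

theorem lintegral_eq_lintegral_cell_tsum {f : E d → ℝ≥0∞} (hf : AEMeasurable f) :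
    ∫⁻ y, f y = ∫⁻ y in cell d, ∑' n : Fin d → ℤ, f (y + latt n) := by
  have hm : ∀ n : Fin d → ℤ, AEMeasurable (fun y => f (y + latt n)) (cellMeasure d) := fun n =>
    (hf.comp_quasiMeasurePreserving
      (measurePreserving_add_right volume (latt n)).quasiMeasurePreserving).restrict
  rw [lintegral_tsum hm, ← setLIntegral_univ, ← iUnion_cell_translates,
    lintegral_iUnion measurableSet_cell_translate pairwise_disjoint_cell_translates]
  refine tsum_congr fun n => ?_
  rw [← (measurePreserving_add_right volume (latt n)).setLIntegral_comp_preimage_emb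
    (measurableEmbedding_addRight _), preimage_cell_translate]

theorem integral_eq_integral_cell_tsum {f : E d → ℂ} (hf : Integrable f) :
    ∫ y, f y = ∫ y in cell d, ∑' n : Fin d → ℤ, f (y + latt n) := by
  have hm : ∀ n : Fin d → ℤ, AEStronglyMeasurable (fun y => f (y + latt n)) (cellMeasure d) :=
    fun n => (hf.1.comp_quasiMeasurePreserving
      (measurePreserving_add_right volume (latt n)).quasiMeasurePreserving).restrict
  have hfin : ∑' n : Fin d → ℤ, ∫⁻ y in cell d, ‖f (y + latt n)‖ₑ ≠ ∞ := by
    rw [← lintegral_tsum fun n => (hm n).enorm,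
      ← lintegral_eq_lintegral_cell_tsum (f := fun y => ‖f y‖ₑ) hf.1.enorm]
    exact hf.2.ne
  rw [integral_tsum hm hfin, ← setIntegral_univ, ← iUnion_cell_translates,
    integral_iUnion measurableSet_cell_translate pairwise_disjoint_cell_translates
      hf.integrableOn]
  refine tsum_congr fun n => ?_
  rw [← (measurePreserving_add_right volume (latt n)).setIntegral_preimage_emb
    (measurableEmbedding_addRight _), preimage_cell_translate]

theorem enorm_perSum_le (b : E d → ℂ) (z : E d) :
    ‖perSum b z‖ₑ ≤ absSum (fun z => ‖b z‖) z := by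
  refine enorm_tsum_le_tsum_enorm.trans (le_of_eq (tsum_congr fun n => ?_))
  rw [enorm_norm]

theorem tsum_neg_latt {M : Type*} [AddCommMonoid M] [TopologicalSpace M] (f : E d → M) (z : E d) :
    ∑' n : Fin d → ℤ, f (z - latt n) = ∑' n : Fin d → ℤ, f (z + latt n) := by
  rw [← (Equiv.neg (Fin d → ℤ)).tsum_eq]
  refine tsum_congr fun n => ?_
  rw [Equiv.neg_apply, latt_neg, sub_neg_eq_add]

theorem ae_absSum_lt_top {b : E d → ℂ} (hb : Integrable b) :
    ∀ᵐ q ∂((cellMeasure d).prod (cellMeasure d)), absSum (fun z => ‖b z‖) (q.1 - q.2) < ∞ := by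
  have hb' := hb.norm
  refine ae_lt_top' (absSum_aemeasurable hb'.1) ?_
  rw [lintegral_prod _ (absSum_aemeasurable hb'.1)]
  refine ne_of_lt ((lintegral_mono fun x => lintegral_absSum_left hb'.1 x).trans_lt ?_)
  rw [lintegral_const]
  exact ENNReal.mul_lt_top hb'.2 (measure_lt_top _ _)

theorem summable_of_absSum_lt_top {b : E d → ℂ} {z : E d}
    (hz : absSum (fun z => ‖b z‖) z < ∞) : Summable fun n : Fin d → ℤ => b (z + latt n) := by
  refine Summable.of_norm ?_
  rw [← tsum_enorm_ne_top_iff_summable_norm]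
  refine ne_of_lt (lt_of_le_of_lt (le_of_eq (tsum_congr fun n => ?_)) hz)
  rw [enorm_norm]

theorem perSum_aestronglyMeasurable {b : E d → ℂ} (hb : Integrable b) :
    AEStronglyMeasurable (fun q : E d × E d => perSum b (q.1 - q.2))
      ((cellMeasure d).prod (cellMeasure d)) := by
  refine aestronglyMeasurable_of_tendsto_ae Filter.atTop
    (f := fun (s : Finset (Fin d → ℤ)) (q : E d × E d) => ∑ n ∈ s, b (q.1 - q.2 + latt n)) ?_ ?_
  · intro s
    refine Finset.aestronglyMeasurable_fun_sum _ fun n _ => ?_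
    have h1 : Measure.QuasiMeasurePreserving (fun q : E d × E d => q.1 - q.2 + latt n)
        (volume.prod volume) volume :=
      (measurePreserving_add_right volume (latt n)).quasiMeasurePreserving.comp
        (quasiMeasurePreserving_sub volume volume)
    exact (hb.1.comp_quasiMeasurePreserving h1).mono_ac (prod_cell_ac d)
  · filter_upwards [ae_absSum_lt_top hb] with q hq
    exact (summable_of_absSum_lt_top hq).hasSum

/-- Unfolding: an integral over `ℝ^d` against a periodic function is an integral over the cell
against the periodized kernel. -/
theorem integral_unfold {b : E d → ℂ} (hb : Integrable b) {g : E d → ℂ}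
    (hg : AEStronglyMeasurable g) (hper : ∀ y n, g (y + latt n) = g y) (x : E d)
    (hfin : ∫⁻ y in cell d, absSum (fun z => ‖b z‖) (x - y) * ‖g y‖ₑ ≠ ∞) :
    Integrable (fun y => b (x - y) * g y) ∧
      ∫ y, b (x - y) * g y = ∫ y in cell d, perSum b (x - y) * g y := by
  have hmeas : AEStronglyMeasurable (fun y => b (x - y) * g y) :=
    (hb.comp_sub_left x).1.mul hg
  have hint : Integrable (fun y => b (x - y) * g y) := by
    refine ⟨hmeas, ?_⟩
    rw [HasFiniteIntegral, lintegral_eq_lintegral_cell_tsum hmeas.enorm]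
    refine lt_of_le_of_lt (le_of_eq (lintegral_congr fun y => ?_)) hfin.lt_top
    rw [absSum, ← ENNReal.tsum_mul_right,
      ← tsum_neg_latt (fun w => ‖(fun z => ‖b z‖) w‖ₑ * ‖g y‖ₑ)]
    refine tsum_congr fun n => ?_
    rw [enorm_mul, hper, enorm_norm, sub_add_eq_sub_sub]
  refine ⟨hint, ?_⟩
  rw [integral_eq_integral_cell_tsum hint]
  refine integral_congr_ae (Filter.Eventually.of_forall fun y => ?_)
  dsimp only
  rw [perSum, ← tsum_mul_right, ← tsum_neg_latt (fun w => b w * g y)]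
  refine tsum_congr fun n => ?_
  rw [hper, sub_add_eq_sub_sub]

theorem perExt_add_latt (u : E d → ℂ) (y : E d) (n : Fin d → ℤ) :
    perExt u (y + latt n) = perExt u y := by
  simp [perExt, latt]

theorem perExt_of_mem_cell (u : E d → ℂ) {y : E d} (hy : y ∈ cell d) : perExt u y = u y := by
  unfold perExt
  congr 1
  ext i
  exact Int.fract_eq_self.2 (hy i)

theorem perExt_aestronglyMeasurable (u : L2 d) : AEStronglyMeasurable (perExt u) := by
  refine ((Lp.stronglyMeasurable u).comp_measurable ?_).aestronglyMeasurable
  refine (WithLp.measurable_toLp 2 (Fin d → ℝ)).comp (measurable_pi_lambda _ fun i => ?_)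
  have : Measurable fun x : E d => x i := by fun_prop
  exact this.fract

end Lattice

/-! ### Periodized convolution operators with the weight `μ` -/

section Operators

variable {d : ℕ} {a : E d → ℝ} {μ : E d → E d → ℝ} {μm μp : ℝ}

namespace Admissible

theorem μp_pos (h : Admissible a μ μm μp) : 0 < μp :=
  h.μm_pos.trans_le ((h.le_μ 0 0).trans (h.μ_le 0 0))

theorem μ_nonneg (h : Admissible a μ μm μp) (x y : E d) : 0 ≤ μ x y :=
  h.μm_pos.le.trans (h.le_μ x y)

theorem μ_add_latt (h : Admissible a μ μm μp) (x y : E d) (n : Fin d → ℤ) :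
    μ x (y + latt n) = μ x y := by
  have h0 : (latt 0 : E d) = 0 := by ext i; simp [latt]
  have := h.periodic x y 0 n
  rwa [h0, add_zero] at this

theorem lintegral_kernel_left (h : Admissible a μ μm μp) {b : E d → ℂ} (hb : Integrable b)
    (x : E d) : ∫⁻ y in cell d, absSum (fun z => ‖b z‖) (x - y) * ENNReal.ofReal μp
      ≤ Real.toNNReal (μp * ∫ z, ‖b z‖) := by
  rw [lintegral_mul_const' _ _ ENNReal.ofReal_ne_top, ← ENNReal.ofReal,
    ENNReal.ofReal_mul h.μp_pos.le, ofReal_integral_norm_eq_lintegral_enorm hb, mul_comm]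
  refine mul_le_mul' le_rfl ((lintegral_absSum_left hb.norm.1 x).trans (le_of_eq ?_))
  exact lintegral_congr fun z => enorm_norm _

theorem lintegral_kernel_right (h : Admissible a μ μm μp) {b : E d → ℂ} (hb : Integrable b)
    (y : E d) : ∫⁻ x in cell d, absSum (fun z => ‖b z‖) (x - y) * ENNReal.ofReal μp
      ≤ Real.toNNReal (μp * ∫ z, ‖b z‖) := by
  rw [lintegral_mul_const' _ _ ENNReal.ofReal_ne_top, ← ENNReal.ofReal,
    ENNReal.ofReal_mul h.μp_pos.le, ofReal_integral_norm_eq_lintegral_enorm hb, mul_comm]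
  refine mul_le_mul' le_rfl ((lintegral_absSum_right hb.norm.1 y).trans (le_of_eq ?_))
  exact lintegral_congr fun z => enorm_norm _

theorem enorm_kernel_le (h : Admissible a μ μm μp) (b : E d → ℂ) (x y : E d) :
    ‖perSum b (x - y) * (μ x y : ℂ)‖ₑ ≤ absSum (fun z => ‖b z‖) (x - y) * ENNReal.ofReal μp := by
  rw [enorm_mul]
  refine mul_le_mul' (enorm_perSum_le b _) ?_
  rw [← ofReal_norm, Complex.norm_real]
  exact ENNReal.ofReal_le_ofReal (h.abs_μ_le x y)

theorem kernel_aestronglyMeasurable (h : Admissible a μ μm μp) {b : E d → ℂ} (hb : Integrable b) :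
    AEStronglyMeasurable (Function.uncurry fun x y => perSum b (x - y) * (μ x y : ℂ))
      ((cellMeasure d).prod (cellMeasure d)) :=
  (perSum_aestronglyMeasurable hb).mul (Complex.continuous_ofReal.comp_aestronglyMeasurable
    (h.measurable_μ.mono_ac (prod_cell_ac d)))

theorem exists_opK (h : Admissible a μ μm μp) {b : E d → ℂ} (hb : Integrable b) :
    ∃ T : L2 d →L[ℂ] L2 d,
      (∀ u, T u =ᵐ[cellMeasure d] fun x => ∫ y in cell d, perSum b (x - y) * (μ x y : ℂ) * u y) ∧
      ‖T‖ ≤ Real.toNNReal (μp * ∫ z, ‖b z‖) ∧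
      ∀ u v, inner ℂ v (T u) =
        ∫ q, starRingEnd ℂ (v q.1) * (perSum b (q.1 - q.2) * (μ q.1 q.2 : ℂ) * u q.2)
          ∂((cellMeasure d).prod (cellMeasure d)) :=
  exists_schur_operator (h.kernel_aestronglyMeasurable hb)
    (fun x => (lintegral_mono fun y => h.enorm_kernel_le b x y).trans
      (h.lintegral_kernel_left hb x))
    (fun y => (lintegral_mono fun x => h.enorm_kernel_le b x y).trans
      (h.lintegral_kernel_right hb y))

/-- The operator `u ↦ ∫_Ω ∑_n b(x-y+n) μ(x,y) u(y) dy` on `L₂(Ω)`, for `b ∈ L₁(ℝ^d)`. On periodic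
functions this is `u ↦ ∫_{ℝ^d} b(x-y) μ(x,y) u(y) dy`. -/
noncomputable def opK (h : Admissible a μ μm μp) {b : E d → ℂ} (hb : Integrable b) :
    L2 d →L[ℂ] L2 d :=
  (h.exists_opK hb).choose

theorem opK_spec (h : Admissible a μ μm μp) {b : E d → ℂ} (hb : Integrable b) (u : L2 d) :
    h.opK hb u =ᵐ[cellMeasure d]
      fun x => ∫ y in cell d, perSum b (x - y) * (μ x y : ℂ) * u y :=
  (h.exists_opK hb).choose_spec.1 u

theorem norm_opK_le (h : Admissible a μ μm μp) {b : E d → ℂ} (hb : Integrable b) :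
    ‖h.opK hb‖ ≤ μp * ∫ z, ‖b z‖ := by
  have := (h.exists_opK hb).choose_spec.2.1
  exact this.trans_eq
    (Real.coe_toNNReal _ (mul_nonneg h.μp_pos.le (integral_nonneg fun _ => norm_nonneg _)))

theorem inner_opK (h : Admissible a μ μm μp) {b : E d → ℂ} (hb : Integrable b) (u v : L2 d) :
    inner ℂ v (h.opK hb u) =
      ∫ q, starRingEnd ℂ (v q.1) * (perSum b (q.1 - q.2) * (μ q.1 q.2 : ℂ) * u q.2)
        ∂((cellMeasure d).prod (cellMeasure d)) :=
  (h.exists_opK hb).choose_spec.2.2 u v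

theorem integrable_inner_opK (h : Admissible a μ μm μp) {b : E d → ℂ} (hb : Integrable b)
    (u v : L2 d) :
    Integrable (fun q : E d × E d =>
      starRingEnd ℂ (v q.1) * (perSum b (q.1 - q.2) * (μ q.1 q.2 : ℂ) * u q.2))
        ((cellMeasure d).prod (cellMeasure d)) :=
  integrable_schur (h.kernel_aestronglyMeasurable hb)
    (fun x => (lintegral_mono fun y => h.enorm_kernel_le b x y).trans
      (h.lintegral_kernel_left hb x))
    (fun y => (lintegral_mono fun x => h.enorm_kernel_le b x y).trans
      (h.lintegral_kernel_right hb y))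
    u v

theorem opK_sub (h : Admissible a μ μm μp) {b c : E d → ℂ} (hb : Integrable b) (hc : Integrable c) :
    h.opK hb - h.opK hc = h.opK (hb.sub hc) := by
  ext1 u
  refine ext_inner_left ℂ fun v => ?_
  rw [sub_apply, inner_sub_right, inner_opK, inner_opK, inner_opK,
    ← integral_sub (h.integrable_inner_opK hb u v) (h.integrable_inner_opK hc u v)]
  refine integral_congr_ae ?_
  filter_upwards [ae_absSum_lt_top hb, ae_absSum_lt_top hc] with q h1 h2
  have : perSum (b - c) (q.1 - q.2) = perSum b (q.1 - q.2) - perSum c (q.1 - q.2) :=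
    (summable_of_absSum_lt_top h1).tsum_sub (summable_of_absSum_lt_top h2)
  rw [this]
  ring

theorem opK_eq_sum (h : Admissible a μ μm μp) {ι : Type*} [Fintype ι] {b : E d → ℂ}
    {f : ι → E d → ℂ} {c : ι → ℂ} (hb : Integrable b) (hf : ∀ i, Integrable (f i))
    (hsum : ∀ z, b z = ∑ i, c i * f i z) : h.opK hb = ∑ i, c i • h.opK (hf i) := by
  ext1 u
  refine ext_inner_left ℂ fun v => ?_
  rw [sum_apply, inner_sum]
  simp only [smul_apply, inner_smul_right, inner_opK, ← integral_const_mul]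
  rw [← integral_finsetSum _ fun i _ => (h.integrable_inner_opK (hf i) u v).const_mul (c i)]
  refine integral_congr_ae ?_
  filter_upwards [ae_all_iff.2 fun i => ae_absSum_lt_top (hf i)] with q hq
  have : perSum b (q.1 - q.2) = ∑ i, c i * perSum (f i) (q.1 - q.2) := by
    simp only [perSum, hsum, ← tsum_mul_left]
    exact Summable.tsum_finsetSum fun i _ => (summable_of_absSum_lt_top (hq i)).mul_left (c i)
  rw [this, Finset.sum_mul, Finset.sum_mul, Finset.mul_sum]
  refine Finset.sum_congr rfl fun i _ => ?_
  ring

theorem opK_isSelfAdjoint (h : Admissible a μ μm μp) {b : E d → ℂ} (hb : Integrable b)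
    (hsymm : ∀ z, starRingEnd ℂ (b (-z)) = b z) : IsSelfAdjoint (h.opK hb) := by
  rw [ContinuousLinearMap.isSelfAdjoint_iff_isSymmetric]
  intro u v
  change inner ℂ (h.opK hb u) v = inner ℂ u (h.opK hb v)
  rw [← inner_conj_symm, inner_opK, inner_opK, ← integral_conj, ← integral_prod_swap]
  refine integral_congr_ae (Filter.Eventually.of_forall fun q => ?_)
  have : starRingEnd ℂ (perSum b (q.2 - q.1)) = perSum b (q.1 - q.2) := by
    rw [perSum, Complex.conj_tsum, perSum, ← tsum_neg_latt]
    refine tsum_congr fun n => ?_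
    have e : -(q.1 - q.2 - latt n) = q.2 - q.1 + latt n := by abel
    rw [← hsymm (q.1 - q.2 - latt n), e]
  simp only [Prod.swap]
  rw [map_mul, map_mul, map_mul, this, Complex.conj_conj, Complex.conj_ofReal, h.symm q.2 q.1]
  ring

end Admissible

/-- The convolution kernel `a(z) exp(-i⟨ξ,z⟩)` of the nonlocal part of `𝔸(ξ)`. -/
noncomputable def modulated (a : E d → ℝ) (ξ z : E d) : ℂ :=
  (a z : ℂ) * Complex.exp (-Complex.I * ((inner ℝ ξ z : ℝ) : ℂ))

theorem norm_modulated (a : E d → ℝ) (ξ z : E d) : ‖modulated a ξ z‖ = |a z| := by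
  rw [modulated, norm_mul, Complex.norm_real, Complex.norm_exp]
  simp

theorem integrable_modulated (ha : Integrable a) (ξ : E d) : Integrable (modulated a ξ) := by
  refine ha.abs.mono' ((Complex.continuous_ofReal.comp_aestronglyMeasurable ha.1).mul
    (Continuous.aestronglyMeasurable (by fun_prop))) (Filter.Eventually.of_forall fun z => ?_)
  exact (norm_modulated a ξ z).le

theorem modulated_zero (a : E d → ℝ) (z : E d) : modulated a 0 z = (a z : ℂ) := by
  simp [modulated]

theorem perSum_modulated (a : E d → ℝ) (ξ z : E d) : perSum (modulated a ξ) z = aTilde a ξ z := rfl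

/-- `∑_n a(z+n)`, the periodization of the unmodulated kernel. -/
noncomputable def alphaSum (a : E d → ℝ) (z : E d) : ℝ := ∑' n : Fin d → ℤ, a (z + latt n)

theorem aTilde_zero (a : E d → ℝ) (z : E d) : aTilde a 0 z = (alphaSum a z : ℂ) := by
  rw [alphaSum, Complex.ofReal_tsum]
  exact tsum_congr fun n => modulated_zero a _

namespace Admissible

theorem alphaSum_nonneg (h : Admissible a μ μm μp) (z : E d) : 0 ≤ alphaSum a z :=
  tsum_nonneg fun _ => h.nonneg _

theorem alphaSum_neg (h : Admissible a μ μm μp) (z : E d) : alphaSum a (-z) = alphaSum a z := by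
  rw [alphaSum, alphaSum, ← tsum_neg_latt]
  refine tsum_congr fun n => ?_
  rw [← h.even]
  congr 1
  abel

theorem norm_aTilde_le (h : Admissible a μ μm μp) (ξ z : E d) :
    ‖aTilde a ξ z‖ ≤ alphaSum a z := by
  have hn : ∀ n : Fin d → ℤ, ‖modulated a ξ (z + latt n)‖ = a (z + latt n) := fun n => by
    rw [norm_modulated, abs_of_nonneg (h.nonneg _)]
  by_cases hs : Summable fun n : Fin d → ℤ => ‖modulated a ξ (z + latt n)‖
  · exact (norm_tsum_le_tsum_norm hs).trans (le_of_eq (tsum_congr hn))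
  · have : aTilde a ξ z = 0 := tsum_eq_zero_of_not_summable
      (f := fun n => modulated a ξ (z + latt n))
      fun hc => hs hc.norm
    rw [this, norm_zero]
    exact h.alphaSum_nonneg z

theorem ae_measurable_μ (h : Admissible a μ μm μp) :
    ∀ᵐ x ∂(cellMeasure d), AEStronglyMeasurable (fun y => μ x y) volume :=
  ae_restrict_of_ae h.measurable_μ.prodMk_left

theorem unfold_of_bounded (h : Admissible a μ μm μp) {b : E d → ℂ} (hb : Integrable b)
    {g : E d → ℂ} (hg : AEStronglyMeasurable g) (hper : ∀ y n, g (y + latt n) = g y)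
    (hbd : ∀ y, ‖g y‖ ≤ 1) {x : E d} (hx : AEStronglyMeasurable (fun y => μ x y) volume) :
    Integrable (fun y => b (x - y) * ((μ x y : ℂ) * g y)) ∧
      ∫ y, b (x - y) * ((μ x y : ℂ) * g y)
        = ∫ y in cell d, perSum b (x - y) * ((μ x y : ℂ) * g y) := by
  refine integral_unfold hb (g := fun y => (μ x y : ℂ) * g y)
    ((Complex.continuous_ofReal.comp_aestronglyMeasurable hx).mul hg)
    (fun y n => by rw [hper, h.μ_add_latt]) x (ne_of_lt ?_)
  refine ((lintegral_mono fun y => ?_).trans (h.lintegral_kernel_left hb x)).trans_lt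
    ENNReal.coe_lt_top
  dsimp only
  gcongr
  rw [← ofReal_norm, norm_mul, Complex.norm_real]
  exact ENNReal.ofReal_le_ofReal ((mul_le_mul (h.abs_μ_le x y) (hbd y) (norm_nonneg _)
    h.μp_pos.le).trans_eq (mul_one _))

theorem ae_potential_eq (h : Admissible a μ μm μp) : ∀ᵐ x ∂(cellMeasure d),
    potential a μ x = ∫ y in cell d, alphaSum a (x - y) * μ x y := by
  filter_upwards [h.ae_measurable_μ] with x hx
  have h1 := (h.unfold_of_bounded (integrable_modulated h.integrable_a 0) (g := fun _ => 1)
    aestronglyMeasurable_const (fun _ _ => rfl) (fun _ => by simp) hx).2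
  rw [← Complex.ofReal_inj, potential, ← integral_complex_ofReal, ← integral_complex_ofReal]
  simp only [modulated_zero, perSum_modulated, aTilde_zero, mul_one] at h1
  simpa only [Complex.ofReal_mul] using h1

/-- For a.e. `x` the operator `opK` is given by an integral over all of `ℝ^d`. -/
theorem ae_opK_eq (h : Admissible a μ μm μp) {b : E d → ℂ} (hb : Integrable b) (v : L2 d) :
    ∀ᵐ x ∂(cellMeasure d), Integrable (fun y => b (x - y) * ((μ x y : ℂ) * perExt v y)) ∧
      ∫ y, b (x - y) * ((μ x y : ℂ) * perExt v y) = h.opK hb v x := by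
  have hfin : ∀ᵐ x ∂(cellMeasure d),
      ∫⁻ y in cell d, absSum (fun z => ‖b z‖) (x - y) * ENNReal.ofReal μp * ‖v y‖ₑ < ∞ := by
    have hmeas : AEMeasurable (fun q : E d × E d => absSum (fun z => ‖b z‖) (q.1 - q.2)
        * ENNReal.ofReal μp) ((cellMeasure d).prod (cellMeasure d)) :=
      (absSum_aemeasurable hb.norm.1).mul_const _
    have hv := ((Lp.aestronglyMeasurable v).comp_quasiMeasurePreserving
      (Measure.quasiMeasurePreserving_snd (μ := cellMeasure d) (ν := cellMeasure d))).enorm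
    have hle := lintegral_schur (ν := cellMeasure d)
      (κ := fun x y => absSum (fun z => ‖b z‖) (x - y) * ENNReal.ofReal μp) hmeas
      (h.lintegral_kernel_left hb) (h.lintegral_kernel_right hb) v (fun _ => 1)
      (Lp.aestronglyMeasurable v) aestronglyMeasurable_const
    simp only [enorm_one, one_mul] at hle
    refine ae_lt_top' (AEMeasurable.lintegral_prod_right' (f := fun q : E d × E d =>
      absSum (fun z => ‖b z‖) (q.1 - q.2) * ENNReal.ofReal μp * ‖v q.2‖ₑ) (hmeas.mul hv)) ?_
    rw [← lintegral_prod (fun q : E d × E d =>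
      absSum (fun z => ‖b z‖) (q.1 - q.2) * ENNReal.ofReal μp * ‖v q.2‖ₑ) (hmeas.mul hv)]
    refine (hle.trans_lt (ENNReal.mul_lt_top (ENNReal.mul_lt_top ENNReal.coe_lt_top ?_)
      (Lp.eLpNorm_lt_top v))).ne
    exact (memLp_const (1 : ℂ)).eLpNorm_lt_top
  filter_upwards [hfin, h.ae_measurable_μ, h.opK_spec hb v] with x hx hxm hK
  have hE : ∀ᵐ y ∂(cellMeasure d), perExt v y = v y :=
    (ae_restrict_iff' (measurableSet_cell d)).2
      (Filter.Eventually.of_forall fun y hy => perExt_of_mem_cell v hy)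
  have hU := integral_unfold hb (g := fun y => (μ x y : ℂ) * perExt v y)
    ((Complex.continuous_ofReal.comp_aestronglyMeasurable hxm).mul (perExt_aestronglyMeasurable v))
    (fun y n => by rw [perExt_add_latt, h.μ_add_latt]) x (by
      refine ne_of_lt (lt_of_le_of_lt (lintegral_mono_ae ?_) hx)
      filter_upwards [hE] with y hy
      rw [hy, enorm_mul, ← mul_assoc]
      gcongr
      rw [← ofReal_norm, Complex.norm_real]
      exact ENNReal.ofReal_le_ofReal (h.abs_μ_le x y))
  refine ⟨hU.1, hU.2.trans ?_⟩
  rw [hK]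
  refine integral_congr_ae ?_
  filter_upwards [hE] with y hy
  rw [hy, mul_assoc]

theorem exists_opM (h : Admissible a μ μm μp) : ∃ T : L2 d →L[ℂ] L2 d,
    ∀ u : L2 d, T u =ᵐ[cellMeasure d] fun x => (potential a μ x : ℂ) * u x :=
  exists_mulOperator (cellMeasure d) (fun x => (potential a μ x : ℂ))
    (Complex.continuous_ofReal.comp_aestronglyMeasurable (potential_aestronglyMeasurable h))
    (Real.toNNReal (μp * ∫ z, |a z|)) (fun x => by
      rw [Complex.norm_real]
      exact (abs_potential_le h x).trans (Real.le_coe_toNNReal _))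

/-- Multiplication by the potential `p` on `L₂(Ω)`. -/
noncomputable def opM (h : Admissible a μ μm μp) : L2 d →L[ℂ] L2 d := h.exists_opM.choose

theorem opM_spec (h : Admissible a μ μm μp) (u : L2 d) :
    h.opM u =ᵐ[cellMeasure d] fun x => (potential a μ x : ℂ) * u x :=
  h.exists_opM.choose_spec u

theorem opM_isSelfAdjoint (h : Admissible a μ μm μp) : IsSelfAdjoint h.opM := by
  rw [ContinuousLinearMap.isSelfAdjoint_iff_isSymmetric]
  intro u v
  change inner ℂ (h.opM u) v = inner ℂ u (h.opM v)
  rw [L2.inner_def, L2.inner_def]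
  refine integral_congr_ae ?_
  filter_upwards [h.opM_spec u, h.opM_spec v] with x hu hv
  rw [hu, hv, RCLike.inner_apply, RCLike.inner_apply, map_mul, Complex.conj_ofReal]
  ring

theorem opA_eq (h : Admissible a μ μm μp) (ξ : E d) :
    opA h ξ = h.opM - h.opK (integrable_modulated h.integrable_a ξ) := by
  ext1 u
  refine Lp.ext ?_
  filter_upwards [opA_spec h ξ u, h.opM_spec u,
    h.opK_spec (integrable_modulated h.integrable_a ξ) u,
    Lp.coeFn_sub (h.opM u) (h.opK (integrable_modulated h.integrable_a ξ) u)] with x h1 h2 h3 h4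
  rw [sub_apply, h4, Pi.sub_apply, h1, h2, h3]
  rfl

theorem opA_isSelfAdjoint (h : Admissible a μ μm μp) (ξ : E d) : IsSelfAdjoint (opA h ξ) := by
  rw [h.opA_eq]
  refine h.opM_isSelfAdjoint.sub (h.opK_isSelfAdjoint _ fun z => ?_)
  rw [modulated, modulated, map_mul, Complex.conj_ofReal, h.even, ← Complex.exp_conj]
  simp

/-! ### The quadratic form -/

theorem re_inner_opM (h : Admissible a μ μm μp) (u : L2 d) :
    Integrable (fun q : E d × E d => alphaSum a (q.1 - q.2) * μ q.1 q.2 * ‖u q.1‖ ^ 2)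
      ((cellMeasure d).prod (cellMeasure d)) ∧
    (inner ℂ u (h.opM u)).re =
      ∫ q, alphaSum a (q.1 - q.2) * μ q.1 q.2 * ‖u q.1‖ ^ 2
        ∂((cellMeasure d).prod (cellMeasure d)) := by
  have hb := integrable_modulated h.integrable_a (0 : E d)
  have hk := h.kernel_aestronglyMeasurable hb
  have hu := (Lp.aestronglyMeasurable u).comp_quasiMeasurePreserving
      (Measure.quasiMeasurePreserving_fst (μ := cellMeasure d) (ν := cellMeasure d))
  have hkn : ∀ x y, ‖perSum (modulated a 0) (x - y) * (μ x y : ℂ)‖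
      = alphaSum a (x - y) * μ x y := fun x y => by
    rw [perSum_modulated, aTilde_zero, ← Complex.ofReal_mul, Complex.norm_real, Real.norm_eq_abs,
      abs_of_nonneg (mul_nonneg (h.alphaSum_nonneg _) (h.μ_nonneg _ _))]
  have hi : Integrable (fun q : E d × E d => alphaSum a (q.1 - q.2) * μ q.1 q.2 * ‖u q.1‖ ^ 2)
      ((cellMeasure d).prod (cellMeasure d)) := by
    have hm : AEStronglyMeasurable (fun q : E d × E d =>
        alphaSum a (q.1 - q.2) * μ q.1 q.2 * ‖u q.1‖ ^ 2)
        ((cellMeasure d).prod (cellMeasure d)) := by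
      refine AEStronglyMeasurable.mul ?_ (hu.norm.pow 2)
      refine hk.norm.congr (Filter.Eventually.of_forall fun q => ?_)
      exact hkn q.1 q.2
    refine ⟨hm, ?_⟩
    have := lintegral_schur_fst (ν := cellMeasure d)
      (κ := fun x y => ‖perSum (modulated a 0) (x - y) * (μ x y : ℂ)‖ₑ) hk.enorm
      (fun x => (lintegral_mono fun y => h.enorm_kernel_le _ x y).trans
        (h.lintegral_kernel_left hb x)) u (Lp.aestronglyMeasurable u)
    refine lt_of_le_of_lt (le_of_eq (lintegral_congr fun q => ?_)) (this.trans_lt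
      (ENNReal.mul_lt_top ENNReal.coe_lt_top (ENNReal.pow_lt_top (Lp.eLpNorm_lt_top u))))
    rw [← ofReal_norm (perSum _ _ * _), hkn, enorm_mul, enorm_pow, enorm_norm,
      ← ofReal_norm, Real.norm_eq_abs,
      abs_of_nonneg (mul_nonneg (h.alphaSum_nonneg _) (h.μ_nonneg _ _))]
  refine ⟨hi, ?_⟩
  rw [integral_prod _ hi, L2.inner_def, ← RCLike.re_eq_complex_re, ← integral_re]
  · refine integral_congr_ae ?_
    filter_upwards [h.opM_spec u, h.ae_potential_eq] with x h1 h2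
    rw [integral_mul_const, ← h2, h1, RCLike.inner_apply, mul_assoc, Complex.mul_conj,
      Complex.normSq_eq_norm_sq, ← Complex.ofReal_mul]
    rfl
  · exact L2.integrable_inner u (h.opM u)

/-- The integrand of the quadratic form of `𝔸(ξ)`, symmetrized in `x` and `y`, without the
factor `μ(x,y)`. -/
noncomputable def formDensity (a : E d → ℝ) (ξ : E d) (u : E d → ℂ) (q : E d × E d) : ℝ :=
  alphaSum a (q.1 - q.2) * ((‖u q.1‖ ^ 2 + ‖u q.2‖ ^ 2) / 2)
    - (starRingEnd ℂ (u q.1) * (aTilde a ξ (q.1 - q.2) * u q.2)).re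

theorem formDensity_nonneg (h : Admissible a μ μm μp) (ξ : E d) (u : E d → ℂ) (q : E d × E d) :
    0 ≤ formDensity a ξ u q := by
  have h1 : (starRingEnd ℂ (u q.1) * (aTilde a ξ (q.1 - q.2) * u q.2)).re
      ≤ alphaSum a (q.1 - q.2) * (‖u q.1‖ * ‖u q.2‖) := by
    refine (Complex.re_le_norm _).trans ?_
    rw [norm_mul, norm_mul, RCLike.norm_conj]
    calc ‖u q.1‖ * (‖aTilde a ξ (q.1 - q.2)‖ * ‖u q.2‖)
        = ‖aTilde a ξ (q.1 - q.2)‖ * (‖u q.1‖ * ‖u q.2‖) := by ring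
      _ ≤ _ := by gcongr; exact h.norm_aTilde_le ξ _
  have h2 : alphaSum a (q.1 - q.2) * (‖u q.1‖ * ‖u q.2‖)
      ≤ alphaSum a (q.1 - q.2) * ((‖u q.1‖ ^ 2 + ‖u q.2‖ ^ 2) / 2) := by
    refine mul_le_mul_of_nonneg_left ?_ (h.alphaSum_nonneg _)
    nlinarith [sq_nonneg (‖u q.1‖ - ‖u q.2‖)]
  rw [formDensity]
  linarith

/-- The quadratic form of `𝔸(ξ)` as a double integral over the cell. Since the kernel of the
multiplication part is symmetric, `|u(x)|²` may be replaced by `(|u(x)|² + |u(y)|²) / 2`. -/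
theorem re_inner_opA (h : Admissible a μ μm μp) (ξ : E d) (u : L2 d) :
    Integrable (fun q => μ q.1 q.2 * formDensity a ξ u q)
      ((cellMeasure d).prod (cellMeasure d)) ∧
    (inner ℂ u (opA h ξ u)).re =
      ∫ q, μ q.1 q.2 * formDensity a ξ u q ∂((cellMeasure d).prod (cellMeasure d)) := by
  obtain ⟨hi, hM⟩ := h.re_inner_opM u
  have hb := integrable_modulated h.integrable_a ξ
  have hK := h.integrable_inner_opK hb u u
  have hsw : (fun q : E d × E d => alphaSum a (q.1 - q.2) * μ q.1 q.2 * ‖u q.2‖ ^ 2)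
      = fun q : E d × E d => (fun q : E d × E d =>
        alphaSum a (q.1 - q.2) * μ q.1 q.2 * ‖u q.1‖ ^ 2) q.swap := by
    funext q
    simp only [Prod.swap]
    rw [← neg_sub q.1 q.2, h.alphaSum_neg, h.symm]
  have hi' : Integrable (fun q : E d × E d => alphaSum a (q.1 - q.2) * μ q.1 q.2 * ‖u q.2‖ ^ 2)
      ((cellMeasure d).prod (cellMeasure d)) := by
    rw [hsw]; exact hi.swap
  have hM' : (inner ℂ u (h.opM u)).re =
      ∫ q, alphaSum a (q.1 - q.2) * μ q.1 q.2 * ‖u q.2‖ ^ 2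
        ∂((cellMeasure d).prod (cellMeasure d)) := by
    rw [hM, hsw]
    exact (integral_prod_swap _).symm
  have e : (fun q : E d × E d => μ q.1 q.2 * formDensity a ξ u q) = fun q =>
      (alphaSum a (q.1 - q.2) * μ q.1 q.2 * ‖u q.1‖ ^ 2
        + alphaSum a (q.1 - q.2) * μ q.1 q.2 * ‖u q.2‖ ^ 2) / 2
        - (starRingEnd ℂ (u q.1) * (perSum (modulated a ξ) (q.1 - q.2) * (μ q.1 q.2 : ℂ)
            * u q.2)).re := by
    funext q
    have : starRingEnd ℂ (u q.1) * (perSum (modulated a ξ) (q.1 - q.2) * (μ q.1 q.2 : ℂ) * u q.2)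
        = (μ q.1 q.2 : ℂ) * (starRingEnd ℂ (u q.1) * (aTilde a ξ (q.1 - q.2) * u q.2)) := by
      rw [perSum_modulated]; ring
    rw [this, Complex.re_ofReal_mul, formDensity]
    ring
  have hadd : Integrable (fun q : E d × E d => (alphaSum a (q.1 - q.2) * μ q.1 q.2 * ‖u q.1‖ ^ 2
      + alphaSum a (q.1 - q.2) * μ q.1 q.2 * ‖u q.2‖ ^ 2) / 2)
      ((cellMeasure d).prod (cellMeasure d)) := (hi.add hi').div_const 2
  have hre : Integrable (fun q : E d × E d => (starRingEnd ℂ (u q.1) *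
      (perSum (modulated a ξ) (q.1 - q.2) * (μ q.1 q.2 : ℂ) * u q.2)).re)
      ((cellMeasure d).prod (cellMeasure d)) := hK.re
  rw [e]
  refine ⟨hadd.sub hre, ?_⟩
  rw [integral_sub hadd hre, integral_div, integral_add hi hi', ← hM, ← hM',
    h.opA_eq, sub_apply, inner_sub_right, Complex.sub_re, h.inner_opK hb, add_self_div_two]
  congr 1
  exact (integral_re hK).symm

theorem opA_nonneg (h : Admissible a μ μm μp) (ξ : E d) : 0 ≤ opA h ξ := by
  refine isPositive_of_re_inner_nonneg (h.opA_isSelfAdjoint ξ) fun u => ?_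
  rw [(h.re_inner_opA ξ u).2]
  exact integral_nonneg fun q => mul_nonneg (h.μ_nonneg _ _) (h.formDensity_nonneg ξ u q)

/-- The coefficients with `μ` replaced by the constant `1`. -/
theorem unweighted (h : Admissible a μ μm μp) : Admissible a (fun _ _ => 1) 1 1 where
  integrable_a := h.integrable_a
  support_pos := h.support_pos
  nonneg := h.nonneg
  even := h.even
  measurable_μ := aestronglyMeasurable_const
  μm_pos := one_pos
  le_μ _ _ := le_rfl
  μ_le _ _ := le_rfl
  symm _ _ := rfl
  periodic _ _ _ _ := rfl
  integrable_moment := h.integrable_moment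

/-- The form density is nonnegative, so bounding `μ` below by `μ₋` bounds the quadratic form below
by `μ₋` times the one for `μ = 1`. -/
theorem re_inner_opA_unweighted_le (h : Admissible a μ μm μp) (ξ : E d) (u : L2 d) :
    μm * (inner ℂ u (opA h.unweighted ξ u)).re ≤ (inner ℂ u (opA h ξ u)).re := by
  have h1 := h.unweighted.re_inner_opA ξ u
  have h2 := h.re_inner_opA ξ u
  rw [h1.2, h2.2, ← integral_const_mul]
  refine integral_mono (h1.1.const_mul _) h2.1 fun q => ?_
  simp only [one_mul]
  exact mul_le_mul_of_nonneg_right (h.le_μ _ _) (h.formDensity_nonneg ξ u q)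

end Admissible
end Operators

/-! ### Fourier series on the cell -/

section Fourier

variable {d : ℕ}

/-- The Haar probability measure on the torus `(ℝ/ℤ)^d`. -/
noncomputable def torusMeasure (d : ℕ) : Measure (UnitAddTorus (Fin d)) :=
  Measure.pi fun _ => AddCircle.haarAddCircle

/-- The representative in `[0,1)^d` of a point of the torus. -/
noncomputable def torusRep (t : UnitAddTorus (Fin d)) : E d :=
  WithLp.toLp 2 fun i => ((AddCircle.equivIco 1 0 (t i) : Ico (0 : ℝ) (0 + 1)) : ℝ)

theorem measurePreserving_circleRep :
    MeasurePreserving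
      (fun t : UnitAddCircle => ((AddCircle.equivIco 1 0 t : Ico (0 : ℝ) (0 + 1)) : ℝ))
      AddCircle.haarAddCircle (volume.restrict (Ico (0 : ℝ) 1)) := by
  have hm : Measurable fun t : UnitAddCircle =>
      ((AddCircle.equivIco 1 0 t : Ico (0 : ℝ) (0 + 1)) : ℝ) :=
    measurable_subtype_coe.comp (AddCircle.measurableEquivIco (1 : ℝ) 0).measurable
  have hmk : MeasurePreserving (fun x : ℝ => (x : UnitAddCircle)) (volume.restrict (Ico (0 : ℝ) 1))
      AddCircle.haarAddCircle := by
    have h := AddCircle.measurePreserving_mk (1 : ℝ) 0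
    rw [AddCircle.volume_eq_smul_haarAddCircle, ENNReal.ofReal_one, one_smul, zero_add,
      ← restrict_Ico_eq_restrict_Ioc] at h
    exact h
  refine ⟨hm, ?_⟩
  rw [← hmk.map_eq, Measure.map_map hm hmk.measurable]
  conv_rhs => rw [← Measure.map_id (μ := volume.restrict (Ico (0 : ℝ) 1))]
  refine Measure.map_congr ?_
  filter_upwards [ae_restrict_mem measurableSet_Ico] with x hx
  rw [Function.comp, AddCircle.coe_equivIco_mk_apply]
  simpa using Int.fract_eq_self.2 hx

theorem measurePreserving_torusRep :
    MeasurePreserving torusRep (torusMeasure d) (cellMeasure d) := by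
  have h1 := measurePreserving_pi (fun _ : Fin d => AddCircle.haarAddCircle)
    (fun _ => volume.restrict (Ico (0 : ℝ) 1)) fun _ => measurePreserving_circleRep
  rw [← Measure.restrict_pi_pi] at h1
  have h2 := (PiLp.volume_preserving_toLp (Fin d)).restrict_preimage (measurableSet_cell d)
  have h3 : (WithLp.toLp 2 : (Fin d → ℝ) → E d) ⁻¹' cell d = univ.pi fun _ => Ico (0 : ℝ) 1 := by
    ext x; simp [cell]
  rw [h3] at h2
  exact h2.comp h1

theorem measure_cell : cellMeasure d univ = 1 := by
  rw [← measurePreserving_torusRep.measure_preimage nullMeasurableSet_univ, preimage_univ,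
    torusMeasure]
  simp

/-- The frequency `2π n`, for `n ∈ ℤ^d`. -/
noncomputable def freq (n : Fin d → ℤ) : E d := (2 * Real.pi) • latt n

/-- The exponential `exp(2πi⟨n,x⟩)`. -/
noncomputable def expFun (n : Fin d → ℤ) (x : E d) : ℂ :=
  Complex.exp (Complex.I * ((inner ℝ (freq n) x : ℝ) : ℂ))

theorem inner_freq (n : Fin d → ℤ) (x : E d) :
    inner ℝ (freq n) x = 2 * Real.pi * ∑ i, n i * x i := by
  rw [freq, inner_smul_left, PiLp.inner_apply]
  simp [latt, mul_comm]

theorem norm_expFun (n : Fin d → ℤ) (x : E d) : ‖expFun n x‖ = 1 := by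
  rw [expFun, Complex.norm_exp]
  simp

theorem expFun_add_latt (n m : Fin d → ℤ) (x : E d) : expFun n (x + latt m) = expFun n x := by
  rw [expFun, expFun, inner_add_right, Complex.ofReal_add, mul_add, Complex.exp_add]
  have : Complex.exp (Complex.I * ((inner ℝ (freq n) (latt m) : ℝ) : ℂ)) = 1 := by
    rw [Complex.exp_eq_one_iff]
    refine ⟨∑ i, n i * m i, ?_⟩
    rw [inner_freq]
    simp only [latt]
    push_cast
    ring
  rw [this, mul_one]

theorem continuous_expFun (n : Fin d → ℤ) : Continuous (expFun n) := by
  unfold expFun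
  fun_prop

theorem memLp_expFun (n : Fin d → ℤ) : MemLp (expFun n) 2 (cellMeasure d) :=
  MemLp.of_bound (continuous_expFun n).aestronglyMeasurable 1
    (Filter.Eventually.of_forall fun x => (norm_expFun n x).le)

/-- The exponential `exp(2πi⟨n,x⟩)` as an element of `L₂(Ω)`. -/
noncomputable def expL2 (n : Fin d → ℤ) : L2 d := (memLp_expFun n).toLp

theorem expL2_zero : expL2 (0 : Fin d → ℤ) = oneCell d := by
  refine Lp.ext ?_
  filter_upwards [(memLp_expFun (0 : Fin d → ℤ)).coeFn_toLp,
    Lp.coeFn_const 2 (cellMeasure d) (1 : ℂ)] with x h1 h2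
  rw [expL2, h1, oneCell, h2]
  simp [expFun, inner_freq]

theorem oneCell_ae : oneCell d =ᵐ[cellMeasure d] fun _ => (1 : ℂ) :=
  Lp.coeFn_const 2 _ _

/-- The Fourier basis of `L₂` of the torus. -/
noncomputable def torusBasis (d : ℕ) : HilbertBasis (Fin d → ℤ) ℂ (Lp ℂ 2 (torusMeasure d)) :=
  UnitAddTorus.mFourierBasis

/-- The isometry from `L₂(Ω)` to `L₂` of the torus. -/
noncomputable def toTorus (d : ℕ) : L2 d →ₗᵢ[ℂ] Lp ℂ 2 (torusMeasure d) :=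
  Lp.compMeasurePreservingₗᵢ ℂ torusRep measurePreserving_torusRep

theorem toTorus_expL2 (n : Fin d → ℤ) : toTorus d (expL2 n) = torusBasis d n := by
  have hb : ⇑(torusBasis d n) =ᵐ[torusMeasure d] UnitAddTorus.mFourier n := by
    have : torusBasis d n = UnitAddTorus.mFourierLp 2 n :=
      congrFun UnitAddTorus.coe_mFourierBasis n
    rw [this]
    exact UnitAddTorus.coeFn_mFourierLp 2 n
  refine Lp.ext ?_
  have h1 : ⇑(toTorus d (expL2 n)) =ᵐ[torusMeasure d] expL2 n ∘ torusRep :=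
    Lp.coeFn_compMeasurePreserving _ measurePreserving_torusRep
  have h2 : ∀ᵐ t ∂(torusMeasure d), expL2 n (torusRep t) = expFun n (torusRep t) :=
    measurePreserving_torusRep.quasiMeasurePreserving.ae (memLp_expFun n).coeFn_toLp
  filter_upwards [hb, h1, h2] with t h1 h2 h3
  rw [h1, h2, Function.comp, h3, expFun, inner_freq, UnitAddTorus.mFourier, ContinuousMap.coe_mk]
  have hf : ∀ i, fourier (n i) (t i)
      = Complex.exp (2 * Real.pi * Complex.I * n i * torusRep t i) := by
    intro i
    have : t i = ((torusRep t i : ℝ) : UnitAddCircle) :=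
      ((AddCircle.equivIco (1 : ℝ) 0).symm_apply_apply (t i)).symm
    conv_lhs => rw [this]
    rw [fourier_coe_apply]
    simp
  simp_rw [hf]
  rw [← Complex.exp_sum]
  congr 1
  push_cast
  rw [Finset.mul_sum, Finset.mul_sum]
  refine Finset.sum_congr rfl fun i _ => ?_
  ring

theorem hasSum_inner_expL2 (u v : L2 d) :
    HasSum (fun n => inner ℂ u (expL2 n) * inner ℂ (expL2 n) v) (inner ℂ u v) := by
  have := (torusBasis d).hasSum_inner_mul_inner (toTorus d u) (toTorus d v)
  simpa only [← toTorus_expL2, LinearIsometry.inner_map_map] using this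

end Fourier

/-! ### The symbol -/

section Symbol

variable {d : ℕ} {a : E d → ℝ} {μ : E d → E d → ℝ} {μm μp : ℝ}

namespace Admissible

theorem integrable_symbol (h : Admissible a μ μm μp) (y : E d) :
    Integrable fun z => (1 - Real.cos (inner ℝ z y)) * a z := by
  refine h.integrable_a.bdd_mul (c := 2) (Continuous.aestronglyMeasurable (by fun_prop))
    (Filter.Eventually.of_forall fun z => ?_)
  rw [Real.norm_eq_abs, abs_le]
  constructor <;> linarith [Real.cos_le_one (inner ℝ z y), Real.neg_one_le_cos (inner ℝ z y)]

theorem integral_modulated (h : Admissible a μ μm μp) (y : E d) :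
    ∫ z, modulated a y z = ((∫ z, a z : ℝ) : ℂ) - (symbolA a y : ℂ) := by
  have hi := integrable_modulated h.integrable_a y
  have h1 : ∫ z, modulated a y z = ∫ z, modulated a y (-z) := (integral_neg_eq_self _ _).symm
  have h2 : ∫ z, modulated a y z = ∫ z, (((a z) * Real.cos (inner ℝ z y) : ℝ) : ℂ) := by
    have h3 : ∫ z, modulated a y z = (∫ z, (modulated a y z + modulated a y (-z))) / 2 := by
      rw [integral_add hi hi.comp_neg, ← h1, add_self_div_two]
    rw [h3, ← integral_div]
    refine integral_congr_ae (Filter.Eventually.of_forall fun z => ?_)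
    simp only [modulated, h.even, inner_neg_right, Complex.ofReal_neg, Complex.ofReal_mul,
      Complex.ofReal_cos, Complex.cos, real_inner_comm z y]
    ring_nf
  rw [h2, integral_complex_ofReal, ← Complex.ofReal_sub, symbolA,
    ← integral_sub h.integrable_a (h.integrable_symbol y)]
  congr 1
  refine integral_congr_ae (Filter.Eventually.of_forall fun z => ?_)
  simp only
  ring

/-- The unweighted operator is diagonal in the Fourier basis. -/
theorem opA_unweighted_expL2 (h : Admissible a μ μm μp) (n : Fin d → ℤ) :
    opA h.unweighted 0 (expL2 n) = ((symbolA a (freq n) : ℝ) : ℂ) • expL2 n := by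
  have hb := integrable_modulated h.integrable_a (0 : E d)
  refine Lp.ext ?_
  filter_upwards [opA_spec h.unweighted 0 (expL2 n), (memLp_expFun n).coeFn_toLp,
    Lp.coeFn_smul ((symbolA a (freq n) : ℝ) : ℂ) (expL2 n)] with x h1 h2 h3
  have hU := (h.unweighted.unfold_of_bounded hb (continuous_expFun n).aestronglyMeasurable
    (fun y m => expFun_add_latt n m y) (fun y => (norm_expFun n y).le) (x := x)
    aestronglyMeasurable_const).2
  have hB : actB a (fun _ _ => 1) 0 (expL2 n) x
      = ∫ y in cell d, perSum (modulated a 0) (x - y) * (((1 : ℝ) : ℂ) * expFun n y) := by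
    refine integral_congr_ae ?_
    filter_upwards [(memLp_expFun n).coeFn_toLp] with y hy
    rw [expL2, hy, perSum_modulated, mul_assoc]
  have hconv : ∫ y, modulated a 0 (x - y) * (((1 : ℝ) : ℂ) * expFun n y)
      = expFun n x * ∫ z, modulated a (freq n) z := by
    rw [← integral_sub_left_eq_self _ volume x, ← integral_const_mul]
    refine integral_congr_ae (Filter.Eventually.of_forall fun z => ?_)
    dsimp only
    rw [modulated_zero, sub_sub_cancel]
    simp only [modulated, expFun, inner_sub_right,
      Complex.ofReal_sub, Complex.ofReal_one, one_mul, mul_sub, Complex.exp_sub, neg_mul,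
      Complex.exp_neg]
    field_simp
  have hp : potential a (fun _ _ => 1) x = ∫ z, a z := by
    simp only [potential, mul_one]
    exact integral_sub_left_eq_self a volume x
  rw [h1, h3, actA, hB, ← hU, hconv, hp, h.integral_modulated, Pi.smul_apply, smul_eq_mul,
    expL2, h2]
  ring

theorem symbolA_nonneg (h : Admissible a μ μm μp) (y : E d) : 0 ≤ symbolA a y :=
  integral_nonneg fun z => mul_nonneg (by linarith [Real.cos_le_one (inner ℝ z y)]) (h.nonneg z)

theorem calA_le (h : Admissible a μ μm μp) {r : ℝ} {y : E d} (hy : r ≤ ‖y‖) :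
    calA r a ≤ symbolA a y :=
  csInf_le ⟨0, by rintro _ ⟨z, -, rfl⟩; exact h.symbolA_nonneg z⟩ ⟨y, hy, rfl⟩

theorem pi_le_norm_freq {n : Fin d → ℤ} (hn : n ≠ 0) : Real.pi ≤ ‖freq n‖ := by
  obtain ⟨i, hi⟩ := Function.ne_iff.1 hn
  have h1 : (1 : ℝ) ≤ |(n i : ℝ)| := by exact_mod_cast Int.one_le_abs hi
  have h2 : ‖(latt n : E d) i‖ ≤ ‖(latt n : E d)‖ := PiLp.norm_apply_le _ i
  have h3 : (latt n : E d) i = n i := rfl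
  rw [h3, Real.norm_eq_abs] at h2
  rw [freq, norm_smul, Real.norm_eq_abs, abs_of_pos Real.two_pi_pos]
  nlinarith [Real.pi_pos]

/-- The spectral gap of the unweighted operator, through Parseval's identity. -/
theorem calA_mul_norm_sq_le (h : Admissible a μ μm μp) {w : L2 d}
    (hw : inner ℂ (oneCell d) w = 0) :
    calA Real.pi a * ‖w‖ ^ 2 ≤ (inner ℂ w (opA h.unweighted 0 w)).re := by
  have hsa := h.unweighted.opA_isSelfAdjoint 0
  have e1 := hasSum_inner_expL2 w w
  have e2 := hasSum_inner_expL2 w (opA h.unweighted 0 w)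
  have hc : ∀ n, inner ℂ w (expL2 n) * inner ℂ (expL2 n) w
      = ((‖inner ℂ (expL2 n) w‖ ^ 2 : ℝ) : ℂ) := fun n => by
    rw [← inner_conj_symm w, mul_comm, Complex.mul_conj, Complex.normSq_eq_norm_sq]
  have hc2 : ∀ n, inner ℂ w (expL2 n) * inner ℂ (expL2 n) (opA h.unweighted 0 w)
      = ((symbolA a (freq n) * ‖inner ℂ (expL2 n) w‖ ^ 2 : ℝ) : ℂ) := fun n => by
    have : inner ℂ (expL2 n) (opA h.unweighted 0 w) = inner ℂ (opA h.unweighted 0 (expL2 n)) w :=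
      (hsa.isSymmetric (expL2 n) w).symm
    rw [this, h.opA_unweighted_expL2, inner_smul_left, Complex.conj_ofReal, mul_left_comm, hc,
      Complex.ofReal_mul]
  simp only [hc] at e1
  simp only [hc2] at e2
  have f1 := (Complex.hasSum_re e1).mul_left (calA Real.pi a)
  have f2 := Complex.hasSum_re e2
  simp only [Complex.ofReal_re] at f1 f2
  have e3 : (inner ℂ w w).re = ‖w‖ ^ 2 := by
    rw [inner_self_eq_norm_sq_to_K]
    norm_cast
  rw [e3] at f1
  refine hasSum_le (fun n => ?_) f1 f2
  by_cases hn : n = 0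
  · rw [hn, expL2_zero, hw]; simp
  · exact mul_le_mul_of_nonneg_right (h.calA_le (pi_le_norm_freq hn)) (by positivity)

end Admissible
end Symbol

/-! ### Positivity of the infimum of the symbol -/

section Positivity

open Filter Topology

variable {d : ℕ} {a : E d → ℝ} {μ : E d → E d → ℝ} {μm μp : ℝ}

theorem volume_cos_inner_eq_one {y : E d} (hy : y ≠ 0) :
    volume {z : E d | Real.cos (inner ℝ z y) = 1} = 0 := by
  -- the set is a countable union of hyperplanes `⟨z,y⟩ = 2πk`
  have hsub : {z : E d | Real.cos (inner ℝ z y) = 1}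
      ⊆ ⋃ k : ℤ, {z : E d | inner ℝ y z = k * (2 * Real.pi)} := by
    intro z hz
    obtain ⟨k, hk⟩ := (Real.cos_eq_one_iff _).1 hz
    exact mem_iUnion.2 ⟨k, by rw [mem_ofPred_eq, real_inner_comm, hk]⟩
  refine measure_mono_null hsub (measure_iUnion_null fun k => ?_)
  set L : E d →ₗ[ℝ] ℝ := (innerSL ℝ y).toLinearMap
  set c : ℝ := k * (2 * Real.pi)
  have hyy : inner ℝ y y ≠ (0 : ℝ) := inner_self_ne_zero.2 hy
  set z₀ : E d := (c / inner ℝ y y) • y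
  have hz₀ : inner ℝ y z₀ = c := by
    rw [inner_smul_right, div_mul_cancel₀ _ hyy]
  have hset : {z : E d | inner ℝ y z = c}
      = (AffineSubspace.mk' z₀ (LinearMap.ker L) : Set (E d)) := by
    ext z
    rw [SetLike.mem_coe, AffineSubspace.mem_mk', LinearMap.mem_ker]
    change inner ℝ y z = c ↔ inner ℝ y (z - z₀) = 0
    rw [inner_sub_right, hz₀, sub_eq_zero]
  rw [hset]
  refine Measure.addHaar_affineSubspace _ _ fun htop => ?_
  have h1 : LinearMap.ker L = ⊤ := by
    rw [← AffineSubspace.direction_mk' z₀ (LinearMap.ker L), htop, AffineSubspace.direction_top]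
  have h2 : y ∈ LinearMap.ker L := h1 ▸ Submodule.mem_top
  exact hyy h2

namespace Admissible

theorem integral_pos (h : Admissible a μ μm μp) : 0 < ∫ z, a z := by
  rw [integral_pos_iff_support_of_nonneg h.nonneg h.integrable_a]
  exact h.support_pos

theorem symbolA_pos (h : Admissible a μ μm μp) {y : E d} (hy : y ≠ 0) : 0 < symbolA a y := by
  rw [symbolA, integral_pos_iff_support_of_nonneg
    (fun z => mul_nonneg (by linarith [Real.cos_le_one (inner ℝ z y)]) (h.nonneg z))
    (h.integrable_symbol y)]
  have hsub : {z | a z ≠ 0} ⊆ Function.support (fun z => (1 - Real.cos (inner ℝ z y)) * a z)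
      ∪ {z : E d | Real.cos (inner ℝ z y) = 1} := by
    intro z hz
    by_cases hc : Real.cos (inner ℝ z y) = 1
    · exact Or.inr hc
    · exact Or.inl (mul_ne_zero (sub_ne_zero.2 (Ne.symm hc)) hz)
  have := h.support_pos.trans_le ((measure_mono hsub).trans (measure_union_le _ _))
  rwa [volume_cos_inner_eq_one hy, add_zero] at this

theorem continuous_symbolA (h : Admissible a μ μm μp) : Continuous (symbolA a) := by
  refine continuous_of_dominated (bound := fun z => 2 * |a z|) (fun y => (h.integrable_symbol y).1)
    (fun y => Eventually.of_forall fun z => ?_) (h.integrable_a.abs.const_mul 2)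
    (Eventually.of_forall fun z => by fun_prop)
  rw [norm_mul, Real.norm_eq_abs, Real.norm_eq_abs]
  gcongr
  rw [abs_le]
  constructor <;> linarith [Real.cos_le_one (inner ℝ z y), Real.neg_one_le_cos (inner ℝ z y)]

/-- The Riemann–Lebesgue lemma for the symbol. -/
theorem tendsto_symbolA (h : Admissible a μ μm μp) :
    Tendsto (symbolA a) (cocompact (E d)) (𝓝 (∫ z, a z)) := by
  have h1 := tendsto_integral_exp_inner_smul_cocompact (fun z : E d => (a z : ℂ))
  have hs : Tendsto (fun y : E d => (2 * Real.pi)⁻¹ • y) (cocompact (E d)) (cocompact (E d)) :=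
    (Homeomorph.smulOfNeZero ((2 * Real.pi)⁻¹ : ℝ)
      (inv_ne_zero Real.two_pi_pos.ne')).isClosedEmbedding.tendsto_cocompact
  have h2 := h1.comp hs
  have h3 : ((fun w : E d => ∫ v, Real.fourierChar (-inner ℝ v w) • (a v : ℂ))
      ∘ fun y : E d => (2 * Real.pi)⁻¹ • y)
      = fun y => ((∫ z, a z : ℝ) : ℂ) - (symbolA a y : ℂ) := by
    funext y
    rw [← h.integral_modulated, Function.comp]
    refine integral_congr_ae (Eventually.of_forall fun z => ?_)
    simp only [modulated]
    rw [Circle.smul_def, Real.fourierChar_apply, smul_eq_mul, mul_comm, inner_smul_right,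
      real_inner_comm z y]
    congr 2
    push_cast
    have : (Real.pi : ℂ) ≠ 0 := by exact_mod_cast Real.pi_ne_zero
    field_simp
  rw [h3] at h2
  have h4 := (Complex.continuous_re.tendsto _).comp h2
  have h5 := (tendsto_const_nhds (x := ∫ z, a z)).sub h4
  simpa [Function.comp_def] using h5

theorem calA_pos (h : Admissible a μ μm μp) (hd : 1 ≤ d) : 0 < calA Real.pi a := by
  obtain ⟨K, hK, hKs⟩ := mem_cocompact.1
    (h.tendsto_symbolA.eventually (lt_mem_nhds (half_lt_self h.integral_pos)))
  have hne : (symbolA a '' {y : E d | Real.pi ≤ ‖y‖}).Nonempty := by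
    refine ⟨_, EuclideanSpace.single ⟨0, hd⟩ Real.pi, ?_, rfl⟩
    rw [mem_ofPred_eq, PiLp.norm_single, Real.norm_eq_abs, abs_of_pos Real.pi_pos]
  obtain ⟨c, hc, hcK⟩ : ∃ c > 0, ∀ y ∈ K ∩ {y : E d | Real.pi ≤ ‖y‖}, c ≤ symbolA a y := by
    have hcomp : IsCompact (K ∩ {y : E d | Real.pi ≤ ‖y‖}) :=
      hK.inter_right (isClosed_le continuous_const continuous_norm)
    rcases (K ∩ {y : E d | Real.pi ≤ ‖y‖}).eq_empty_or_nonempty with he | hn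
    · exact ⟨1, one_pos, fun y hy => by rw [he] at hy; exact hy.elim⟩
    · obtain ⟨y₀, hy₀, hmin⟩ := hcomp.exists_isMinOn hn h.continuous_symbolA.continuousOn
      refine ⟨symbolA a y₀, h.symbolA_pos fun h0 => ?_, fun y hy => hmin hy⟩
      have := hy₀.2
      rw [mem_ofPred_eq, h0, norm_zero] at this
      exact absurd this (not_le.2 Real.pi_pos)
  refine (lt_min hc (half_pos h.integral_pos)).trans_le (le_csInf hne ?_)
  rintro _ ⟨y, hy, rfl⟩
  by_cases hyK : y ∈ K
  · exact (min_le_left _ _).trans (hcK y ⟨hyK, hy⟩)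
  · exact (min_le_right _ _).trans (hKs hyK).le

/-! ### The kernel and the spectral gap of the unperturbed operator -/

theorem norm_oneCell : ‖oneCell d‖ = 1 := by
  have h : inner ℂ (oneCell d) (oneCell d) = 1 := by
    rw [L2.inner_def]
    have : (fun x => inner ℂ (oneCell d x) (oneCell d x)) =ᵐ[cellMeasure d] fun _ => (1 : ℂ) := by
      filter_upwards [oneCell_ae (d := d)] with x hx
      simp [hx]
    rw [integral_congr_ae this, integral_const, measureReal_def, measure_cell]
    simp
  rw [inner_self_eq_norm_sq_to_K] at h
  have h2 : ‖oneCell d‖ ^ 2 = 1 := Complex.ofReal_injective (by simpa using h)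
  nlinarith [norm_nonneg (oneCell d)]

theorem inner_oneCell_self : inner ℂ (oneCell d) (oneCell d) = 1 := by
  rw [inner_self_eq_norm_sq_to_K, norm_oneCell]; simp

theorem opK_oneCell (h : Admissible a μ μm μp) {b : E d → ℂ} (hb : Integrable b) :
    h.opK hb (oneCell d) =ᵐ[cellMeasure d] fun x => ∫ y, b (x - y) * (μ x y : ℂ) := by
  filter_upwards [h.opK_spec hb (oneCell d), h.ae_measurable_μ] with x h1 h2
  have h3 := (h.unfold_of_bounded hb (g := fun _ => 1) aestronglyMeasurable_const
    (fun _ _ => rfl) (fun _ => by simp) h2).2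
  simp only [mul_one] at h3
  rw [h1, h3]
  refine integral_congr_ae ?_
  filter_upwards [oneCell_ae (d := d)] with y hy
  rw [hy, mul_one]

theorem opA_zero_oneCell (h : Admissible a μ μm μp) : opA h 0 (oneCell d) = 0 := by
  refine Lp.ext ?_
  rw [h.opA_eq, sub_apply]
  filter_upwards [h.opM_spec (oneCell d), h.opK_oneCell (integrable_modulated h.integrable_a 0),
    Lp.coeFn_sub (h.opM (oneCell d)) (h.opK (integrable_modulated h.integrable_a 0) (oneCell d)),
    oneCell_ae (d := d), Lp.coeFn_zero ℂ 2 (cellMeasure d)] with x h1 h2 h3 h4 h5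
  rw [h3, Pi.sub_apply, h1, h2, h4, h5, mul_one, potential, ← integral_complex_ofReal,
    Pi.zero_apply, sub_eq_zero]
  simp only [modulated_zero, Complex.ofReal_mul]

theorem sub_inner_oneCell_smul (u : L2 d) :
    inner ℂ (oneCell d) (u - inner ℂ (oneCell d) u • oneCell d) = 0 := by
  rw [inner_sub_right, inner_smul_right, inner_oneCell_self, mul_one, sub_self]

/-- The quadratic form of `𝔸(0)` is bounded below by `μ₋ 𝒜_π(a)` off the constants. -/
theorem form_bound (h : Admissible a μ μm μp) (u : L2 d) :
    μm * calA Real.pi a * ‖u - inner ℂ (oneCell d) u • oneCell d‖ ^ 2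
      ≤ (inner ℂ u (opA h 0 u)).re := by
  set w := u - inner ℂ (oneCell d) u • oneCell d with hw
  have hTw : opA h 0 w = opA h 0 u := by
    rw [hw, map_sub, map_smul, h.opA_zero_oneCell, smul_zero, sub_zero]
  have hsym : ∀ x y, inner ℂ (opA h 0 x) y = inner ℂ x (opA h 0 y) :=
    (h.opA_isSelfAdjoint 0).isSymmetric
  have e : inner ℂ u (opA h 0 u) = inner ℂ w (opA h 0 w) := by
    rw [← hsym w, hTw, hsym, hTw]
  rw [e, mul_assoc]
  exact (mul_le_mul_of_nonneg_left (h.calA_mul_norm_sq_le (sub_inner_oneCell_smul u))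
    h.μm_pos.le).trans (h.re_inner_opA_unweighted_le 0 w)

theorem ker_opA_zero (h : Admissible a μ μm μp) (hd : 1 ≤ d) :
    (opA h 0).ker = Submodule.span ℂ {oneCell d} := by
  refine le_antisymm (fun u hu => ?_) ?_
  · have hu0 : opA h 0 u = 0 := hu
    have h1 := h.form_bound u
    rw [hu0, inner_zero_right, Complex.zero_re] at h1
    have h2 := mul_pos h.μm_pos (h.calA_pos hd)
    have h3 : ‖u - inner ℂ (oneCell d) u • oneCell d‖ ^ 2 ≤ 0 := by
      by_contra hc
      nlinarith
    have h4 : u - inner ℂ (oneCell d) u • oneCell d = 0 := by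
      rw [← norm_eq_zero]
      exact pow_eq_zero_iff two_ne_zero |>.1 (le_antisymm h3 (by positivity))
    exact Submodule.mem_span_singleton.2 ⟨_, (sub_eq_zero.1 h4).symm⟩
  · rw [Submodule.span_singleton_le_iff_mem]
    exact h.opA_zero_oneCell

theorem projP_apply (h : Admissible a μ μm μp) (hd : 1 ≤ d) (u : L2 d) :
    projP h u = inner ℂ (oneCell d) u • oneCell d := by
  refine (Submodule.eq_starProjection_of_mem_of_inner_eq_zero ?_ fun w hw => ?_)
  · rw [h.ker_opA_zero hd]
    exact Submodule.smul_mem _ _ (Submodule.mem_span_singleton_self _)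
  · rw [h.ker_opA_zero hd] at hw
    obtain ⟨c, rfl⟩ := Submodule.mem_span_singleton.1 hw
    rw [inner_smul_right, ← inner_conj_symm, sub_inner_oneCell_smul]
    simp

theorem spectrum_opA_zero (h : Admissible a μ μm μp) (hd : 1 ≤ d) {x : ℝ}
    (hx : x ∈ spectrum ℝ (opA h 0)) : x = 0 ∨ μm * calA Real.pi a ≤ x :=
  spectrum_gap_of_form_bound (h.opA_isSelfAdjoint 0) (mul_pos h.μm_pos (h.calA_pos hd))
    (fun u => by
      have := h.form_bound u
      rwa [← h.projP_apply hd] at this) hx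

theorem expL2_ne (hd : 1 ≤ d) : ∃ w : L2 d, w ≠ 0 ∧ inner ℂ (oneCell d) w = 0 := by
  have : Nontrivial (Fin d → ℤ) := ⟨0, fun _ => 1, fun hc => by
    simpa using congrFun hc ⟨0, hd⟩⟩
  obtain ⟨n, hn⟩ := exists_ne (0 : Fin d → ℤ)
  refine ⟨expL2 n, fun h0 => ?_, ?_⟩
  · have := (torusBasis d).orthonormal.1 n
    rw [← toTorus_expL2, h0, map_zero, norm_zero] at this
    exact zero_ne_one this
  · rw [← expL2_zero, ← (toTorus d).inner_map_map, toTorus_expL2, toTorus_expL2]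
    exact (torusBasis d).orthonormal.2 hn.symm

theorem le_dZero (h : Admissible a μ μm μp) (hd : 1 ≤ d) : μm * calA Real.pi a ≤ dZero h := by
  refine le_gapAtZero (h.opA_isSelfAdjoint 0) (fun h0 => ?_) fun x hx => h.spectrum_opA_zero hd hx
  obtain ⟨w, hw, hw1⟩ := expL2_ne hd
  have h1 := h.form_bound w
  rw [h0, hw1, zero_smul, sub_zero] at h1
  simp only [zero_apply, inner_zero_right, Complex.zero_re] at h1
  have h2 := mul_pos (mul_pos h.μm_pos (h.calA_pos hd)) (pow_pos (norm_pos_iff.2 hw) 2)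
  linarith

theorem dZero_pos (h : Admissible a μ μm μp) (hd : 1 ≤ d) : 0 < dZero h :=
  (mul_pos h.μm_pos (h.calA_pos hd)).trans_le (h.le_dZero hd)

theorem spectrum_opA_zero_gap (h : Admissible a μ μm μp) {x : ℝ}
    (hx : x ∈ spectrum ℝ (opA h 0)) : x = 0 ∨ dZero h ≤ x :=
  eq_zero_or_gapAtZero_le (h.opA_nonneg 0) hx

end Admissible
end Positivity

/-! ### Taylor expansion of `𝔸(ξ)` -/

section Taylor

theorem norm_exp_neg_I_mul_sub_one_le (t : ℝ) :
    ‖1 - Complex.exp (-Complex.I * t)‖ ≤ |t| := by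
  have h := Real.norm_exp_I_mul_ofReal_sub_one_le (x := -t)
  rw [norm_sub_rev]
  simpa [Real.norm_eq_abs] using h

/-- One step of the Taylor estimate: integrating a bound for the derivative on `[0, ∞)`. -/
theorem norm_le_of_hasDerivAt_of_norm_le {f f' : ℝ → ℂ} (hf : ∀ t, HasDerivAt f (f' t) t)
    (h0 : f 0 = 0) (k : ℕ) (hb : ∀ t, 0 ≤ t → ‖f' t‖ ≤ t ^ k / k.factorial) {t : ℝ} (ht : 0 ≤ t) :
    ‖f t‖ ≤ t ^ (k + 1) / (k + 1).factorial := by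
  have hB : ∀ x : ℝ, HasDerivAt (fun x : ℝ => x ^ (k + 1) / (k + 1).factorial)
      (x ^ k / k.factorial) x := fun x => by
    have := (hasDerivAt_pow (k + 1) x).div_const ((k + 1).factorial : ℝ)
    refine this.congr_deriv ?_
    rw [Nat.factorial_succ, Nat.add_sub_cancel]
    push_cast
    have : (k.factorial : ℝ) ≠ 0 := by positivity
    field_simp
  refine image_norm_le_of_norm_deriv_right_le_deriv_boundary (a := 0) (b := t) (f' := f')
    (fun x _ => (hf x).continuousAt.continuousWithinAt) (fun x _ => (hf x).hasDerivWithinAt)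
    (by simp [h0]) hB (fun x hx => hb x hx.1) ⟨ht, le_rfl⟩

theorem norm_exp_taylor_two_le (t : ℝ) :
    ‖1 - Complex.exp (-Complex.I * t) - Complex.I * t‖ ≤ |t| ^ 2 / 2 := by
  have key : ∀ t : ℝ, 0 ≤ t → ‖1 - Complex.exp (-Complex.I * t) - Complex.I * t‖ ≤ t ^ 2 / 2 := by
    intro t ht
    have hd : ∀ t : ℝ, HasDerivAt (fun t : ℝ => 1 - Complex.exp (-Complex.I * t) - Complex.I * t)
        (-Complex.I * (1 - Complex.exp (-Complex.I * t))) t := fun t => by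
      have h1 : HasDerivAt (fun t : ℝ => (t : ℂ)) 1 t := Complex.ofRealCLM.hasDerivAt
      have h2 := ((h1.const_mul (-Complex.I)).cexp.const_sub 1).sub (h1.const_mul Complex.I)
      refine h2.congr_deriv ?_
      ring
    have := norm_le_of_hasDerivAt_of_norm_le hd (by simp) 1 (fun s hs => by
      rw [norm_mul, norm_neg, Complex.norm_I, one_mul]
      simpa [abs_of_nonneg hs] using norm_exp_neg_I_mul_sub_one_le s) ht
    simpa using this
  rcases le_total 0 t with h | h
  · rw [abs_of_nonneg h]; exact key t h
  · have h1 := key (-t) (by linarith)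
    rw [abs_of_nonpos h]
    refine le_trans (le_of_eq ?_) h1
    rw [← RCLike.norm_conj]
    simp [← Complex.exp_conj]

theorem norm_exp_taylor_three_le (t : ℝ) :
    ‖1 - Complex.exp (-Complex.I * t) - Complex.I * t - (t : ℂ) ^ 2 / 2‖ ≤ |t| ^ 3 / 6 := by
  have key : ∀ t : ℝ, 0 ≤ t →
      ‖1 - Complex.exp (-Complex.I * t) - Complex.I * t - (t : ℂ) ^ 2 / 2‖ ≤ t ^ 3 / 6 := by
    intro t ht
    have hd : ∀ t : ℝ, HasDerivAt
        (fun t : ℝ => 1 - Complex.exp (-Complex.I * t) - Complex.I * t - (t : ℂ) ^ 2 / 2)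
        (-Complex.I * (1 - Complex.exp (-Complex.I * t) - Complex.I * t)) t := fun t => by
      have h1 : HasDerivAt (fun t : ℝ => (t : ℂ)) 1 t := Complex.ofRealCLM.hasDerivAt
      have h2 := (((h1.const_mul (-Complex.I)).cexp.const_sub 1).sub (h1.const_mul Complex.I)).sub
        ((h1.pow 2).div_const 2)
      refine h2.congr_deriv ?_
      push_cast
      linear_combination -(t : ℂ) * Complex.I_sq
    have := norm_le_of_hasDerivAt_of_norm_le hd (by simp) 2 (fun s hs => by
      rw [norm_mul, norm_neg, Complex.norm_I, one_mul]
      simpa [abs_of_nonneg hs, Nat.factorial] using norm_exp_taylor_two_le s) ht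
    simpa [Nat.factorial] using this
  rcases le_total 0 t with h | h
  · rw [abs_of_nonneg h]; exact key t h
  · have h1 := key (-t) (by linarith)
    rw [abs_of_nonpos h]
    refine le_trans (le_of_eq ?_) h1
    rw [← RCLike.norm_conj]
    simp [← Complex.exp_conj, map_ofNat]

variable {d : ℕ} {a : E d → ℝ} {μ : E d → E d → ℝ} {μm μp : ℝ}

namespace Admissible

theorem moment_nonneg (h : Admissible a μ μm μp) (k : ℕ) : 0 ≤ moment k a :=
  integral_nonneg fun z => mul_nonneg (by positivity) (h.nonneg z)

theorem integrable_mul_of_norm_le (h : Admissible a μ μm μp) {f : E d → ℂ} (hf : Continuous f)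
    {k : ℕ} (hk : k ∈ ({1, 2, 3} : Set ℕ)) {C : ℝ} (hb : ∀ z, ‖f z‖ ≤ C * ‖z‖ ^ k) :
    Integrable fun z => f z * (a z : ℂ) := by
  refine ((h.integrable_moment k hk).const_mul C).mono' (hf.aestronglyMeasurable.mul
    (Complex.continuous_ofReal.comp_aestronglyMeasurable h.integrable_a.1))
    (Filter.Eventually.of_forall fun z => ?_)
  rw [norm_mul, Complex.norm_real, Real.norm_eq_abs, abs_of_nonneg (h.nonneg z), ← mul_assoc]
  exact mul_le_mul_of_nonneg_right (hb z) (h.nonneg z)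

theorem integral_norm_mul_le (h : Admissible a μ μm μp) {f : E d → ℂ} (hf : Continuous f)
    {k : ℕ} (hk : k ∈ ({1, 2, 3} : Set ℕ)) {C : ℝ} (hb : ∀ z, ‖f z‖ ≤ C * ‖z‖ ^ k) :
    ∫ z, ‖f z * (a z : ℂ)‖ ≤ C * moment k a := by
  rw [moment, ← integral_const_mul]
  refine integral_mono (h.integrable_mul_of_norm_le hf hk hb).norm
    ((h.integrable_moment k hk).const_mul C) fun z => ?_
  dsimp only
  rw [norm_mul, Complex.norm_real, Real.norm_eq_abs, abs_of_nonneg (h.nonneg z), ← mul_assoc]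
  exact mul_le_mul_of_nonneg_right (hb z) (h.nonneg z)

theorem norm_opK_mul_le (h : Admissible a μ μm μp) {f b : E d → ℂ} (hf : Continuous f)
    {k : ℕ} (hk : k ∈ ({1, 2, 3} : Set ℕ)) {C : ℝ} (hb : ∀ z, ‖f z‖ ≤ C * ‖z‖ ^ k)
    (hbi : Integrable b) (hbf : ∀ z, b z = f z * (a z : ℂ)) :
    ‖h.opK hbi‖ ≤ μp * (C * moment k a) := by
  refine (h.norm_opK_le hbi).trans (mul_le_mul_of_nonneg_left ?_ h.μp_pos.le)
  refine le_trans (le_of_eq ?_) (h.integral_norm_mul_le hf hk hb)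
  exact integral_congr_ae (Filter.Eventually.of_forall fun z => by simp only [hbf])

end Admissible

/-- The kernel of the first-order term of `𝔸(ξ)`. -/
noncomputable def kernelOne (a : E d → ℝ) (ξ z : E d) : ℂ :=
  Complex.I * ((inner ℝ ξ z : ℝ) : ℂ) * (a z : ℂ)

/-- The kernel of the second-order term of `𝔸(ξ)`. -/
noncomputable def kernelTwo (a : E d → ℝ) (ξ z : E d) : ℂ :=
  ((inner ℝ ξ z : ℝ) : ℂ) ^ 2 / 2 * (a z : ℂ)

namespace Admissible

theorem integrable_kernelOne (h : Admissible a μ μm μp) (ξ : E d) : Integrable (kernelOne a ξ) :=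
  h.integrable_mul_of_norm_le (k := 1) (C := ‖ξ‖) (by fun_prop) (by simp) fun z => by
    rw [norm_mul, Complex.norm_I, one_mul, Complex.norm_real, pow_one]
    exact abs_real_inner_le_norm ξ z

theorem integrable_kernelTwo (h : Admissible a μ μm μp) (ξ : E d) : Integrable (kernelTwo a ξ) :=
  h.integrable_mul_of_norm_le (k := 2) (C := ‖ξ‖ ^ 2 / 2) (by fun_prop) (by simp) fun z => by
    rw [norm_div, norm_pow, Complex.norm_real, Complex.norm_two, Real.norm_eq_abs]
    have := pow_le_pow_left₀ (abs_nonneg _) (abs_real_inner_le_norm ξ z) 2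
    rw [mul_pow] at this
    linarith

/-- The first-order term of `𝔸(ξ)`. -/
noncomputable def opOne (h : Admissible a μ μm μp) (ξ : E d) : L2 d →L[ℂ] L2 d :=
  h.opK (h.integrable_kernelOne ξ)

/-- The second-order term of `𝔸(ξ)`. -/
noncomputable def opTwo (h : Admissible a μ μm μp) (ξ : E d) : L2 d →L[ℂ] L2 d :=
  h.opK (h.integrable_kernelTwo ξ)

theorem opA_sub (h : Admissible a μ μm μp) (ξ : E d) :
    opA h ξ - opA h 0 = h.opK ((integrable_modulated h.integrable_a 0).sub
      (integrable_modulated h.integrable_a ξ)) := by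
  rw [h.opA_eq, h.opA_eq, sub_sub_sub_cancel_left, h.opK_sub]

theorem norm_opA_sub_le (h : Admissible a μ μm μp) (ξ : E d) :
    ‖opA h ξ - opA h 0‖ ≤ μp * (‖ξ‖ * moment 1 a) := by
  rw [h.opA_sub]
  refine h.norm_opK_mul_le (k := 1)
    (f := fun z => 1 - Complex.exp (-Complex.I * ((inner ℝ ξ z : ℝ) : ℂ))) (by fun_prop) (by simp)
    (fun z => ?_) _ (fun z => ?_)
  · rw [pow_one]
    exact (norm_exp_neg_I_mul_sub_one_le _).trans (abs_real_inner_le_norm ξ z)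
  · rw [Pi.sub_apply, modulated_zero, modulated]
    ring

theorem norm_opOne_le (h : Admissible a μ μm μp) (ξ : E d) :
    ‖h.opOne ξ‖ ≤ μp * (‖ξ‖ * moment 1 a) :=
  h.norm_opK_mul_le (k := 1) (f := fun z => Complex.I * ((inner ℝ ξ z : ℝ) : ℂ)) (by fun_prop)
    (by simp) (fun z => by
      rw [norm_mul, Complex.norm_I, one_mul, Complex.norm_real, pow_one]
      exact abs_real_inner_le_norm ξ z) _ fun z => rfl

theorem norm_opA_sub_opOne_le (h : Admissible a μ μm μp) (ξ : E d) :
    ‖opA h ξ - opA h 0 - h.opOne ξ‖ ≤ μp * (‖ξ‖ ^ 2 / 2 * moment 2 a) := by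
  rw [h.opA_sub, opOne, h.opK_sub]
  refine h.norm_opK_mul_le (k := 2)
    (f := fun z => 1 - Complex.exp (-Complex.I * ((inner ℝ ξ z : ℝ) : ℂ))
      - Complex.I * ((inner ℝ ξ z : ℝ) : ℂ)) (by fun_prop) (by simp) (fun z => ?_) _ (fun z => ?_)
  · refine (norm_exp_taylor_two_le _).trans ?_
    have := pow_le_pow_left₀ (abs_nonneg _) (abs_real_inner_le_norm ξ z) 2
    rw [mul_pow] at this
    linarith
  · rw [Pi.sub_apply, Pi.sub_apply, modulated_zero, modulated, kernelOne]
    ring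

theorem norm_opA_sub_opOne_sub_opTwo_le (h : Admissible a μ μm μp) (ξ : E d) :
    ‖opA h ξ - opA h 0 - h.opOne ξ - h.opTwo ξ‖ ≤ μp * (‖ξ‖ ^ 3 / 6 * moment 3 a) := by
  rw [h.opA_sub, opOne, opTwo, h.opK_sub, h.opK_sub]
  refine h.norm_opK_mul_le (k := 3)
    (f := fun z => 1 - Complex.exp (-Complex.I * ((inner ℝ ξ z : ℝ) : ℂ))
      - Complex.I * ((inner ℝ ξ z : ℝ) : ℂ) - ((inner ℝ ξ z : ℝ) : ℂ) ^ 2 / 2) (by fun_prop)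
      (by simp) (fun z => ?_) _ (fun z => ?_)
  · refine (norm_exp_taylor_three_le _).trans ?_
    have := pow_le_pow_left₀ (abs_nonneg _) (abs_real_inner_le_norm ξ z) 3
    rw [mul_pow] at this
    linarith
  · rw [Pi.sub_apply, Pi.sub_apply, Pi.sub_apply, modulated_zero, modulated, kernelOne, kernelTwo]
    ring

theorem opOne_isSelfAdjoint (h : Admissible a μ μm μp) (ξ : E d) : IsSelfAdjoint (h.opOne ξ) := by
  refine h.opK_isSelfAdjoint _ fun z => ?_
  simp only [kernelOne, map_mul, Complex.conj_ofReal, Complex.conj_I, h.even, inner_neg_right]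
  push_cast
  ring

/-- An odd kernel has no mean value: exchanging `x` and `y` changes the sign of the double
integral. -/
theorem inner_oneCell_opK_of_odd (h : Admissible a μ μm μp) {b : E d → ℂ} (hb : Integrable b)
    (hodd : ∀ z, b (-z) = -b z) : inner ℂ (oneCell d) (h.opK hb (oneCell d)) = 0 := by
  have e : inner ℂ (oneCell d) (h.opK hb (oneCell d))
      = -inner ℂ (oneCell d) (h.opK hb (oneCell d)) := by
    conv_lhs => rw [h.inner_opK, ← integral_prod_swap]
    rw [h.inner_opK, ← integral_neg]
    have hae1 : ∀ᵐ q ∂((cellMeasure d).prod (cellMeasure d)), oneCell d q.1 = 1 :=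
      Measure.quasiMeasurePreserving_fst.ae oneCell_ae
    have hae2 : ∀ᵐ q ∂((cellMeasure d).prod (cellMeasure d)), oneCell d q.2 = 1 :=
      Measure.quasiMeasurePreserving_snd.ae oneCell_ae
    refine integral_congr_ae ?_
    filter_upwards [hae1, hae2] with q h1 h2
    have : perSum b (q.2 - q.1) = -perSum b (q.1 - q.2) := by
      rw [perSum, perSum, ← tsum_neg_latt, ← tsum_neg]
      refine tsum_congr fun n => ?_
      rw [← hodd]
      congr 1
      abel
    simp only [Prod.swap]
    rw [h1, h2, this, h.symm]
    ring
  exact self_eq_neg.1 e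

end Admissible
end Taylor

/-! ### The cell problem and the effective coefficients -/

section CellProblem

variable {d : ℕ} {a : E d → ℝ} {μ : E d → E d → ℝ} {μm μp : ℝ}

namespace Admissible

theorem integrable_coord (h : Admissible a μ μm μp) (j : Fin d) :
    Integrable fun z : E d => ((z j : ℝ) : ℂ) * (a z : ℂ) :=
  h.integrable_mul_of_norm_le (k := 1) (C := 1) (by fun_prop) (by simp) fun z => by
    rw [Complex.norm_real, pow_one, one_mul]
    exact PiLp.norm_apply_le z j

theorem integrable_coord_mul (h : Admissible a μ μm μp) (i j : Fin d) :
    Integrable fun z : E d => ((z i : ℝ) : ℂ) * ((z j : ℝ) : ℂ) * (a z : ℂ) :=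
  h.integrable_mul_of_norm_le (k := 2) (C := 1) (by fun_prop) (by simp) fun z => by
    rw [norm_mul, Complex.norm_real, Complex.norm_real, one_mul, sq]
    exact mul_le_mul (PiLp.norm_apply_le z i) (PiLp.norm_apply_le z j) (norm_nonneg _)
      (norm_nonneg _)

/-- The right-hand side `∫ a(x-y) μ(x,y) (x_j - y_j) dy` of the `j`-th cell problem. -/
noncomputable def flux (h : Admissible a μ μm μp) (j : Fin d) : L2 d :=
  h.opK (h.integrable_coord j) (oneCell d)

theorem flux_ae (h : Admissible a μ μm μp) (j : Fin d) :
    h.flux j =ᵐ[cellMeasure d] fun x => ∫ y, ((a (x - y) * μ x y * (x j - y j) : ℝ) : ℂ) := by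
  filter_upwards [h.opK_oneCell (h.integrable_coord j)] with x hx
  rw [flux, hx]
  refine integral_congr_ae (Filter.Eventually.of_forall fun y => ?_)
  simp only [PiLp.sub_apply]
  push_cast
  ring

theorem conj_flux (h : Admissible a μ μm μp) (j : Fin d) :
    ∀ᵐ x ∂(cellMeasure d), starRingEnd ℂ (h.flux j x) = h.flux j x := by
  filter_upwards [h.flux_ae j] with x hx
  rw [hx, integral_complex_ofReal, Complex.conj_ofReal]

theorem inner_oneCell_flux (h : Admissible a μ μm μp) (j : Fin d) :
    inner ℂ (oneCell d) (h.flux j) = 0 :=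
  h.inner_oneCell_opK_of_odd _ fun z => by
    rw [PiLp.neg_apply, h.even]
    push_cast
    ring

theorem inner_oneCell (u : L2 d) : inner ℂ (oneCell d) u = ∫ x in cell d, u x := by
  rw [L2.inner_def]
  refine integral_congr_ae ?_
  filter_upwards [oneCell_ae (d := d)] with x hx
  rw [hx, RCLike.inner_apply, map_one, mul_one]

/-- In operator form the cell problem reads `𝔸(0) v = w_j`, `v ⊥ 1`, with `w_j = h.flux j`. -/
theorem isCellSolution_iff (h : Admissible a μ μm μp) (j : Fin d) (v : L2 d) :
    IsCellSolution a μ j v ↔ opA h 0 v = h.flux j ∧ inner ℂ (oneCell d) v = 0 := by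
  have hb := integrable_modulated h.integrable_a (0 : E d)
  have hE : ∀ᵐ x ∂(cellMeasure d), perExt v x = v x :=
    (ae_restrict_iff' (measurableSet_cell d)).2
      (Filter.Eventually.of_forall fun y hy => perExt_of_mem_cell v hy)
  have hL : opA h 0 v =ᵐ[cellMeasure d]
      fun x => ∫ y, ((a (x - y) * μ x y : ℝ) : ℂ) * (perExt v x - perExt v y) := by
    rw [h.opA_eq, sub_apply]
    filter_upwards [h.opM_spec v, h.ae_opK_eq hb v, Lp.coeFn_sub (h.opM v) (h.opK hb v), hE,
      h.ae_measurable_μ] with x h1 h2 h3 h4 h5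
    have hi := (h.unfold_of_bounded hb (g := fun _ => 1) aestronglyMeasurable_const
      (fun _ _ => rfl) (fun _ => by simp) h5).1
    simp only [modulated_zero, mul_one] at hi h2
    rw [h3, Pi.sub_apply, h1, ← h2.2, h4, potential, ← integral_complex_ofReal,
      ← integral_mul_const, ← integral_sub]
    · refine integral_congr_ae (Filter.Eventually.of_forall fun y => ?_)
      simp only
      push_cast
      ring
    · refine (hi.mul_const (v x)).congr (Filter.Eventually.of_forall fun y => ?_)
      simp only
      push_cast
      ring
    · exact h2.1
  rw [IsCellSolution, ← inner_oneCell, and_congr_left_iff]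
  intro _
  constructor
  · intro hv
    refine Lp.ext ?_
    filter_upwards [hL, hv, h.flux_ae j] with x h1 h2 h3
    rw [h1, h2, h3]
  · intro hv
    filter_upwards [hL, h.flux_ae j] with x h1 h2
    rw [← h1, ← h2, hv]

theorem existsUnique_cellSolution (h : Admissible a μ μm μp) (hd : 1 ≤ d) (j : Fin d) :
    ∃! v : L2 d, IsCellSolution a μ j v := by
  obtain ⟨S, hTS, hST, hPS, hSP, -⟩ := exists_reduced_inverse (h.opA_isSelfAdjoint 0)
    (h.dZero_pos hd) fun x hx => h.spectrum_opA_zero_gap hx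
  have hP : ∀ u, (opA h 0).ker.starProjection u = inner ℂ (oneCell d) u • oneCell d :=
    h.projP_apply hd
  refine ⟨S (h.flux j), (h.isCellSolution_iff j _).2 ⟨?_, ?_⟩, fun v hv => ?_⟩
  · have := congrArg (fun A : L2 d →L[ℂ] L2 d => A (h.flux j)) hTS
    simpa [hP, h.inner_oneCell_flux] using this
  · have h1 := congrArg (fun A : L2 d →L[ℂ] L2 d => A (h.flux j)) hPS
    have h2 : inner ℂ (oneCell d) (S (h.flux j)) • oneCell d = 0 := by
      rw [← hP]; exact h1
    have h3 := congrArg (inner ℂ (oneCell d)) h2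
    rwa [inner_smul_right, inner_oneCell_self, mul_one, inner_zero_right] at h3
  · obtain ⟨h1, h2⟩ := (h.isCellSolution_iff j v).1 hv
    have h3 := congrArg (fun A : L2 d →L[ℂ] L2 d => A v) hST
    simpa [h1, hP, h2] using h3.symm

theorem inner_eq_sum_mul (ξ z : E d) : inner ℝ ξ z = ∑ j, ξ j * z j := by
  rw [PiLp.inner_apply]
  exact Finset.sum_congr rfl fun j _ => by simp [mul_comm]

theorem opOne_oneCell (h : Admissible a μ μm μp) (ξ : E d) :
    h.opOne ξ (oneCell d) = Complex.I • ∑ j, (ξ j : ℂ) • h.flux j := by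
  rw [opOne, h.opK_eq_sum (c := fun j => Complex.I * (ξ j : ℂ)) _ h.integrable_coord fun z => ?_,
    sum_apply, Finset.smul_sum]
  · exact Finset.sum_congr rfl fun j _ => by rw [smul_apply, smul_smul, flux]
  · rw [kernelOne, inner_eq_sum_mul]
    push_cast
    rw [Finset.mul_sum, Finset.sum_mul]
    exact Finset.sum_congr rfl fun j _ => by ring

theorem inner_oneCell_opTwo (h : Admissible a μ μm μp) (ξ : E d) :
    inner ℂ (oneCell d) (h.opTwo ξ (oneCell d)) = (1 / 2 : ℂ) * ∑ i, ∑ j,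
      inner ℂ (oneCell d) (h.opK (h.integrable_coord_mul i j) (oneCell d))
        * (ξ i : ℂ) * (ξ j : ℂ) := by
  rw [opTwo, h.opK_eq_sum (ι := Fin d × Fin d)
    (c := fun p => (1 / 2 : ℂ) * (ξ p.1 : ℂ) * (ξ p.2 : ℂ))
    _ (fun p => h.integrable_coord_mul p.1 p.2) fun z => ?_,
    sum_apply, inner_sum, Fintype.sum_prod_type, Finset.mul_sum]
  · refine Finset.sum_congr rfl fun i _ => ?_
    rw [Finset.mul_sum]
    refine Finset.sum_congr rfl fun j _ => ?_
    rw [smul_apply, inner_smul_right]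
    ring
  · rw [kernelTwo, inner_eq_sum_mul, Fintype.sum_prod_type]
    push_cast
    rw [sq, Finset.sum_mul_sum, Finset.sum_div, Finset.sum_mul]
    refine Finset.sum_congr rfl fun i _ => ?_
    rw [Finset.sum_div, Finset.sum_mul]
    exact Finset.sum_congr rfl fun j _ => by ring

theorem coeffG_eq (h : Admissible a μ μm μp) (v : Fin d → L2 d) (i j : Fin d) :
    coeffG a μ v i j = inner ℂ (oneCell d) (h.opK (h.integrable_coord_mul i j) (oneCell d))
      - inner ℂ (h.flux i) (v j) - inner ℂ (h.flux j) (v i) := by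
  have hin : ∀ i j, inner ℂ (h.flux i) (v j) = ∫ x in cell d, v j x * h.flux i x := fun i j => by
    rw [L2.inner_def]
    refine integral_congr_ae ?_
    filter_upwards [h.conj_flux i] with x hx
    rw [RCLike.inner_apply, hx]
  have hint : ∀ i j, Integrable (fun x => v j x * h.flux i x) (cellMeasure d) := fun i j => by
    refine (L2.integrable_inner (𝕜 := ℂ) (h.flux i) (v j)).congr ?_
    filter_upwards [h.conj_flux i] with x hx
    rw [RCLike.inner_apply, hx]
  have hintK : Integrable (fun x => h.opK (h.integrable_coord_mul i j) (oneCell d) x)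
      (cellMeasure d) := by
    refine (L2.integrable_inner (𝕜 := ℂ) (oneCell d)
      (h.opK (h.integrable_coord_mul i j) (oneCell d))).congr ?_
    filter_upwards [oneCell_ae (d := d)] with x hx
    rw [hx, RCLike.inner_apply, map_one, mul_one]
  have hsub : Integrable (fun x => h.opK (h.integrable_coord_mul i j) (oneCell d) x
      - v j x * h.flux i x) (cellMeasure d) := hintK.sub (hint i j)
  rw [inner_oneCell, hin, hin, ← integral_sub hintK (hint i j), ← integral_sub hsub (hint j i)]
  refine integral_congr_ae ?_
  filter_upwards [h.opK_oneCell (h.integrable_coord_mul i j), h.opK_oneCell (h.integrable_coord i),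
    h.opK_oneCell (h.integrable_coord j), h.ae_measurable_μ] with x h1 h2 h3 h4
  have hi : ∀ {b : E d → ℂ}, Integrable b → Integrable fun y => b (x - y) * (μ x y : ℂ) :=
    fun hb => by
      simpa using (h.unfold_of_bounded hb (g := fun _ => 1) aestronglyMeasurable_const
        (fun _ _ => rfl) (fun _ => by simp) h4).1
  have hi2 := hi (h.integrable_coord_mul i j)
  have hi3 := (hi (h.integrable_coord i)).const_mul (v j x)
  have hi4 := (hi (h.integrable_coord j)).const_mul (v i x)
  have hi5 := hi2.sub hi3
  simp only [Pi.sub_def] at hi5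
  rw [flux, flux, h1, h2, h3, ← integral_const_mul, ← integral_const_mul,
    ← integral_sub hi2 hi3, ← integral_sub hi5 hi4]
  refine integral_congr_ae (Filter.Eventually.of_forall fun y => ?_)
  simp only [PiLp.sub_apply]
  push_cast
  ring

/-- The second-order effective operator is multiplication by the quadratic form
`½ ∑ g_ij ξ_i ξ_j` on the constants: with `V = ∑ ξ_j v_j`, the first-order term sends `1` to
`i 𝔸(0) V`, so that the reduced inverse takes it back to `i V`. -/
theorem effective_operator_eq (h : Admissible a μ μm μp) (hd : 1 ≤ d) {v : Fin d → L2 d}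
    (hv : ∀ j, IsCellSolution a μ j (v j)) {S : L2 d →L[ℂ] L2 d}
    (hST : S * opA h 0 = 1 - projP h) (ξ : E d) :
    projP h * h.opTwo ξ * projP h - projP h * h.opOne ξ * S * h.opOne ξ * projP h
      = ((1 / 2 : ℂ) * ∑ i, ∑ j, coeffG a μ v i j * (ξ i : ℂ) * (ξ j : ℂ)) • projP h := by
  set V : L2 d := ∑ j, (ξ j : ℂ) • v j with hV
  have hTV : opA h 0 V = ∑ j, (ξ j : ℂ) • h.flux j := by
    rw [hV, map_sum]
    exact Finset.sum_congr rfl fun j _ => by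
      rw [map_smul, ((h.isCellSolution_iff j _).1 (hv j)).1]
  have hV0 : inner ℂ (oneCell d) V = 0 := by
    rw [hV, inner_sum]
    exact Finset.sum_eq_zero fun j _ => by
      rw [inner_smul_right, ((h.isCellSolution_iff j _).1 (hv j)).2, mul_zero]
  have hS : S (h.opOne ξ (oneCell d)) = Complex.I • V := by
    have h3 := congrArg (fun A : L2 d →L[ℂ] L2 d => A V) hST
    have h4 : S (opA h 0 V) = V := by simpa [h.projP_apply hd, hV0] using h3
    rw [h.opOne_oneCell, map_smul, ← hTV, h4]
  have hWV : inner ℂ (∑ j, (ξ j : ℂ) • h.flux j) V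
      = ∑ i, ∑ j, inner ℂ (h.flux i) (v j) * (ξ i : ℂ) * (ξ j : ℂ) := by
    rw [sum_inner]
    refine Finset.sum_congr rfl fun i _ => ?_
    rw [hV, inner_sum]
    refine Finset.sum_congr rfl fun j _ => ?_
    rw [inner_smul_left, inner_smul_right, Complex.conj_ofReal]
    ring
  have hc : inner ℂ (oneCell d) (h.opOne ξ (S (h.opOne ξ (oneCell d))))
      = ∑ i, ∑ j, inner ℂ (h.flux i) (v j) * (ξ i : ℂ) * (ξ j : ℂ) := by
    have hsym : inner ℂ (oneCell d) (h.opOne ξ (Complex.I • V))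
        = inner ℂ (h.opOne ξ (oneCell d)) (Complex.I • V) :=
      ((h.opOne_isSelfAdjoint ξ).isSymmetric _ _).symm
    rw [hS, hsym, h.opOne_oneCell, inner_smul_left, inner_smul_right, hWV, ← mul_assoc,
      Complex.conj_I, neg_mul, Complex.I_mul_I, neg_neg, one_mul]
  have hg : (1 / 2 : ℂ) * ∑ i, ∑ j, coeffG a μ v i j * (ξ i : ℂ) * (ξ j : ℂ)
      = inner ℂ (oneCell d) (h.opTwo ξ (oneCell d))
        - inner ℂ (oneCell d) (h.opOne ξ (S (h.opOne ξ (oneCell d)))) := by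
    have hcomm : ∑ i, ∑ j, inner ℂ (h.flux j) (v i) * (ξ i : ℂ) * (ξ j : ℂ)
        = ∑ i, ∑ j, inner ℂ (h.flux i) (v j) * (ξ i : ℂ) * (ξ j : ℂ) := by
      rw [Finset.sum_comm]
      exact Finset.sum_congr rfl fun i _ => Finset.sum_congr rfl fun j _ => by ring
    rw [hc, h.inner_oneCell_opTwo]
    simp only [h.coeffG_eq, sub_mul, Finset.sum_sub_distrib]
    rw [hcomm]
    ring
  ext1 u
  rw [hg]
  simp only [sub_apply, smul_apply, mul_apply_eq_comp, h.projP_apply hd, map_smul,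
    smul_smul, sub_smul]
  rw [mul_comm (inner ℂ (oneCell d) u), mul_comm (inner ℂ (oneCell d) u)]

end Admissible
end CellProblem

/-! ### The threshold estimates -/

section Estimates

variable {d : ℕ} {a : E d → ℝ} {μ : E d → E d → ℝ} {μm μp : ℝ}

namespace Admissible

theorem perturbation_le (h : Admissible a μ μm μp) (hd : 1 ≤ d) {ξ : E d}
    (hξ : ‖ξ‖ ≤ deltaZero a μm μp) : μp * (‖ξ‖ * moment 1 a) ≤ dZero h / 6 := by
  have hM := h.moment_nonneg 1
  have hA := mul_pos h.μm_pos (h.calA_pos hd)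
  have h1 : ‖ξ‖ ≤ 3⁻¹ * (2 ^ d)⁻¹ * (moment 1 a)⁻¹ * μp⁻¹ * μm * calA Real.pi a :=
    hξ.trans (min_le_right _ _)
  have h2 : ((2 : ℝ) ^ d)⁻¹ ≤ 2⁻¹ :=
    inv_anti₀ two_pos (by simpa using pow_le_pow_right₀ (one_le_two (α := ℝ)) hd)
  have hdz := h.le_dZero hd
  rcases hM.eq_or_lt with h0 | h0
  · rw [← h0]
    have := h.dZero_pos hd
    simp only [mul_zero]
    positivity
  · calc μp * (‖ξ‖ * moment 1 a)
        ≤ μp * ((3⁻¹ * (2 ^ d)⁻¹ * (moment 1 a)⁻¹ * μp⁻¹ * μm * calA Real.pi a) * moment 1 a) := by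
          have := h.μp_pos.le
          gcongr
      _ = 3⁻¹ * (2 ^ d)⁻¹ * (μm * calA Real.pi a) := by
          have := h.μp_pos.ne'
          have := h0.ne'
          field_simp
      _ ≤ 3⁻¹ * 2⁻¹ * dZero h := by gcongr
      _ = dZero h / 6 := by ring

theorem exists_gap (h : Admissible a μ μm μp) (hd : 1 ≤ d) {ξ : E d}
    (hξ : ‖ξ‖ ≤ deltaZero a μm μp) : ∃ S G, PerturbedGap (opA h 0) (opA h ξ) (projP h) S
      (projF h ξ) G (dZero h) (μp * (‖ξ‖ * moment 1 a)) :=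
  exists_perturbedGap (h.opA_isSelfAdjoint 0) (h.dZero_pos hd)
    (fun _ hx => h.spectrum_opA_zero_gap hx) (h.opA_nonneg ξ) (h.norm_opA_sub_le ξ)
    (h.perturbation_le hd hξ)

theorem continuousOn_chi_spectrum (h : Admissible a μ μm μp) (hd : 1 ≤ d) {ξ : E d}
    (hξ : ‖ξ‖ ≤ deltaZero a μm μp) :
    ContinuousOn (chi (Icc 0 (dZero h / 3))) (spectrum ℝ (opA h ξ)) :=
  continuousOn_chi (h.dZero_pos hd) fun _ hx => spectrum_of_norm_sub_le (h.opA_isSelfAdjoint 0)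
    (h.dZero_pos hd) (fun _ hy => h.spectrum_opA_zero_gap hy) (h.opA_nonneg ξ)
    ((h.norm_opA_sub_le ξ).trans (h.perturbation_le hd hξ)) hx

theorem norm_projF_sub_projP_le (h : Admissible a μ μm μp) (hd : 1 ≤ d) {ξ : E d}
    (hξ : ‖ξ‖ ≤ deltaZero a μm μp) :
    ‖projF h ξ - projP h‖ ≤ constC1 d μp (moment 1 a) (dZero h) * ‖ξ‖ := by
  obtain ⟨S, G, hG⟩ := h.exists_gap hd hξ
  refine hG.norm_F_sub_P.trans ?_
  have hM := h.moment_nonneg 1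
  have hμ := h.μp_pos
  have hD := inv_pos.2 (h.dZero_pos hd)
  have hp : 1 ≤ (Real.pi + 2) * Real.pi⁻¹ := by
    rw [← div_eq_mul_inv, one_le_div Real.pi_pos]; linarith
  have h2 : (1 : ℝ) ≤ 2 ^ d := one_le_pow₀ one_le_two
  have h3 : 1 ≤ (Real.pi + 2) * Real.pi⁻¹ * 2 ^ d := one_le_mul_of_one_le_of_one_le hp h2
  have h4 : 0 ≤ (dZero h)⁻¹ * μp * moment 1 a * ‖ξ‖ := by positivity
  calc 12 / 5 * (μp * (‖ξ‖ * moment 1 a) * (dZero h)⁻¹)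
      = 12 / 5 * ((dZero h)⁻¹ * μp * moment 1 a * ‖ξ‖) := by ring
    _ ≤ 6 * ((Real.pi + 2) * Real.pi⁻¹ * 2 ^ d) * ((dZero h)⁻¹ * μp * moment 1 a * ‖ξ‖) := by
        gcongr
        linarith
    _ = constC1 d μp (moment 1 a) (dZero h) * ‖ξ‖ := by rw [constC1]; ring

theorem norm_opA_mul_projF_sub_le (h : Admissible a μ μm μp) (hd : 1 ≤ d) {v : Fin d → L2 d}
    (hv : ∀ j, IsCellSolution a μ j (v j)) {ξ : E d} (hξ : ‖ξ‖ ≤ deltaZero a μm μp) :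
    ‖opA h ξ * projF h ξ
        - ((1 / 2 : ℂ) * ∑ i, ∑ j, coeffG a μ v i j * (ξ i : ℂ) * (ξ j : ℂ)) • projP h‖
      ≤ constC2 μp (moment 1 a) (moment 2 a) (moment 3 a) (dZero h) * ‖ξ‖ ^ 3 := by
  obtain ⟨S, G, hG⟩ := h.exists_gap hd hξ
  have hPT : projP h * h.opOne ξ * projP h = 0 := by
    have h0 : inner ℂ (oneCell d) (h.opOne ξ (oneCell d)) = 0 :=
      h.inner_oneCell_opK_of_odd _ fun z => by
        simp only [kernelOne, inner_neg_right, h.even]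
        push_cast
        ring
    ext1 u
    simp [h.projP_apply hd, h0]
  rw [← h.effective_operator_eq hd hv hG.S_mul_T₀ ξ]
  refine (hG.norm_T_mul_F_sub hPT (h.norm_opOne_le ξ) (h.norm_opA_sub_opOne_le ξ)
    (h.norm_opA_sub_opOne_sub_opTwo_le ξ)).trans ?_
  have hM1 := h.moment_nonneg 1
  have hM2 := h.moment_nonneg 2
  have hM3 := h.moment_nonneg 3
  have hμ := h.μp_pos
  have hD := inv_pos.2 (h.dZero_pos hd)
  set D := dZero h
  set M₁ := moment 1 a
  set M₂ := moment 2 a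
  set M₃ := moment 3 a
  have hp : 1 / 2 ≤ (Real.pi + 2) / (2 * Real.pi) := by
    rw [div_le_div_iff₀ two_pos Real.two_pi_pos]; linarith
  have e1 : (3 * M₂) * (12 * M₁) ≤ (3 * M₂ + M₃) * (12 * M₁ + 3 * M₂ + M₃) := by
    gcongr <;> linarith
  have e2 : (6 * M₁) ^ 3 ≤ (6 * M₁ + 3 * M₂ + M₃) ^ 3 := by
    gcongr; linarith
  have e3 : 1 / 2 * (μp * M₃ + μp ^ 2 / D * ((3 * M₂) * (12 * M₁)) + μp ^ 3 / D ^ 2 * (6 * M₁) ^ 3)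
      ≤ constC2 μp M₁ M₂ M₃ D := by
    have := h.dZero_pos hd
    rw [constC2]
    gcongr
  refine le_trans ?_ (mul_le_mul_of_nonneg_right e3 (by positivity))
  have t1 : 0 ≤ μp * M₃ * ‖ξ‖ ^ 3 := by positivity
  have t2 : 0 ≤ μp ^ 2 * D⁻¹ * (M₂ * M₁) * ‖ξ‖ ^ 3 := by positivity
  have t3 : 0 ≤ μp ^ 3 * D⁻¹ ^ 2 * M₁ ^ 3 * ‖ξ‖ ^ 3 := by positivity
  have r1 : μp ^ 2 / D = μp ^ 2 * D⁻¹ := div_eq_mul_inv _ _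
  have r2 : μp ^ 3 / D ^ 2 = μp ^ 3 * D⁻¹ ^ 2 := by rw [inv_pow, div_eq_mul_inv]
  rw [r1, r2]
  calc _ = 1 / 6 * (μp * M₃ * ‖ξ‖ ^ 3) + 2.2 * (μp ^ 2 * D⁻¹ * (M₂ * M₁) * ‖ξ‖ ^ 3)
        + 14 * (μp ^ 3 * D⁻¹ ^ 2 * M₁ ^ 3 * ‖ξ‖ ^ 3) := by ring
    _ ≤ 1 / 2 * (μp * M₃ * ‖ξ‖ ^ 3) + 18 * (μp ^ 2 * D⁻¹ * (M₂ * M₁) * ‖ξ‖ ^ 3)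
        + 108 * (μp ^ 3 * D⁻¹ ^ 2 * M₁ ^ 3 * ‖ξ‖ ^ 3) := by gcongr <;> norm_num
    _ = _ := by ring

theorem constC1_anti (h : Admissible a μ μm μp) {D D' : ℝ} (hD' : 0 < D') (hD : D' ≤ D) :
    constC1 d μp (moment 1 a) D ≤ constC1 d μp (moment 1 a) D' := by
  have := h.moment_nonneg 1
  have := h.μp_pos
  rw [constC1, constC1]
  have := Real.pi_pos
  gcongr

theorem constC2_anti (h : Admissible a μ μm μp) {D D' : ℝ} (hD' : 0 < D') (hD : D' ≤ D) :
    constC2 μp (moment 1 a) (moment 2 a) (moment 3 a) D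
      ≤ constC2 μp (moment 1 a) (moment 2 a) (moment 3 a) D' := by
  have := h.moment_nonneg 1
  have := h.moment_nonneg 2
  have := h.moment_nonneg 3
  have := h.μp_pos
  rw [constC2, constC2]
  have := Real.pi_pos
  gcongr

end Admissible
end Estimates
end NonlocalHomogenization

theorem theorem2p1 (d : ℕ) (hd : 1 ≤ d) (a : E d → ℝ) (μ : E d → E d → ℝ) (μm μp : ℝ)
    (h : Admissible a μ μm μp) :
    -- the kernel of `𝔸(0)` consists of the constants, and the spectral gap is positive
    (opA h 0).ker = Submodule.span ℂ {oneCell d} ∧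
    0 < calA Real.pi a ∧
    μm * calA Real.pi a ≤ dZero h ∧
    -- the spectral projector is meaningful: the operators are self-adjoint and the indicator
    -- function of `[0, d₀/3]` is continuous on their spectra
    (∀ ξ : E d, IsSelfAdjoint (opA h ξ)) ∧
    (∀ ξ : E d, ‖ξ‖ ≤ deltaZero a μm μp →
      ContinuousOn (chi (Set.Icc 0 (dZero h / 3))) (spectrum ℝ (opA h ξ))) ∧
    -- the cell problems are uniquely solvable
    (∀ j : Fin d, ∃! v : L2 d, IsCellSolution a μ j v) ∧
    -- the estimates
    (∀ ξ : E d, ‖ξ‖ ≤ deltaZero a μm μp →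
      ‖projF h ξ - projP h‖ ≤ constC1 d μp (moment 1 a) (dZero h) * ‖ξ‖) ∧
    (∀ v : Fin d → L2 d, (∀ j, IsCellSolution a μ j (v j)) →
      ∀ ξ : E d, ‖ξ‖ ≤ deltaZero a μm μp →
        ‖opA h ξ * projF h ξ
            - ((1 / 2 : ℂ) * ∑ i, ∑ j, coeffG a μ v i j * (ξ i : ℂ) * (ξ j : ℂ)) • projP h‖
          ≤ constC2 μp (moment 1 a) (moment 2 a) (moment 3 a) (dZero h) * ‖ξ‖ ^ 3) ∧
    -- the constants are controlled by `d`, `μ₋`, `μ₊`, `M₁`, `M₂`, `M₃`, `𝒜_π(a)` alone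
    constC1 d μp (moment 1 a) (dZero h) ≤ constC1 d μp (moment 1 a) (μm * calA Real.pi a) ∧
    constC2 μp (moment 1 a) (moment 2 a) (moment 3 a) (dZero h)
      ≤ constC2 μp (moment 1 a) (moment 2 a) (moment 3 a) (μm * calA Real.pi a) := by
  have hA := mul_pos h.μm_pos (h.calA_pos hd)
  exact ⟨h.ker_opA_zero hd, h.calA_pos hd, h.le_dZero hd, h.opA_isSelfAdjoint,
    fun _ hξ => h.continuousOn_chi_spectrum hd hξ, h.existsUnique_cellSolution hd,
    fun _ hξ => h.norm_projF_sub_projP_le hd hξ,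
    fun _ hv _ hξ => h.norm_opA_mul_projF_sub_le hd hv hξ,
    h.constC1_anti hA (h.le_dZero hd), h.constC2_anti hA (h.le_dZero hd)⟩
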